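/- Let $\mathbb F$ be a field of characteristic $p>0$, let $S=\mathbb F[x_0,\dots,x_n]$ with its standard grading, and let $\mathfrak m=(x_0,\dots,x_n)$. Let $f_1,\dots,f_c$ be a regular sequence of homogeneous forms in $S$ such that $\operatorname{Proj} S/(f_1,\dots,f_c)$ is smooth over $\mathbb F$. Set $d_i=\deg f_i$ and $d=\sum_{i=1}^c d_i$. Let $t\ge 0$ be an integer with $t\le p$ and $$t\,d_i\ \ge\ (n+1-c)(d-c)+1\qquad\text{for every } 1\le i\le c .$$ Consider the composition of ring homomorphisms $$S/(f_1,\dots,f_c)\longrightarrow S/(f_1^p,\dots,f_c^p)\longrightarrow S/(f_1^t,\dots,f_c^t),$$ where the first map is induced by the Frobenius endomorphism $s\mapsto s^p$ of $S$ and the second is the canonical surjection. Then the map that it induces on the degree $0$ pieces of local cohomology, $$\tilde F_{[t]}\colon\ \big[H^{n+1-c}_{\mathfrak m}\big(S/(f_1,\dots,f_c)\big)\big]_0\longrightarrow \big[H^{n+1-c}_{\mathfrak m}\big(S/(f_1^t,\dots,f_c^t)\big)\big]_0,$$ is injective. Here local cohomology and its grading are computed by the Čech complex on $x_0,\dots,x_n$.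 -/

import Mathlib

set_option linter.unusedSectionVars false

universe u

namespace FrobCI

/-! ### Quotients of graded algebras and their `Proj` -/

section Grading

variable {F A : Type u} [CommRing F] [CommRing A] [Algebra F A]

/-- The grading induced on `A ⧸ I` by a grading of `A`: the degree `j` piece is the image of
`𝒜 j`. -/
def quotientGrading (𝒜 : ℕ → Submodule F A) (I : Ideal A) (j : ℕ) : Submodule F (A ⧸ I) :=
  (𝒜 j).map (Ideal.Quotient.mkₐ F I).toLinearMap

theorem mk_mem_quotientGrading {𝒜 : ℕ → Submodule F A} (I : Ideal A) {j : ℕ} {a : A}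
    (ha : a ∈ 𝒜 j) : Ideal.Quotient.mk I a ∈ quotientGrading 𝒜 I j :=
  ⟨a, ha, rfl⟩

instance quotientGrading_gradedMonoid (𝒜 : ℕ → Submodule F A) [SetLike.GradedMonoid 𝒜]
    (I : Ideal A) : SetLike.GradedMonoid (quotientGrading 𝒜 I) where
  one_mem := ⟨1, SetLike.GradedOne.one_mem, map_one (Ideal.Quotient.mkₐ F I)⟩
  mul_mem := by
    rintro i j _ _ ⟨a, ha, rfl⟩ ⟨b, hb, rfl⟩
    exact ⟨a * b, SetLike.GradedMul.mul_mem ha hb, map_mul (Ideal.Quotient.mkₐ F I) a b⟩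

/-- The map `A → ⨁ j, (A ⧸ I)_j` taking `a` to the classes of its homogeneous components. -/
noncomputable def toQuotientComponents (𝒜 : ℕ → Submodule F A) [GradedAlgebra 𝒜]
    (I : Ideal A) : A →+ DirectSum ℕ (fun j => quotientGrading 𝒜 I j) :=
  (DirectSum.map (fun j =>
    (((Ideal.Quotient.mkₐ F I).toLinearMap.submoduleMap (𝒜 j)).toAddMonoidHom :
      𝒜 j →+ quotientGrading 𝒜 I j))).comp
    (DirectSum.decomposeAddEquiv 𝒜).toAddMonoidHom

theorem toQuotientComponents_apply (𝒜 : ℕ → Submodule F A) [GradedAlgebra 𝒜]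
    (I : Ideal A) (a : A) (j : ℕ) :
    (toQuotientComponents 𝒜 I a j : A ⧸ I) =
      Ideal.Quotient.mk I (DirectSum.decompose 𝒜 a j : A) := rfl

theorem toQuotientComponents_of_mem (𝒜 : ℕ → Submodule F A) [GradedAlgebra 𝒜]
    (I : Ideal A) {j : ℕ} {a : A} (ha : a ∈ 𝒜 j) :
    toQuotientComponents 𝒜 I a = DirectSum.of (fun j => quotientGrading 𝒜 I j) j
      ⟨Ideal.Quotient.mk I a, mk_mem_quotientGrading I ha⟩ := by
  refine DFinsupp.ext fun k => Subtype.ext ?_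
  refine (toQuotientComponents_apply 𝒜 I a k).trans ?_
  by_cases h : j = k
  · subst h
    rw [DirectSum.decompose_of_mem_same 𝒜 ha, DirectSum.of_eq_same]
  · rw [DirectSum.decompose_of_mem_ne 𝒜 ha h, DirectSum.of_eq_of_ne _ _ _ (Ne.symm h), map_zero]
    rfl

theorem coe_toQuotientComponents (𝒜 : ℕ → Submodule F A) [GradedAlgebra 𝒜]
    (I : Ideal A) (a : A) :
    DirectSum.coeAddMonoidHom (quotientGrading 𝒜 I) (toQuotientComponents 𝒜 I a) =
      Ideal.Quotient.mk I a := by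
  refine DirectSum.Decomposition.inductionOn 𝒜 ?_ ?_ ?_ a
  · rw [map_zero, map_zero, map_zero]
  · intro i m
    rw [toQuotientComponents_of_mem 𝒜 I m.2, DirectSum.coeAddMonoidHom_of]
  · intro a b ha hb
    rw [map_add, map_add, map_add, ha, hb]

/-- The quotient of a graded algebra by a homogeneous ideal is graded. -/
noncomputable abbrev quotientGradedAlgebra (𝒜 : ℕ → Submodule F A) [GradedAlgebra 𝒜]
    (I : Ideal A) (hI : I.IsHomogeneous 𝒜) : GradedAlgebra (quotientGrading 𝒜 I) :=
  { quotientGrading_gradedMonoid 𝒜 I,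
    DirectSum.Decomposition.ofAddHom (quotientGrading 𝒜 I)
      (QuotientAddGroup.lift I.toAddSubgroup (toQuotientComponents 𝒜 I) (by
        intro a ha
        refine DFinsupp.ext fun j => Subtype.ext ?_
        exact Ideal.Quotient.eq_zero_iff_mem.mpr (hI j ha)) :
        A ⧸ I →+ DirectSum ℕ (fun j => quotientGrading 𝒜 I j))
      (by
        refine AddMonoidHom.ext fun b => ?_
        obtain ⟨a, rfl⟩ := Ideal.Quotient.mk_surjective b
        exact coe_toQuotientComponents 𝒜 I a)
      (by
        refine DirectSum.addHom_ext fun j b => ?_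
        obtain ⟨_, a, ha, rfl⟩ := b
        refine (congrArg _ (DirectSum.coeAddMonoidHom_of (quotientGrading 𝒜 I) j _)).trans ?_
        exact toQuotientComponents_of_mem 𝒜 I ha) with }

open AlgebraicGeometry CategoryTheory in
/-- The structure morphism `Proj (A ⧸ I) ⟶ Spec F`, for a homogeneous ideal `I` of a graded
`F`-algebra `A`. -/
noncomputable def projStructureMap (𝒜 : ℕ → Submodule F A) [GradedAlgebra 𝒜]
    (I : Ideal A) (hI : I.IsHomogeneous 𝒜) :
    letI := quotientGradedAlgebra 𝒜 I hI
    Proj (quotientGrading 𝒜 I) ⟶ Spec (CommRingCat.of F) :=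
  letI := quotientGradedAlgebra 𝒜 I hI
  Proj.toSpecZero (quotientGrading 𝒜 I) ≫
    Spec.map (CommRingCat.ofHom (algebraMap F (quotientGrading 𝒜 I 0)))

/-- `Proj (A ⧸ I)` is smooth over `F`. -/
def IsSmoothProj (𝒜 : ℕ → Submodule F A) [GradedAlgebra 𝒜]
    (I : Ideal A) (hI : I.IsHomogeneous 𝒜) : Prop :=
  AlgebraicGeometry.Smooth (projStructureMap 𝒜 I hI)

end Grading

/-! ### Čech complexes and local cohomology -/

section Cech

variable {ι : Type*} [LinearOrder ι] {A : Type u} [CommRing A]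

/-- The localization `A_{x_T}`, where `x_T` is the product of the `x i` with `i ∈ T`. -/
abbrev Loc (x : ι → A) (T : Finset ι) : Type u := Localization.Away (∏ i ∈ T, x i)

/-- The canonical map `A_{x_T} → A_{x_U}` for `T ⊆ U`. -/
noncomputable def Loc.res (x : ι → A) {T U : Finset ι} (h : T ⊆ U) : Loc x T →ₐ[A] Loc x U :=
  IsLocalization.liftAlgHom (M := Submonoid.powers (∏ i ∈ T, x i)) (f := Algebra.ofId A (Loc x U))
    (by
      rintro ⟨_, e, rfl⟩
      rw [map_pow]
      exact (isUnit_of_dvd_unit (map_dvd _ (Finset.prod_dvd_prod_of_subset T U x h))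
        (IsLocalization.Away.algebraMap_isUnit (S := Loc x U) (∏ i ∈ U, x i))).pow e)

/-- The Čech cochains of degree `k`: families `(σ_T)` with `σ_T ∈ A_{x_T}`, where `T` runs over
the `k`-element sets of indices. -/
abbrev Cochain (x : ι → A) (k : ℕ) : Type _ := ∀ T : {T : Finset ι // T.card = k}, Loc x T.1

/-- For `i ∈ T`, the set `T \ {i}`. -/
def face {k : ℕ} (T : {T : Finset ι // T.card = k + 1}) (i : T.1) :
    {T : Finset ι // T.card = k} :=
  ⟨T.1.erase i, by rw [Finset.card_erase_of_mem i.2, T.2, Nat.add_sub_cancel]⟩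

theorem face_subset {k : ℕ} (T : {T : Finset ι // T.card = k + 1}) (i : T.1) :
    (face T i).1 ⊆ T.1 :=
  Finset.erase_subset i.1 T.1

/-- The Čech differential
`(dσ)_T = ∑_{i ∈ T} (-1)^(position of i in T) σ_{T \ {i}}`, positions starting at `0`. -/
noncomputable def cechD (x : ι → A) (k : ℕ) : Cochain x k →ₗ[A] Cochain x (k + 1) :=
  LinearMap.pi fun T => ∑ i : T.1, (-1 : A) ^ (T.1.filter (· < i.1)).card •
    ((Loc.res x (face_subset T i)).toLinearMap ∘ₗ LinearMap.proj (face T i))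

theorem cechD_apply (x : ι → A) (k : ℕ) (σ : Cochain x k)
    (T : {T : Finset ι // T.card = k + 1}) :
    cechD x k σ T = ∑ i : T.1, (-1 : A) ^ (T.1.filter (· < i.1)).card •
      Loc.res x (face_subset T i) (σ (face T i)) := by
  simp only [cechD, LinearMap.pi_apply, LinearMap.sum_apply, LinearMap.smul_apply]
  rfl

/-- The Čech coboundaries in degree `k` (there are none in degree `0`). -/
noncomputable def coboundaries (x : ι → A) : (k : ℕ) → Submodule A (Cochain x k)
  | 0 => ⊥
  | k + 1 => LinearMap.range (cechD x k)

/-- The local cohomology `H^k` of the ring `A` with support in the ideal generated by the finite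
family `x`: the `k`-th cohomology of the Čech complex
`0 → A → ⨁ A_{x_i} → ⨁ A_{x_i x_j} → ⋯ → A_{∏ x_i} → 0`. -/
abbrev LocalCohomology (x : ι → A) (k : ℕ) : Type _ :=
  LinearMap.ker (cechD x k) ⧸ (coboundaries x k).comap (LinearMap.ker (cechD x k)).subtype

theorem Loc.res_res (x : ι → A) {T U V : Finset ι} (h : T ⊆ U) (h' : U ⊆ V) (z : Loc x T) :
    Loc.res x h' (Loc.res x h z) = Loc.res x (h.trans h') z := by
  have : ((Loc.res x h').comp (Loc.res x h)) = Loc.res x (h.trans h') :=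
    IsLocalization.algHom_ext (Submonoid.powers (∏ i ∈ T, x i)) (Subsingleton.elim _ _)
  exact DFunLike.congr_fun this z

theorem Loc.res_congr (x : ι → A) {k : ℕ} (σ : Cochain x k) {U V : {T : Finset ι // T.card = k}}
    {T : Finset ι} (e : U = V) (hU : U.1 ⊆ T) (hV : V.1 ⊆ T) :
    Loc.res x hU (σ U) = Loc.res x hV (σ V) := by
  subst e
  rfl

theorem card_filter_erase {T : Finset ι} {i j : ι} (hi : i ∈ T) (h : i < j) :
    (T.filter (· < j)).card = ((T.erase i).filter (· < j)).card + 1 ∧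
      ((T.erase j).filter (· < i)).card = (T.filter (· < i)).card := by
  rw [Finset.filter_erase, Finset.filter_erase, Finset.card_erase_add_one
    (Finset.mem_filter.mpr ⟨hi, h⟩), Finset.erase_eq_of_notMem (a := j)]
  · exact ⟨rfl, rfl⟩
  · exact fun hj => absurd (Finset.mem_filter.mp hj).2 (not_lt.mpr h.le)

/-- The Čech differentials compose to zero. -/
theorem cechD_cechD (x : ι → A) (k : ℕ) (σ : Cochain x k) :
    cechD x (k + 1) (cechD x k σ) = 0 := by
  funext T
  rw [cechD_apply, Pi.zero_apply]
  simp only [cechD_apply, map_sum, map_smul, Loc.res_res, Finset.smul_sum, smul_smul, ← pow_add]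
  rw [Finset.sum_sigma']
  have hmem : ∀ (i : T.1) (j : (face T i).1), i.1 ∈ (T.1.erase j.1) := fun i j =>
    Finset.mem_erase.mpr ⟨fun h => (Finset.mem_erase.mp j.2).1 h.symm, i.2⟩
  refine Finset.sum_involution
    (fun q _ => ⟨⟨q.2.1, face_subset T q.1 q.2.2⟩, ⟨q.1.1, hmem q.1 q.2⟩⟩) ?_ ?_ ?_ ?_
  · rintro ⟨i, j⟩ -
    have hji : j.1 ≠ i.1 := (Finset.mem_erase.mp j.2).1
    have hj : j.1 ∈ T.1 := face_subset T i j.2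
    have e : face (face T ⟨j.1, hj⟩) ⟨i.1, hmem i j⟩ = face (face T i) j :=
      Subtype.ext Finset.erase_right_comm
    have key := Loc.res_congr x σ e ((face_subset _ _).trans (face_subset _ _))
      ((face_subset _ _).trans (face_subset _ _)) (T := T.1)
    dsimp only
    rw [key, ← add_smul]
    convert zero_smul A _
    change (-1 : A) ^ ((T.1.filter (· < i.1)).card + ((T.1.erase i.1).filter (· < j.1)).card) +
      (-1 : A) ^ ((T.1.filter (· < j.1)).card + ((T.1.erase j.1).filter (· < i.1)).card) = 0
    rcases lt_or_gt_of_ne hji with h | h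
    · obtain ⟨h1, h2⟩ := card_filter_erase hj h
      rw [h1, h2]
      ring
    · obtain ⟨h1, h2⟩ := card_filter_erase i.2 h
      rw [h1, h2]
      ring
  · rintro ⟨i, j⟩ - - h
    exact (Finset.mem_erase.mp j.2).1 (congrArg (fun q => q.1.1) h)
  · exact fun _ _ => Finset.mem_univ _
  · exact fun _ _ => rfl

section Functoriality

variable {B : Type u} [CommRing B] (φ : A →+* B) (x : ι → A) (y : ι → B) (p : ℕ)
  (h : ∀ i, φ (x i) = y i ^ p)

theorem isUnit_map_prod (h : ∀ i, φ (x i) = y i ^ p) (T : Finset ι) :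
    IsUnit (((algebraMap B (Loc y T)).comp φ) (∏ i ∈ T, x i)) := by
  rw [RingHom.comp_apply, map_prod, Finset.prod_congr rfl fun i _ => h i, Finset.prod_pow, map_pow]
  exact (IsLocalization.Away.algebraMap_isUnit (S := Loc y T) (∏ i ∈ T, y i)).pow p

/-- If `φ : A → B` takes each `x i` to a power `y i ^ p`, the induced map `A_{x_T} → B_{y_T}`. -/
noncomputable def Loc.map (T : Finset ι) : Loc x T →+* Loc y T :=
  Localization.awayLift ((algebraMap B (Loc y T)).comp φ) _ (isUnit_map_prod φ x y p h T)

theorem Loc.map_algebraMap (T : Finset ι) (a : A) :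
    Loc.map φ x y p h T (algebraMap A (Loc x T) a) = algebraMap B (Loc y T) (φ a) :=
  IsLocalization.Away.lift_eq _ (isUnit_map_prod φ x y p h T) a

theorem Loc.map_res {T U : Finset ι} (hTU : T ⊆ U) (z : Loc x T) :
    Loc.map φ x y p h U (Loc.res x hTU z) = Loc.res y hTU (Loc.map φ x y p h T z) := by
  have : ((Loc.map φ x y p h U).comp (Loc.res x hTU).toRingHom) =
      ((Loc.res y hTU).toRingHom.comp (Loc.map φ x y p h T)) := by
    refine IsLocalization.ringHom_ext (Submonoid.powers (∏ i ∈ T, x i)) (RingHom.ext fun a => ?_)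
    change Loc.map φ x y p h U (Loc.res x hTU (algebraMap A _ a)) =
      Loc.res y hTU (Loc.map φ x y p h T (algebraMap A _ a))
    rw [AlgHom.commutes, Loc.map_algebraMap, Loc.map_algebraMap, AlgHom.commutes]
  exact DFunLike.congr_fun this z

/-- The map of Čech cochains induced by a ring homomorphism `φ : A → B` that takes each `x i` to
`y i ^ p`. -/
noncomputable def cochainMap (k : ℕ) : Cochain x k →ₛₗ[φ] Cochain y k where
  toFun σ T := Loc.map φ x y p h T.1 (σ T)
  map_add' σ τ := by
    funext T
    exact map_add _ _ _
  map_smul' a σ := by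
    funext T
    change Loc.map φ x y p h T.1 (a • σ T) = φ a • Loc.map φ x y p h T.1 (σ T)
    rw [Algebra.smul_def, map_mul, Loc.map_algebraMap, ← Algebra.smul_def]

theorem cochainMap_cechD (k : ℕ) (σ : Cochain x k) :
    cochainMap φ x y p h (k + 1) (cechD x k σ) = cechD y k (cochainMap φ x y p h k σ) := by
  funext T
  change Loc.map φ x y p h T.1 (cechD x k σ T) = _
  rw [cechD_apply, cechD_apply, map_sum]
  refine Finset.sum_congr rfl fun i _ => ?_
  rw [Algebra.smul_def, map_mul, Loc.map_algebraMap, ← Algebra.smul_def, map_pow, map_neg, map_one,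
    Loc.map_res]
  rfl

theorem cochainMap_mem_coboundaries (k : ℕ) (σ : Cochain x k) (hσ : σ ∈ coboundaries x k) :
    cochainMap φ x y p h k σ ∈ coboundaries y k := by
  cases k with
  | zero =>
    obtain rfl : σ = 0 := hσ
    rw [map_zero]
    exact zero_mem _
  | succ k =>
    obtain ⟨τ, rfl⟩ := hσ
    exact ⟨cochainMap φ x y p h k τ, (cochainMap_cechD φ x y p h k τ).symm⟩

/-- The map of Čech cocycles induced by `φ`. -/
noncomputable def cocycleMap (k : ℕ) :
    LinearMap.ker (cechD x k) →ₛₗ[φ] LinearMap.ker (cechD y k) :=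
  ((cochainMap φ x y p h k).comp (LinearMap.ker (cechD x k)).subtype).codRestrict _ (by
    intro σ
    change cechD y k (cochainMap φ x y p h k σ.1) = 0
    rw [← cochainMap_cechD, LinearMap.mem_ker.mp σ.2, map_zero])

/-- The map of local cohomology induced by a ring homomorphism `φ : A → B` that takes each `x i`
to `y i ^ p`. -/
noncomputable def localCohomologyMap (k : ℕ) : LocalCohomology x k →ₛₗ[φ] LocalCohomology y k :=
  Submodule.mapQ _ _ (cocycleMap φ x y p h k) fun σ hσ =>
    cochainMap_mem_coboundaries φ x y p h k σ.1 hσ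

end Functoriality

section Graded

variable {F : Type u} [CommRing F] [Algebra F A]

/-- A grading by natural numbers, extended by zero to integer degrees. -/
def intPiece (𝒜 : ℕ → Submodule F A) : ℤ → Submodule F A
  | .ofNat i => 𝒜 i
  | .negSucc _ => ⊥

variable (𝒜 : ℕ → Submodule F A) [SetLike.GradedMonoid 𝒜] (x : ι → A) (hx : ∀ i, x i ∈ 𝒜 1)

theorem mul_mem_intPiece {m : ℤ} {i : ℕ} {a b : A} (ha : a ∈ intPiece 𝒜 m) (hb : b ∈ 𝒜 i) :
    a * b ∈ intPiece 𝒜 (m + i) := by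
  cases m with
  | ofNat m => exact SetLike.GradedMul.mul_mem (A := 𝒜) ha hb
  | negSucc m =>
    obtain rfl : a = 0 := ha
    rw [zero_mul]
    exact zero_mem _

theorem prod_pow_mem (hx : ∀ i, x i ∈ 𝒜 1) (T : Finset ι) (e : ℕ) : (∏ i ∈ T, x i) ^ e ∈ 𝒜 (e * T.card) := by
  have h : (∏ i ∈ T, x i) ∈ 𝒜 (∑ _i ∈ T, 1) :=
    SetLike.prod_mem_graded 𝒜 (fun _ => 1) x fun i _ => hx i
  rw [Finset.sum_const, smul_eq_mul, mul_one] at h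
  simpa using SetLike.pow_mem_graded e h

/-- The degree `j` piece of `A_{x_T}`, where the `x i` have degree `1`: the fractions `a / x_T ^ e`
with `a` homogeneous of degree `j + e * #T`. -/
def Loc.degreePiece (T : Finset ι) (j : ℤ) : AddSubgroup (Loc x T) where
  carrier := {z | ∃ (e : ℕ) (a : A), a ∈ intPiece 𝒜 (j + (e * T.card : ℕ)) ∧
    z * algebraMap A (Loc x T) ((∏ i ∈ T, x i) ^ e) = algebraMap A (Loc x T) a}
  zero_mem' := ⟨0, 0, zero_mem _, by rw [zero_mul, map_zero]⟩
  add_mem' := by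
    rintro z w ⟨e, a, ha, hz⟩ ⟨e', a', ha', hw⟩
    refine ⟨e + e', a * (∏ i ∈ T, x i) ^ e' + a' * (∏ i ∈ T, x i) ^ e, add_mem ?_ ?_, ?_⟩
    · have := mul_mem_intPiece 𝒜 ha (prod_pow_mem 𝒜 x hx T e')
      rwa [add_assoc, ← Nat.cast_add, ← add_mul] at this
    · have := mul_mem_intPiece 𝒜 ha' (prod_pow_mem 𝒜 x hx T e)
      rwa [add_assoc, ← Nat.cast_add, ← add_mul, add_comm e' e] at this
    · rw [pow_add, map_add, map_mul, map_mul, map_mul, ← hz, ← hw]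
      ring
  neg_mem' := by
    rintro z ⟨e, a, ha, hz⟩
    exact ⟨e, -a, neg_mem ha, by rw [neg_mul, hz, map_neg]⟩

/-- The Čech cocycles of degree `k` that are homogeneous of internal degree `j`. -/
noncomputable def homogeneousCocycles (k : ℕ) (j : ℤ) : AddSubgroup (LinearMap.ker (cechD x k)) where
  carrier := {σ | ∀ T, σ.1 T ∈ Loc.degreePiece 𝒜 x hx T.1 j}
  zero_mem' := fun _ => zero_mem _
  add_mem' := fun hσ hτ T => add_mem (hσ T) (hτ T)
  neg_mem' := fun hσ T => neg_mem (hσ T)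

/-- The degree `j` piece `[H^k]_j` of the graded module `H^k`: the classes of the cocycles that are
homogeneous of degree `j`. -/
noncomputable def gradedPiece (k : ℕ) (j : ℤ) : AddSubgroup (LocalCohomology x k) :=
  (homogeneousCocycles 𝒜 x hx k j).map (Submodule.mkQ _).toAddMonoidHom

variable {B : Type u} [CommRing B] [Algebra F B] (ℬ : ℕ → Submodule F B) [SetLike.GradedMonoid ℬ]
  (φ : A →+* B) (y : ι → B) (hy : ∀ i, y i ∈ ℬ 1) (p : ℕ) (h : ∀ i, φ (x i) = y i ^ p)
  (hφ : ∀ i, ∀ a ∈ 𝒜 i, φ a ∈ ℬ (p * i))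

/-- If `φ` multiplies degrees by `p`, then so does the induced map of local cohomology. -/
theorem localCohomologyMap_mem_gradedPiece (hφ : ∀ i, ∀ a ∈ 𝒜 i, φ a ∈ ℬ (p * i)) (k : ℕ) (j : ℤ) (ξ : LocalCohomology x k)
    (hξ : ξ ∈ gradedPiece 𝒜 x hx k j) :
    localCohomologyMap φ x y p h k ξ ∈ gradedPiece ℬ y hy k (p * j) := by
  have hint : ∀ (m : ℤ) (a : A), a ∈ intPiece 𝒜 m → φ a ∈ intPiece ℬ (p * m) := by
    intro m a ha
    cases m with
    | ofNat m => exact hφ m a ha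
    | negSucc m =>
      obtain rfl : a = 0 := ha
      rw [map_zero]
      exact zero_mem _
  obtain ⟨σ, hσ, rfl⟩ := hξ
  refine ⟨cocycleMap φ x y p h k σ, fun T => ?_, rfl⟩
  obtain ⟨e, a, ha, hz⟩ := hσ T
  refine ⟨p * e, φ a, ?_, ?_⟩
  · have := hint _ _ ha
    rwa [mul_add, ← Nat.cast_mul, ← mul_assoc] at this
  · have := congrArg (Loc.map φ x y p h T.1) hz
    rw [map_mul, Loc.map_algebraMap, Loc.map_algebraMap, map_pow, map_prod,
      Finset.prod_congr rfl fun i _ => h i, Finset.prod_pow, ← pow_mul] at this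
    exact this

/-- The map `[H^k]_0 → [H^k]_0` of degree `0` pieces induced by `φ`. -/
noncomputable def degreeZeroMap (k : ℕ) :
    gradedPiece 𝒜 x hx k 0 →+ gradedPiece ℬ y hy k 0 :=
  ((localCohomologyMap φ x y p h k).toAddMonoidHom.comp
    (gradedPiece 𝒜 x hx k 0).subtype).codRestrict _ fun ξ => by
      have := localCohomologyMap_mem_gradedPiece 𝒜 x hx ℬ φ y hy p h hφ k 0 ξ.1 ξ.2
      rwa [mul_zero] at this

end Graded

end Cech

/-! ### The Frobenius map on quotients of polynomial rings -/

section Frobenius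

variable {R : Type u} [CommRing R] (p : ℕ) [ExpChar R p] {c : ℕ} (f : Fin c → R)

/-- The ideal generated by `f_1, …, f_c`. -/
abbrev genIdeal (f : Fin c → R) : Ideal R := Ideal.span (Set.range f)

theorem genIdeal_le_comap_frobenius :
    genIdeal f ≤ (genIdeal fun i => f i ^ p).comap (frobenius R p) := by
  rw [genIdeal, Ideal.span_le]
  rintro _ ⟨i, rfl⟩
  exact Ideal.subset_span ⟨i, rfl⟩

theorem genIdeal_pow_le {s t : ℕ} (h : t ≤ s) :
    (genIdeal fun i => f i ^ s) ≤ genIdeal fun i => f i ^ t := by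
  rw [genIdeal, Ideal.span_le]
  rintro _ ⟨i, rfl⟩
  exact Ideal.mem_of_dvd _ (pow_dvd_pow (f i) h) (Ideal.subset_span ⟨i, rfl⟩)

/-- The composition `R/(f_1,…,f_c) → R/(f_1^p,…,f_c^p) → R/(f_1^t,…,f_c^t)` of the map induced by
the Frobenius endomorphism of `R` with the canonical surjection, for `t ≤ p`. -/
noncomputable def frobeniusQuotient (t : ℕ) (htp : t ≤ p) :
    R ⧸ genIdeal f →+* R ⧸ genIdeal fun i => f i ^ t :=
  (Ideal.Quotient.factor (genIdeal_pow_le f htp)).comp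
    (Ideal.quotientMap _ (frobenius R p) (genIdeal_le_comap_frobenius p f))

theorem frobeniusQuotient_mk (t : ℕ) (htp : t ≤ p) (a : R) :
    frobeniusQuotient p f t htp (Ideal.Quotient.mk _ a) = Ideal.Quotient.mk _ (a ^ p) := rfl

end Frobenius

section Polynomial

open MvPolynomial

variable {F : Type u} [Field F] {n c : ℕ}

attribute [local instance] MvPolynomial.gradedAlgebra

/-- An ideal generated by homogeneous forms is homogeneous. -/
theorem genIdeal_isHomogeneous {f : Fin c → MvPolynomial (Fin (n + 1)) F} {d : Fin c → ℕ}
    (hf : ∀ i, (f i).IsHomogeneous (d i)) :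
    (genIdeal f).IsHomogeneous (homogeneousSubmodule (Fin (n + 1)) F) := by
  refine Ideal.homogeneous_span _ _ ?_
  rintro _ ⟨i, rfl⟩
  exact ⟨d i, hf i⟩

/-- For homogeneous forms `f_1, …, f_c` in `F[x_0, …, x_n]`, the condition that
`Proj F[x_0, …, x_n]/(f_1, …, f_c)` is smooth over `F`. -/
def DefinesSmoothProj {f : Fin c → MvPolynomial (Fin (n + 1)) F} {d : Fin c → ℕ}
    (hf : ∀ i, (f i).IsHomogeneous (d i)) : Prop :=
  IsSmoothProj (homogeneousSubmodule (Fin (n + 1)) F) (genIdeal f) (genIdeal_isHomogeneous hf)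

/-- The standard grading of `F[x_0, …, x_n]/(f_1, …, f_c)`. -/
noncomputable abbrev stdGrading (f : Fin c → MvPolynomial (Fin (n + 1)) F) :
    ℕ → Submodule F (MvPolynomial (Fin (n + 1)) F ⧸ genIdeal f) :=
  quotientGrading (homogeneousSubmodule (Fin (n + 1)) F) (genIdeal f)

/-- The classes of the variables in `F[x_0, …, x_n]/(f_1, …, f_c)`; they generate the image of the
homogeneous maximal ideal. -/
noncomputable def varClass (f : Fin c → MvPolynomial (Fin (n + 1)) F) (i : Fin (n + 1)) :
    MvPolynomial (Fin (n + 1)) F ⧸ genIdeal f :=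
  Ideal.Quotient.mk _ (X i)

theorem varClass_mem (f : Fin c → MvPolynomial (Fin (n + 1)) F) (i : Fin (n + 1)) :
    varClass f i ∈ stdGrading f 1 :=
  mk_mem_quotientGrading _ (isHomogeneous_X F i)

variable (p : ℕ) [Fact p.Prime] [CharP F p] (f : Fin c → MvPolynomial (Fin (n + 1)) F)
  (t : ℕ) (htp : t ≤ p)

theorem frobeniusQuotient_varClass (i : Fin (n + 1)) :
    frobeniusQuotient p f t htp (varClass f i) = varClass (fun i => f i ^ t) i ^ p := by
  rw [varClass, varClass, frobeniusQuotient_mk, map_pow]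

theorem frobeniusQuotient_mem (i : ℕ) :
    ∀ a ∈ stdGrading f i, frobeniusQuotient p f t htp a ∈ stdGrading (fun i => f i ^ t) (p * i) := by
  rintro _ ⟨a, ha, rfl⟩
  rw [mul_comm]
  exact mk_mem_quotientGrading _ (IsHomogeneous.pow ha p)

/-- The degree `0` piece of the local cohomology, supported at the homogeneous maximal ideal, of
`F[x_0, …, x_n]/(f_1, …, f_c)`. -/
noncomputable abbrev LocalCohomologyZero (f : Fin c → MvPolynomial (Fin (n + 1)) F) (k : ℕ) :
    AddSubgroup (LocalCohomology (varClass f) k) :=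
  gradedPiece (stdGrading f) (varClass f) (varClass_mem f) k 0

/-- The map of degree `0` pieces of local cohomology induced by the composition
`S/(f_1,…,f_c) → S/(f_1^p,…,f_c^p) → S/(f_1^t,…,f_c^t)`, where `S = F[x_0, …, x_n]`. -/
noncomputable def frobeniusLocalCohomologyZero (k : ℕ) :
    LocalCohomologyZero f k →+ LocalCohomologyZero (fun i => f i ^ t) k :=
  degreeZeroMap (stdGrading f) (varClass f) (varClass_mem f)
    (stdGrading fun i => f i ^ t) (frobeniusQuotient p f t htp)
    (varClass fun i => f i ^ t) (varClass_mem fun i => f i ^ t) p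
    (frobeniusQuotient_varClass p f t htp) (frobeniusQuotient_mem p f t htp) k

end Polynomial

end FrobCI

/-!
Write `S = F[x_0, …, x_n]`, `J_i = (f_1, …, f_i)` and `m = (x_0, …, x_n)`. The proof has three
parts.

*Reduction to `S`.* Because the `f_i` form a regular sequence, `H^k_m(S/J_i)` vanishes for
`k < n + 1 - i`, so the connecting homomorphisms
`H^(n+1-i)_m(S/J_i) → H^(n+2-i)_m(S/J_(i-1))` are injective (`mem_cobMod_of_connecting`). They embed
the degree zero piece of `H^(n+1-c)_m(S/J_c)` in the piece of degree `-∑ d_i` of `H^(n+1)_m(S)`, with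
image in the classes killed by all `f_i`, and carry the map of the theorem to
`ξ ↦ (f_1 ⋯ f_c)^(p-t) φ(ξ)`, where `φ` is the Frobenius action
(`connecting_cochainMap_mem_cobMod`, `injective_of_top`). All cochains are kept over `S`, and the
cohomology of `S/J` is expressed by cochains modulo `J`. A class of `H^(n+1)_m(S)` is a fraction
`s / (x_0 ⋯ x_n)^N`, which vanishes when `s ∈ (x_0^N, …, x_n^N)`, and `φ` raises it to the power `p`
(`mem_coboundaries_iff`).

*Differentiation.* Suppose that `f^k s^p ∈ Q = (x_0^(pN), …, x_n^(pN))` with all exponents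
`k_i ≤ p - t`. Partial derivatives preserve `Q` and kill `s^p`, so Cramer's rule shows that the
`c × c` minors of the Jacobian matrix take `w = f^(k - e_j) s^p` into `Q` whenever `k_j > 0`. So do
`f_j`, and `f_i^(p - k_i)` for `i ≠ j`, the latter because `f_i s ∈ (x_0^N, …, x_n^N)`. If the ideal
generated by all these elements contains every form of the degree complementary to that of `w`, then
`w ∈ Q` by the perfect pairing of `S` with its top local cohomology (`descend`). Decreasing the
exponents in this way leads to `s^p ∈ Q`, hence to `s ∈ (x_0^N, …, x_n^N)`.

*The degree bound.* Smoothness of `Proj S/J_c` enters through the Jacobian criterion: the ideal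
generated by the `f_i` and by the minors contains powers of all variables. This is proved on the
charts by infinitesimal lifting (`map_sup_minorIdeal_eq_top`,
`exists_X_pow_mem_of_definesSmoothProj`). Over an infinite field, `n + 1 - c` general linear
combinations of the minors, which are forms of degree `∑ (d_i - 1)`, extend
`f_1^(a_1), …, f_c^(a_c)` to a regular sequence of length `n + 1`. The Hilbert series of the quotient
is therefore a polynomial of known degree, and beyond this degree all forms lie in the ideal
(`mem_span_pow_sup`). The inequality assumed on `t` places the complementary degree of `w` beyond it.
-/

namespace FrobCI

/-! ### Regular sequences modulo an ideal -/

section RegularSequences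

variable {A : Type u} [CommRing A]

/-- `f` is a nonzerodivisor on `A ⧸ J`. -/
def NzdMod (J : Ideal A) (f : A) : Prop := ∀ a, f * a ∈ J → a ∈ J

theorem NzdMod.mul {J : Ideal A} {f g : A} (hf : NzdMod J f) (hg : NzdMod J g) :
    NzdMod J (f * g) := fun a ha => hg a (hf _ (by rwa [← mul_assoc]))

theorem NzdMod.pow {J : Ideal A} {f : A} (hf : NzdMod J f) (e : ℕ) : NzdMod J (f ^ e) := by
  induction e with
  | zero => intro a ha; simpa using ha
  | succ e ih => rw [pow_succ]; exact ih.mul hf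

theorem mem_sup_span_singleton {J : Ideal A} {f y : A} :
    y ∈ J ⊔ Ideal.span {f} ↔ ∃ b ∈ J, ∃ w, y = b + f * w := by
  rw [Submodule.mem_sup]
  constructor
  · rintro ⟨b, hb, z, hz, rfl⟩
    obtain ⟨w, rfl⟩ := Ideal.mem_span_singleton'.mp hz
    exact ⟨b, hb, w, by ring⟩
  · rintro ⟨b, hb, w, rfl⟩
    exact ⟨b, hb, f * w, Ideal.mem_span_singleton'.mpr ⟨w, by ring⟩, rfl⟩

/-- If `f, g` is a regular sequence modulo `J`, then so is `f ^ a, g`. -/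
theorem NzdMod.of_sup_pow {J : Ideal A} {f g : A} (hf : NzdMod J f)
    (hg : NzdMod (J ⊔ Ideal.span {f}) g) (a : ℕ) : NzdMod (J ⊔ Ideal.span {f ^ a}) g := by
  induction a with
  | zero => intro y _; rw [pow_zero, Ideal.span_singleton_one, sup_top_eq]; trivial
  | succ a ih =>
    intro y hy
    obtain ⟨b', hb', w, hw⟩ := mem_sup_span_singleton.mp hy
    obtain ⟨b, hb, y', rfl⟩ := mem_sup_span_singleton.mp (hg y (mem_sup_span_singleton.mpr
      ⟨b', hb', f ^ a * w, by rw [hw]; ring⟩))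
    have h1 : g * y' - f ^ a * w ∈ J := by
      refine hf _ ?_
      have : f * (g * y' - f ^ a * w) = b' - g * b := by linear_combination hw
      rw [this]
      exact sub_mem hb' (J.mul_mem_left _ hb)
    obtain ⟨b2, hb2, w2, hw2⟩ := mem_sup_span_singleton.mp
      (ih y' (mem_sup_span_singleton.mpr ⟨_, h1, w, by ring⟩))
    exact mem_sup_span_singleton.mpr
      ⟨b + f * b2, add_mem hb (J.mul_mem_left _ hb2), w2, by rw [hw2]; ring⟩

/-- If `f, g` is a regular sequence modulo `J`, then `f` is a nonzerodivisor modulo `J + (g)`. -/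
theorem NzdMod.swap {J : Ideal A} {f g : A} (hf : NzdMod J f)
    (hg : NzdMod (J ⊔ Ideal.span {f}) g) : NzdMod (J ⊔ Ideal.span {g}) f := by
  intro y hy
  obtain ⟨b, hb, w, hw⟩ := mem_sup_span_singleton.mp hy
  obtain ⟨b', hb', w', rfl⟩ := mem_sup_span_singleton.mp (hg w (mem_sup_span_singleton.mpr
    ⟨-b, neg_mem hb, y, by linear_combination -hw⟩))
  refine mem_sup_span_singleton.mpr ⟨y - g * w', hf _ ?_, w', by ring⟩
  have : f * (y - g * w') = b + g * b' := by linear_combination hw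
  rw [this]
  exact add_mem hb (J.mul_mem_left _ hb')

/-- The elements of the list form a (weakly) regular sequence on `A ⧸ J`; unlike Mathlib's
`RingTheory.Sequence.IsWeaklyRegular`, the condition refers to ideals of `A` only. -/
def RegSeq : Ideal A → List A → Prop
  | _, [] => True
  | J, f :: l => NzdMod J f ∧ RegSeq (J ⊔ Ideal.span {f}) l

/-- A regular sequence remains regular when its first element is replaced by a power. -/
theorem RegSeq.sup_pow {l : List A} {J : Ideal A} {f : A} (hf : NzdMod J f)
    (hl : RegSeq (J ⊔ Ideal.span {f}) l) (a : ℕ) : RegSeq (J ⊔ Ideal.span {f ^ a}) l := by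
  induction l generalizing J with
  | nil => trivial
  | cons g l ih =>
    refine ⟨hf.of_sup_pow hl.1 a, ?_⟩
    rw [sup_right_comm]
    refine ih (hf.swap hl.1) ?_
    rw [sup_right_comm]
    exact hl.2

theorem regSeq_ofFn_iff {c : ℕ} (f : Fin c → A) (J : Ideal A) :
    RegSeq J (List.ofFn f) ↔
      ∀ i : Fin c, NzdMod (J ⊔ Ideal.span (f '' {j | j < i})) (f i) := by
  induction c generalizing J with
  | zero => simp [RegSeq]
  | succ c ih =>
    rw [List.ofFn_succ, RegSeq, ih, Fin.forall_fin_succ]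
    have h0 : f '' {j | j < 0} = ∅ := by simp
    have h1 : ∀ i : Fin c, J ⊔ Ideal.span {f 0} ⊔ Ideal.span ((fun j => f j.succ) '' {j | j < i}) =
        J ⊔ Ideal.span (f '' {j | j < i.succ}) := by
      intro i
      rw [sup_assoc, ← Ideal.span_union]
      congr 2
      ext a
      constructor
      · rintro (rfl | ⟨j, hj, rfl⟩)
        · exact ⟨0, Fin.succ_pos i, rfl⟩
        · exact ⟨j.succ, Fin.succ_lt_succ_iff.mpr hj, rfl⟩
      · rintro ⟨j, hj, rfl⟩
        rcases Fin.eq_zero_or_eq_succ j with rfl | ⟨j, rfl⟩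
        · exact Or.inl rfl
        · exact Or.inr ⟨j, Fin.succ_lt_succ_iff.mp hj, rfl⟩
    simp only [h0, h1, Ideal.span_empty, sup_bot_eq]

/-- Powers of the elements of a regular sequence form a regular sequence. -/
theorem RegSeq.pow {c : ℕ} {f : Fin c → A} {J : Ideal A} (h : RegSeq J (List.ofFn f))
    (a : Fin c → ℕ) : RegSeq J (List.ofFn fun i => f i ^ a i) := by
  induction c generalizing J with
  | zero => simp [RegSeq]
  | succ c ih =>
    rw [List.ofFn_succ] at h ⊢
    exact ⟨h.1.pow _, ih (RegSeq.sup_pow h.1 h.2 _) _⟩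

theorem RegSeq.castSucc {c : ℕ} {f : Fin (c + 1) → A} {J : Ideal A}
    (h : RegSeq J (List.ofFn f)) : RegSeq J (List.ofFn fun i : Fin c => f i.castSucc) := by
  rw [regSeq_ofFn_iff] at h ⊢
  intro i
  convert h i.castSucc using 3
  ext a
  constructor
  · rintro ⟨j, hj, rfl⟩
    exact ⟨j.castSucc, hj, rfl⟩
  · rintro ⟨j, hj, rfl⟩
    exact ⟨j.castLT (lt_trans (show j.1 < i.1 from hj) i.2), hj, rfl⟩

theorem image_lt_last {c : ℕ} (f : Fin (c + 1) → A) :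
    f '' {j | j < Fin.last c} = Set.range fun i : Fin c => f i.castSucc := by
  ext a
  constructor
  · rintro ⟨j, hj, rfl⟩
    exact ⟨j.castLT hj, rfl⟩
  · rintro ⟨j, rfl⟩
    exact ⟨j.castSucc, Fin.castSucc_lt_last j, rfl⟩

/-- The coefficients of a linear relation between the elements of a regular sequence lie in the
ideal that they generate. -/
theorem RegSeq.mem_of_sum_mem {c : ℕ} {f : Fin c → A} {J : Ideal A}
    (h : RegSeq J (List.ofFn f)) (a : Fin c → A) (ha : ∑ i, f i * a i ∈ J) (i : Fin c) :
    a i ∈ J ⊔ Ideal.span (Set.range f) := by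
  induction c with
  | zero => exact i.elim0
  | succ c ih =>
    have hlast := (regSeq_ofFn_iff f J).mp h (Fin.last c)
    rw [image_lt_last] at hlast
    rw [Fin.sum_univ_castSucc] at ha
    have hle : Ideal.span (Set.range fun i : Fin c => f i.castSucc) ≤
        Ideal.span (Set.range f) := Ideal.span_mono (by rintro _ ⟨j, rfl⟩; exact ⟨_, rfl⟩)
    have h1 : a (Fin.last c) ∈ J ⊔ Ideal.span (Set.range fun i : Fin c => f i.castSucc) := by
      refine hlast _ ?_
      rw [← add_sub_cancel_left (∑ i : Fin c, f i.castSucc * a i.castSucc)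
        (f (Fin.last c) * a (Fin.last c))]
      refine sub_mem (Ideal.mem_sup_left ha) (Ideal.mem_sup_right (sum_mem fun j _ => ?_))
      exact Ideal.mul_mem_right _ _ (Ideal.subset_span ⟨j, rfl⟩)
    obtain ⟨b, hb, z, hz, hbz⟩ := Submodule.mem_sup.mp h1
    obtain ⟨w, hw⟩ := Ideal.mem_span_range_iff_exists_fun.mp hz
    have h2 := ih h.castSucc (fun j => a j.castSucc + w j * f (Fin.last c)) (by
      have : ∑ j : Fin c, f j.castSucc * (a j.castSucc + w j * f (Fin.last c)) =
          (∑ j : Fin c, f j.castSucc * a j.castSucc + f (Fin.last c) * a (Fin.last c)) -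
            f (Fin.last c) * b := by
        rw [← hbz, ← hw]
        simp only [mul_add, Finset.sum_add_distrib, Finset.mul_sum]
        rw [add_sub_assoc, add_sub_cancel_left]
        congr 1
        exact Finset.sum_congr rfl fun j _ => by ring
      rw [this]
      exact sub_mem ha (J.mul_mem_left _ hb))
    refine Fin.lastCases ?_ (fun j => ?_) i
    · exact sup_le_sup_left hle J h1
    · have h3 := sub_mem (sup_le_sup_left hle J (h2 j)) (Ideal.mem_sup_right (R := A) (S := J)
        (Ideal.mul_mem_left _ (w j) (Ideal.subset_span (Set.mem_range_self (Fin.last c)))))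
      rwa [add_sub_cancel_right] at h3

theorem regSeq_of_isWeaklyRegular {c : ℕ} {f : Fin c → A}
    (h : RingTheory.Sequence.IsWeaklyRegular A (List.ofFn f)) : RegSeq ⊥ (List.ofFn f) := by
  rw [regSeq_ofFn_iff]
  intro i a ha
  have h1 := h.regular_mod_prev i.1 (by simp)
  have h2 : Ideal.ofList (List.take i.1 (List.ofFn f)) = Ideal.span (f '' {j | j < i}) := by
    rw [Ideal.ofList]
    congr 1
    ext b
    simp only [Set.mem_ofPred_eq, List.mem_take_iff_getElem, List.getElem_ofFn, Set.mem_image,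
      List.length_ofFn]
    constructor
    · rintro ⟨j, hj, rfl⟩
      exact ⟨⟨j, (lt_min_iff.mp hj).2⟩, (lt_min_iff.mp hj).1, rfl⟩
    · rintro ⟨j, hj, rfl⟩
      exact ⟨j.1, lt_min hj j.2, rfl⟩
  rw [bot_sup_eq] at ha ⊢
  rw [h2, List.getElem_ofFn, smul_eq_mul, Ideal.mul_top] at h1
  refine (Submodule.Quotient.mk_eq_zero _).mp (h1.right_eq_zero_of_smul ?_)
  rw [← Submodule.Quotient.mk_smul]
  exact (Submodule.Quotient.mk_eq_zero _).mpr ha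

end RegularSequences

/-! ### Čech cochains modulo an ideal -/

section CechModulo

variable {ι : Type*} [LinearOrder ι] {A : Type u} [CommRing A] (x : ι → A)

theorem Loc.mem_map_iff (J : Ideal A) {T : Finset ι} {z : Loc x T} :
    z ∈ J.map (algebraMap A (Loc x T)) ↔
      ∃ (e : ℕ) (a : A), a ∈ J ∧
        z * algebraMap A (Loc x T) ((∏ i ∈ T, x i) ^ e) = algebraMap A (Loc x T) a := by
  rw [IsLocalization.mem_map_algebraMap_iff (Submonoid.powers (∏ i ∈ T, x i))]
  constructor
  · rintro ⟨⟨a, ⟨_, e, rfl⟩⟩, h⟩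
    exact ⟨e, a.1, a.2, h⟩
  · rintro ⟨e, a, ha, h⟩
    exact ⟨⟨⟨a, ha⟩, ⟨_, e, rfl⟩⟩, h⟩

theorem Loc.exists_mul_eq {T : Finset ι} (z : Loc x T) :
    ∃ (e : ℕ) (a : A), z * algebraMap A (Loc x T) ((∏ i ∈ T, x i) ^ e) = algebraMap A _ a := by
  obtain ⟨⟨a, ⟨_, e, rfl⟩⟩, h⟩ := IsLocalization.surj (Submonoid.powers (∏ i ∈ T, x i)) z
  exact ⟨e, a, h⟩

theorem Loc.isUnit_prod (T : Finset ι) (e : ℕ) :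
    IsUnit (algebraMap A (Loc x T) ((∏ i ∈ T, x i) ^ e)) := by
  rw [map_pow]
  exact (IsLocalization.Away.algebraMap_isUnit (S := Loc x T) (∏ i ∈ T, x i)).pow e

theorem Loc.mul_mem_map_iff (J : Ideal A) {T : Finset ι} {z : Loc x T} (e : ℕ) :
    z * algebraMap A (Loc x T) ((∏ i ∈ T, x i) ^ e) ∈ J.map (algebraMap A (Loc x T)) ↔
      z ∈ J.map (algebraMap A (Loc x T)) :=
  Ideal.mul_unit_mem_iff_mem _ (Loc.isUnit_prod x T e)

theorem Loc.algebraMap_mem_map_iff (J : Ideal A) {T : Finset ι} {a : A} :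
    algebraMap A (Loc x T) a ∈ J.map (algebraMap A (Loc x T)) ↔
      ∃ e : ℕ, (∏ i ∈ T, x i) ^ e * a ∈ J := by
  constructor
  · intro h
    obtain ⟨e, b, hb, h⟩ := (Loc.mem_map_iff x J).mp h
    rw [← map_mul] at h
    obtain ⟨⟨_, e', rfl⟩, h⟩ :=
      IsLocalization.exists_of_eq (M := Submonoid.powers (∏ i ∈ T, x i)) h
    refine ⟨e' + e, ?_⟩
    have h' : (∏ i ∈ T, x i) ^ e' * (a * (∏ i ∈ T, x i) ^ e) = (∏ i ∈ T, x i) ^ e' * b := h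
    rw [pow_add, mul_assoc, mul_comm _ a, h']
    exact J.mul_mem_left _ hb
  · rintro ⟨e, he⟩
    refine (Loc.mul_mem_map_iff x J e).mp ?_
    rw [← map_mul, mul_comm]
    exact Ideal.mem_map_of_mem _ he

theorem NzdMod.map_loc {J : Ideal A} {f : A} (hf : NzdMod J f) {T : Finset ι} {z : Loc x T}
    (hz : f • z ∈ J.map (algebraMap A (Loc x T))) : z ∈ J.map (algebraMap A (Loc x T)) := by
  obtain ⟨e, a, h⟩ := Loc.exists_mul_eq x z
  rw [← Loc.mul_mem_map_iff x J e, h, Loc.algebraMap_mem_map_iff]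
  have h1 : algebraMap A (Loc x T) (f * a) ∈ J.map (algebraMap A (Loc x T)) := by
    rw [map_mul, ← h, ← mul_assoc, ← Algebra.smul_def, Loc.mul_mem_map_iff]
    exact hz
  obtain ⟨e', h'⟩ := (Loc.algebraMap_mem_map_iff x J).mp h1
  exact ⟨e', hf _ (by rwa [mul_left_comm])⟩

theorem Loc.res_mem_map {J : Ideal A} {T U : Finset ι} (h : T ⊆ U) {z : Loc x T}
    (hz : z ∈ J.map (algebraMap A (Loc x T))) :
    Loc.res x h z ∈ J.map (algebraMap A (Loc x U)) := by
  have := Ideal.mem_map_of_mem (Loc.res x h).toRingHom hz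
  rw [Ideal.map_map] at this
  exact (congrArg (fun φ => J.map φ) (Loc.res x h).comp_algebraMap).le this

/-- The cochains with values in `J A_{x_T}`; the cochains modulo this submodule are those
of `A ⧸ J`. -/
noncomputable def cochainIdeal (J : Ideal A) (k : ℕ) : Submodule A (Cochain x k) where
  carrier := {σ | ∀ T, σ T ∈ J.map (algebraMap A (Loc x T.1))}
  zero_mem' := fun _ => zero_mem _
  add_mem' := fun hσ hτ T => add_mem (hσ T) (hτ T)
  smul_mem' := fun a σ hσ T => by
    rw [Pi.smul_apply, Algebra.smul_def]
    exact Ideal.mul_mem_left _ _ (hσ T)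

/-- The cochains that are coboundaries modulo `J`. -/
noncomputable def cobMod (J : Ideal A) (k : ℕ) : Submodule A (Cochain x k) :=
  coboundaries x k ⊔ cochainIdeal x J k

variable {x}

theorem mem_cochainIdeal {J : Ideal A} {k : ℕ} {σ : Cochain x k} :
    σ ∈ cochainIdeal x J k ↔ ∀ T, σ T ∈ J.map (algebraMap A (Loc x T.1)) := Iff.rfl

theorem smul_mem_cochainIdeal {J : Ideal A} {a : A} (ha : a ∈ J) {k : ℕ} (σ : Cochain x k) :
    a • σ ∈ cochainIdeal x J k := fun T => by
  rw [Pi.smul_apply, Algebra.smul_def]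
  exact Ideal.mul_mem_right _ _ (Ideal.mem_map_of_mem _ ha)

theorem cechD_mem_cochainIdeal {J : Ideal A} {k : ℕ} {σ : Cochain x k}
    (hσ : σ ∈ cochainIdeal x J k) : cechD x k σ ∈ cochainIdeal x J (k + 1) := by
  intro T
  rw [cechD_apply]
  refine sum_mem fun i _ => ?_
  rw [Algebra.smul_def]
  exact Ideal.mul_mem_left _ _ (Loc.res_mem_map x _ (hσ _))

theorem cochainIdeal_mono {J J' : Ideal A} (h : J ≤ J') (k : ℕ) :
    cochainIdeal x J k ≤ cochainIdeal x J' k := fun _ hσ T => Ideal.map_mono h (hσ T)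

theorem cobMod_mono {J J' : Ideal A} (h : J ≤ J') (k : ℕ) : cobMod x J k ≤ cobMod x J' k :=
  sup_le_sup_left (cochainIdeal_mono h k) _

theorem mem_cochainIdeal_sup {J : Ideal A} {f : A} {k : ℕ} {σ : Cochain x k}
    (hσ : σ ∈ cochainIdeal x (J ⊔ Ideal.span {f}) k) :
    ∃ σ' ∈ cochainIdeal x J k, ∃ τ, σ = σ' + f • τ := by
  have h : ∀ T : {T : Finset ι // T.card = k}, ∃ a ∈ J.map (algebraMap A (Loc x T.1)),
      ∃ b : Loc x T.1, σ T = a + f • b := by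
    intro T
    have := hσ T
    rw [Ideal.map_sup, Ideal.map_span, Set.image_singleton, mem_sup_span_singleton] at this
    obtain ⟨a, ha, b, hb⟩ := this
    exact ⟨a, ha, b, by rw [hb, Algebra.smul_def]⟩
  choose a ha b hb using h
  exact ⟨a, ha, b, funext hb⟩

theorem NzdMod.cochain {J : Ideal A} {f : A} (hf : NzdMod J f) {k : ℕ} {σ : Cochain x k}
    (hσ : f • σ ∈ cochainIdeal x J k) : σ ∈ cochainIdeal x J k := fun T => hf.map_loc x (hσ T)

theorem mem_cobMod_succ {J : Ideal A} {k : ℕ} {σ : Cochain x (k + 1)} :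
    σ ∈ cobMod x J (k + 1) ↔ ∃ ρ, σ - cechD x k ρ ∈ cochainIdeal x J (k + 1) := by
  rw [cobMod, Submodule.mem_sup]
  constructor
  · rintro ⟨_, ⟨ρ, rfl⟩, σ', hσ', rfl⟩
    exact ⟨ρ, by rwa [add_sub_cancel_left]⟩
  · rintro ⟨ρ, h⟩
    exact ⟨_, ⟨ρ, rfl⟩, _, h, add_sub_cancel _ _⟩

theorem cechD_eq_zero_of_mem_coboundaries {k : ℕ} {ρ : Cochain x k} (hρ : ρ ∈ coboundaries x k) :
    cechD x k ρ = 0 := by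
  cases k with
  | zero =>
    obtain rfl : ρ = 0 := hρ
    rw [map_zero]
  | succ k =>
    obtain ⟨ρ', rfl⟩ := hρ
    rw [cechD_cechD]

variable (x)

/-- The vanishing of the local cohomology `H^k` of `A ⧸ J`, in terms of cochains over `A`. -/
def Vanishes (J : Ideal A) (k : ℕ) : Prop :=
  ∀ σ : Cochain x k, cechD x k σ ∈ cochainIdeal x J (k + 1) → σ ∈ cobMod x J k

variable {x}

/-- The part `H^k(A/J) → H^k(A/(J + (f))) → H^(k+1)(A/J)` of the long exact sequence. -/
theorem Vanishes.sup {J : Ideal A} {f : A} (hf : NzdMod J f) {k : ℕ} (h : Vanishes x J k)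
    (h' : Vanishes x J (k + 1)) : Vanishes x (J ⊔ Ideal.span {f}) k := by
  intro σ hσ
  obtain ⟨σ', hσ', τ, hτ⟩ := mem_cochainIdeal_sup hσ
  have h1 : cechD x (k + 1) τ ∈ cochainIdeal x J (k + 2) := by
    refine hf.cochain ?_
    have := congrArg (cechD x (k + 1)) hτ
    rw [cechD_cechD, map_add, map_smul] at this
    rw [← neg_eq_iff_add_eq_zero.mpr this.symm]
    exact neg_mem (cechD_mem_cochainIdeal hσ')
  obtain ⟨ρ, hρ⟩ := mem_cobMod_succ.mp (h' τ h1)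
  have h2 : σ - f • ρ ∈ cobMod x J k := by
    refine h _ ?_
    rw [map_sub, hτ, map_smul, add_sub_assoc, ← smul_sub]
    exact add_mem hσ' (Submodule.smul_mem _ _ hρ)
  have h3 := add_mem (cobMod_mono (le_sup_left (b := Ideal.span {f})) k h2)
    (Submodule.mem_sup_right (smul_mem_cochainIdeal (x := x) (k := k)
      (Ideal.mem_sup_right (S := J) (Ideal.mem_span_singleton_self f)) ρ))
  rwa [sub_add_cancel] at h3

/-- If `g` is a nonzerodivisor on `A ⧸ J` and `H^(k-1)(A/(J + (g)))` vanishes, then `g` is a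
nonzerodivisor on `H^k(A/J)`. -/
theorem mem_cobMod_of_smul {J : Ideal A} {g : A} (hg : NzdMod J g) {k : ℕ}
    (h : ∀ k', k = k' + 1 → Vanishes x (J ⊔ Ideal.span {g}) k') {σ : Cochain x k}
    (hσ : g • σ ∈ cobMod x J k) : σ ∈ cobMod x J k := by
  cases k with
  | zero =>
    refine Submodule.mem_sup_right (hg.cochain ?_)
    obtain ⟨ρ, hρ, σ', hσ', hs⟩ := Submodule.mem_sup.mp hσ
    obtain rfl : ρ = 0 := hρ
    rwa [← hs, zero_add]
  | succ k =>
    obtain ⟨ρ, hρ⟩ := mem_cobMod_succ.mp hσ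
    have h1 : ρ ∈ cobMod x (J ⊔ Ideal.span {g}) k := by
      refine h k rfl ρ ?_
      rw [← sub_sub_cancel (g • σ) (cechD x k ρ)]
      exact sub_mem (smul_mem_cochainIdeal
        (Ideal.mem_sup_right (S := J) (Ideal.mem_span_singleton_self g)) σ)
        (cochainIdeal_mono le_sup_left _ hρ)
    obtain ⟨π, hπ, ρ', hρ', rfl⟩ := Submodule.mem_sup.mp h1
    have h2 : cechD x k π = 0 := cechD_eq_zero_of_mem_coboundaries hπ
    obtain ⟨ρ1, hρ1, κ, rfl⟩ := mem_cochainIdeal_sup hρ'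
    refine mem_cobMod_succ.mpr ⟨κ, hg.cochain ?_⟩
    rw [map_add, h2, zero_add, map_add, map_smul] at hρ
    have := add_mem hρ (cechD_mem_cochainIdeal hρ1)
    rw [smul_sub]
    convert this using 1
    abel

theorem Loc.res_mem_map_iff {J : Ideal A} {T : Finset ι} {i : ι} (hi : NzdMod J (x i))
    {z : Loc x T} (h : T ⊆ insert i T) :
    Loc.res x h z ∈ J.map (algebraMap A (Loc x (insert i T))) ↔
      z ∈ J.map (algebraMap A (Loc x T)) := by
  refine ⟨fun hz => ?_, Loc.res_mem_map x h⟩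
  obtain ⟨e, a, ha⟩ := Loc.exists_mul_eq x z
  rw [← Loc.mul_mem_map_iff x J e, ha, Loc.algebraMap_mem_map_iff]
  have h1 : algebraMap A (Loc x (insert i T)) a ∈ J.map (algebraMap A (Loc x (insert i T))) := by
    rw [← (Loc.res x h).commutes a, ← ha, map_mul]
    exact Ideal.mul_mem_right _ _ hz
  by_cases hiT : i ∈ T
  · rw [Loc.algebraMap_mem_map_iff, Finset.insert_eq_self.mpr hiT] at h1
    exact h1
  · obtain ⟨e', h'⟩ := (Loc.algebraMap_mem_map_iff x J).mp h1
    rw [Finset.prod_insert hiT, mul_pow, mul_assoc] at h'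
    exact ⟨e', hi.pow e' _ h'⟩

theorem Loc.exists_res_eq {T : Finset ι} {i : ι} (hiT : i ∉ T) (h : T ⊆ insert i T)
    (z : Loc x (insert i T)) :
    ∃ N, ∀ M, N ≤ M → ∃ w : Loc x T, Loc.res x h w = x i ^ M • z := by
  obtain ⟨e, a, ha⟩ := Loc.exists_mul_eq x z
  refine ⟨e, fun M hM => ?_⟩
  obtain ⟨u, hu⟩ := Loc.isUnit_prod x T e
  refine ⟨algebraMap A _ (x i ^ (M - e) * a) * (↑u⁻¹ : Loc x T), ?_⟩
  have hu' : IsUnit (Loc.res x h (u : Loc x T)) := u.isUnit.map (Loc.res x h)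
  have hp : (∏ j ∈ insert i T, x j) ^ e = x i ^ e * (∏ j ∈ T, x j) ^ e := by
    rw [Finset.prod_insert hiT, mul_pow]
  have hM' : x i ^ M = x i ^ (M - e) * x i ^ e := by rw [← pow_add, Nat.sub_add_cancel hM]
  refine hu'.mul_right_cancel ?_
  rw [← map_mul, mul_assoc, Units.inv_mul, mul_one, (Loc.res x h).commutes, map_mul, ← ha, hu,
    (Loc.res x h).commutes, hp, Algebra.smul_def, hM', map_mul, map_mul]
  ring

theorem Loc.res_self {T : Finset ι} (h : T ⊆ T) (z : Loc x T) : Loc.res x h z = z := by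
  have : Loc.res x h = AlgHom.id A _ :=
    IsLocalization.algHom_ext (Submonoid.powers (∏ i ∈ T, x i)) (Subsingleton.elim _ _)
  rw [this]
  rfl

/-- The component of the cochain `σ` at `V`, restricted to `A_{x_U}`; it is zero unless `V` is
a `k`-element subset of `U`. -/
noncomputable def evalAt {k : ℕ} (σ : Cochain x k) (V U : Finset ι) : Loc x U :=
  if h : V.card = k ∧ V ⊆ U then Loc.res x h.2 (σ ⟨V, h.1⟩) else 0

theorem evalAt_eq {k : ℕ} (σ : Cochain x k) (T : {T : Finset ι // T.card = k}) {U : Finset ι}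
    (h : T.1 ⊆ U) : evalAt σ T.1 U = Loc.res x h (σ T) := dif_pos ⟨T.2, h⟩

theorem evalAt_self {k : ℕ} (σ : Cochain x k) (T : {T : Finset ι // T.card = k}) :
    evalAt σ T.1 T.1 = σ T := by
  rw [evalAt_eq σ T subset_rfl, Loc.res_self]

theorem res_evalAt {k : ℕ} (σ : Cochain x k) {V U U' : Finset ι} (h : V ⊆ U) (h' : U ⊆ U') :
    Loc.res x h' (evalAt σ V U) = evalAt σ V U' := by
  by_cases hV : V.card = k
  · rw [evalAt_eq σ ⟨V, hV⟩ h, Loc.res_res]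
    exact (evalAt_eq σ ⟨V, hV⟩ (h.trans h')).symm
  · rw [evalAt, evalAt, dif_neg fun h => hV h.1, dif_neg fun h => hV h.1, map_zero]

theorem cechD_eq_sum {k : ℕ} (σ : Cochain x k) (T : {T : Finset ι // T.card = k + 1}) :
    cechD x k σ T =
      ∑ i ∈ T.1, (-1 : A) ^ (T.1.filter (· < i)).card • evalAt σ (T.1.erase i) T.1 := by
  rw [cechD_apply, ← Finset.sum_coe_sort T.1 fun i =>
    (-1 : A) ^ (T.1.filter (· < i)).card • evalAt σ (T.1.erase i) T.1]
  exact Finset.sum_congr rfl fun i _ =>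
    congrArg _ (evalAt_eq σ (face T i) (face_subset T i)).symm

/-- The class of a cocycle is killed by a power of each `x i` that is a nonzerodivisor: the
components of the cochain at the sets containing `i` define a contracting homotopy after
multiplication by a power of `x i`. -/
theorem exists_pow_smul_mem_cobMod [Finite ι] {J : Ideal A} {i : ι} (hi : NzdMod J (x i)) {k : ℕ}
    {σ : Cochain x k} (hσ : cechD x k σ ∈ cochainIdeal x J (k + 1)) :
    ∃ N : ℕ, x i ^ N • σ ∈ cobMod x J k := by
  have key : ∀ (T : {T : Finset ι // T.card = k}), i ∉ T.1 →
      (-1 : A) ^ ((insert i T.1).filter (· < i)).card • evalAt σ T.1 (insert i T.1) +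
        ∑ j ∈ T.1, (-1 : A) ^ ((insert i T.1).filter (· < j)).card •
          evalAt σ (insert i (T.1.erase j)) (insert i T.1) ∈
        J.map (algebraMap A (Loc x (insert i T.1))) := by
    intro T hiT
    have h := hσ ⟨insert i T.1, by rw [Finset.card_insert_of_notMem hiT, T.2]⟩
    rw [cechD_eq_sum, Finset.sum_insert hiT, Finset.erase_insert hiT] at h
    convert h using 2
    refine Finset.sum_congr rfl fun j hj => ?_
    rw [Finset.erase_insert_of_ne (ne_of_mem_of_not_mem hj hiT).symm]
  cases k with
  | zero =>
    refine ⟨0, Submodule.mem_sup_right fun T => ?_⟩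
    have hT : T.1 = ∅ := Finset.card_eq_zero.mp T.2
    have hiT : i ∉ T.1 := by rw [hT]; exact Finset.notMem_empty i
    have h := key T hiT
    rw [hT, Finset.sum_empty, add_zero, ← hT, evalAt_eq σ T (Finset.subset_insert _ _),
      ← map_smul, Loc.res_mem_map_iff hi, Algebra.smul_def] at h
    rw [pow_zero, one_smul]
    refine (Ideal.unit_mul_mem_iff_mem _ ?_).mp h
    exact ((isUnit_one.neg).pow _).map _
  | succ k =>
    cases nonempty_fintype ι
    have hw : ∃ N, ∀ T : {T : Finset ι // T.card = k}, ∃ w : Loc x T.1, (i ∈ T.1 → w = 0) ∧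
        (i ∉ T.1 → ∀ (U : Finset ι) (h : T.1 ⊆ U), insert i T.1 ⊆ U → Loc.res x h w =
          (x i ^ N * (-1 : A) ^ (T.1.filter (· < i)).card) • evalAt σ (insert i T.1) U) := by
      have : ∀ T : {T : Finset ι // T.card = k}, ∃ N, ∀ M, N ≤ M → ∃ w : Loc x T.1,
          Loc.res x (Finset.subset_insert i T.1) w =
            x i ^ M • evalAt σ (insert i T.1) (insert i T.1) ∨ i ∈ T.1 := by
        intro T
        by_cases hiT : i ∈ T.1
        · exact ⟨0, fun _ _ => ⟨0, Or.inr hiT⟩⟩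
        · obtain ⟨N, hN⟩ := Loc.exists_res_eq hiT (Finset.subset_insert i T.1)
            (evalAt σ (insert i T.1) (insert i T.1))
          exact ⟨N, fun M hM => ⟨_, Or.inl (hN M hM).choose_spec⟩⟩
      choose N hN using this
      refine ⟨Finset.univ.sup N, fun T => ?_⟩
      obtain ⟨w, hw⟩ := hN T _ (Finset.le_sup (Finset.mem_univ T))
      by_cases hiT : i ∈ T.1
      · exact ⟨0, fun _ => rfl, fun h => absurd hiT h⟩
      · refine ⟨(-1 : A) ^ (T.1.filter (· < i)).card • w, fun h => absurd h hiT,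
          fun _ U h h' => ?_⟩
        rw [← Loc.res_res x (Finset.subset_insert i T.1) h', map_smul,
          hw.resolve_right hiT, map_smul, map_smul, res_evalAt σ subset_rfl, smul_smul, mul_comm]
    obtain ⟨N, hN⟩ := hw
    -- `ρ_V = ± x_i ^ N σ_{V ∪ {i}}` for `i ∉ V`, and `ρ_V = 0` otherwise
    choose ρ hρ using hN
    have hρ0 : ∀ V U : Finset ι, i ∈ V → evalAt ρ V U = 0 := by
      intro V U hV
      rw [evalAt]
      split_ifs with h
      · rw [(hρ ⟨V, h.1⟩).1 hV, map_zero]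
      · rfl
    have hρ1 : ∀ V U : Finset ι, V.card = k → i ∉ V → insert i V ⊆ U → evalAt ρ V U =
        (x i ^ N * (-1 : A) ^ (V.filter (· < i)).card) • evalAt σ (insert i V) U := by
      intro V U hV hiV hU
      have hVU := (Finset.subset_insert i V).trans hU
      rw [evalAt, dif_pos ⟨hV, hVU⟩]
      exact (hρ ⟨V, hV⟩).2 hiV U hVU hU
    have hfilter : ∀ V : Finset ι, (insert i V).filter (· < i) = V.filter (· < i) := by
      intro V
      rw [Finset.filter_insert, if_neg (lt_irrefl i)]
    refine ⟨N, mem_cobMod_succ.mpr ⟨ρ, fun T => ?_⟩⟩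
    have hsgn : ∀ q : ℕ, (-1 : A) ^ q * (-1) ^ q = 1 := fun q => by
      rw [← mul_pow, neg_one_mul, neg_neg, one_pow]
    rw [Pi.sub_apply, Pi.smul_apply, cechD_eq_sum, ← evalAt_self σ T]
    by_cases hiT : i ∈ T.1
    · rw [Finset.sum_eq_single i, hρ1 (T.1.erase i) T.1 (by
        rw [Finset.card_erase_of_mem hiT, T.2, Nat.add_sub_cancel]) (Finset.notMem_erase _ _)
        (by rw [Finset.insert_erase hiT]), ← hfilter (T.1.erase i), Finset.insert_erase hiT,
        smul_smul, mul_left_comm, hsgn, mul_one, sub_self]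
      · exact zero_mem _
      · intro j hj hji
        rw [hρ0 _ _ (Finset.mem_erase.mpr ⟨hji.symm, hiT⟩), smul_zero]
      · exact fun h => absurd hiT h
    · have h := key T hiT
      rw [← Loc.res_mem_map_iff hi (Finset.subset_insert i T.1)]
      have h' := Ideal.mul_mem_left _ (algebraMap A (Loc x (insert i T.1))
        (x i ^ N * (-1 : A) ^ (T.1.filter (· < i)).card)) h
      rw [← Algebra.smul_def] at h'
      convert h' using 1
      rw [hfilter, smul_add, smul_smul, mul_assoc, hsgn, mul_one, map_sub, map_smul,
        res_evalAt σ subset_rfl, sub_eq_add_neg, map_sum, ← Finset.sum_neg_distrib,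
        Finset.smul_sum]
      congr 1
      refine Finset.sum_congr rfl fun j hj => ?_
      have hij : i ≠ j := (ne_of_mem_of_not_mem hj hiT).symm
      have hU : insert i (T.1.erase j) ⊆ insert i T.1 :=
        Finset.insert_subset_insert i (Finset.erase_subset _ _)
      rw [map_smul, res_evalAt ρ (Finset.erase_subset _ _), hρ1 _ _ (by
        rw [Finset.card_erase_of_mem hj, T.2, Nat.add_sub_cancel])
        (fun h => hiT (Finset.mem_of_mem_erase h)) hU, smul_smul, smul_smul, ← neg_smul]
      congr 1
      rcases lt_or_gt_of_ne hij with hlt | hlt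
      · obtain ⟨h1, h2⟩ := card_filter_erase (Finset.mem_insert_self i T.1) hlt
        rw [Finset.erase_insert hiT] at h1
        rw [Finset.erase_insert_of_ne hij, hfilter, hfilter] at h2
        rw [h1, h2]
        ring
      · obtain ⟨h1, h2⟩ := card_filter_erase (Finset.mem_insert_of_mem (b := i) hj) hlt
        rw [Finset.erase_insert hiT] at h2
        rw [Finset.erase_insert_of_ne hij, hfilter, hfilter] at h1
        rw [h1, h2]
        ring

/-- If `x i` is a nonzerodivisor on `A ⧸ J` and `H^(k-1)(A/(J + (x i)))` vanishes, then so does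
`H^k(A/J)`. -/
theorem Vanishes.of_sup_variable [Finite ι] {J : Ideal A} {i : ι} (hi : NzdMod J (x i)) {k : ℕ}
    (h : ∀ k', k = k' + 1 → Vanishes x (J ⊔ Ideal.span {x i}) k') : Vanishes x J k := by
  intro σ hσ
  obtain ⟨N, hN⟩ := exists_pow_smul_mem_cobMod hi hσ
  induction N with
  | zero => rwa [pow_zero, one_smul] at hN
  | succ N ih =>
    refine ih (mem_cobMod_of_smul hi h ?_)
    rwa [smul_smul, ← pow_succ']

end CechModulo

/-! ### The connecting homomorphism and its compatibility with Frobenius -/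

section Connecting

variable {ι : Type*} [LinearOrder ι] {A : Type u} [CommRing A] {x : ι → A}

theorem cechD_mem_of_cechD_sub_smul_mem {J : Ideal A} {f : A} (hf : NzdMod J f) {k : ℕ}
    {σ : Cochain x k} {τ : Cochain x (k + 1)}
    (h : cechD x k σ - f • τ ∈ cochainIdeal x J (k + 1)) :
    cechD x (k + 1) τ ∈ cochainIdeal x J (k + 2) := by
  refine hf.cochain ?_
  have := cechD_mem_cochainIdeal h
  rw [map_sub, cechD_cechD, map_smul, zero_sub] at this
  exact neg_mem_iff.mp this

/-- The connecting homomorphism `H^k(A/(J + (f))) → H^(k+1)(A/J)`, which takes the class of `σ`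
to that of `τ` when `dσ = f τ` modulo `J`, is well defined. -/
theorem connecting_mem_cobMod {J : Ideal A} {f : A} (hf : NzdMod J f) {k : ℕ}
    {σ : Cochain x k} {τ : Cochain x (k + 1)}
    (h : cechD x k σ - f • τ ∈ cochainIdeal x J (k + 1))
    (hσ : σ ∈ cobMod x (J ⊔ Ideal.span {f}) k) : τ ∈ cobMod x J (k + 1) := by
  obtain ⟨ρ, hρ, σ', hσ', rfl⟩ := Submodule.mem_sup.mp hσ
  obtain ⟨σ₁, hσ₁, κ, rfl⟩ := mem_cochainIdeal_sup hσ'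
  refine mem_cobMod_succ.mpr ⟨κ, hf.cochain ?_⟩
  rw [map_add, cechD_eq_zero_of_mem_coboundaries hρ, zero_add, map_add, map_smul] at h
  have := sub_mem (cechD_mem_cochainIdeal hσ₁) h
  rw [smul_sub]
  convert this using 1
  abel

/-- The connecting homomorphism `H^k(A/(J + (f))) → H^(k+1)(A/J)` is injective if `H^k(A/J)`
vanishes. -/
theorem mem_cobMod_of_connecting {J : Ideal A} {f : A} {k : ℕ} (hv : Vanishes x J k)
    {σ : Cochain x k} {τ : Cochain x (k + 1)}
    (h : cechD x k σ - f • τ ∈ cochainIdeal x J (k + 1)) (hτ : τ ∈ cobMod x J (k + 1)) :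
    σ ∈ cobMod x (J ⊔ Ideal.span {f}) k := by
  obtain ⟨κ, hκ⟩ := mem_cobMod_succ.mp hτ
  have h1 : σ - f • κ ∈ cobMod x J k := by
    refine hv _ ?_
    have := add_mem h (Submodule.smul_mem _ f hκ)
    rwa [smul_sub, sub_add_sub_cancel, ← map_smul, ← map_sub] at this
  have h2 := add_mem (cobMod_mono (le_sup_left (b := Ideal.span {f})) k h1)
    (Submodule.mem_sup_right (smul_mem_cochainIdeal (x := x) (k := k)
      (Ideal.mem_sup_right (S := J) (Ideal.mem_span_singleton_self f)) κ))
  rwa [sub_add_cancel] at h2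

theorem cochainMap_mem_cochainIdeal {B : Type u} [CommRing B] (φ : A →+* B) (y : ι → B) (p : ℕ)
    (h : ∀ i, φ (x i) = y i ^ p) {J : Ideal A} {J' : Ideal B} (hJ : J ≤ J'.comap φ) {k : ℕ}
    {σ : Cochain x k} (hσ : σ ∈ cochainIdeal x J k) :
    cochainMap φ x y p h k σ ∈ cochainIdeal y J' k := by
  intro T
  have h1 := Ideal.mem_map_of_mem (Loc.map φ x y p h T.1) (hσ T)
  rw [Ideal.map_map] at h1
  have h2 : (Loc.map φ x y p h T.1).comp (algebraMap A (Loc x T.1)) =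
      (algebraMap B (Loc y T.1)).comp φ := RingHom.ext (Loc.map_algebraMap φ x y p h T.1)
  rw [h2, ← Ideal.map_map] at h1
  exact Ideal.map_mono (Ideal.map_le_iff_le_comap.mpr hJ) h1

/-- Let `φ` be an endomorphism with `φ f = f ^ p`, inducing maps `A/(J + (f)) → A/(J' + (f ^ t))`
and `A/J → A/J'`. If the connecting homomorphisms take `σ` to `τ`, then they take `φ σ` to
`f ^ (p - t) φ τ`. -/
theorem connecting_cochainMap_mem_cobMod (φ : A →+* A) {p t : ℕ} (h : ∀ i, φ (x i) = x i ^ p)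
    (htp : t ≤ p) {J J' : Ideal A} (hJ : J ≤ J'.comap φ) {f : A} (hφf : φ f = f ^ p)
    (hf' : NzdMod J' (f ^ t)) {k : ℕ} {σ : Cochain x k} {τ : Cochain x (k + 1)}
    (hστ : cechD x k σ - f • τ ∈ cochainIdeal x J (k + 1)) (g : A)
    (hσ : g • cochainMap φ x x p h k σ ∈ cobMod x (J' ⊔ Ideal.span {f ^ t}) k) :
    (g * f ^ (p - t)) • cochainMap φ x x p h (k + 1) τ ∈ cobMod x J' (k + 1) := by
  refine connecting_mem_cobMod hf' ?_ hσ
  have h1 := Submodule.smul_mem _ g (cochainMap_mem_cochainIdeal φ x p h hJ hστ)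
  rw [map_sub, cochainMap_cechD, LinearMap.map_smulₛₗ, hφf, smul_sub, ← map_smul, smul_smul] at h1
  rw [smul_smul]
  convert h1 using 3
  rw [mul_left_comm, ← pow_add, Nat.add_sub_cancel' htp]

end Connecting

/-! ### Homogeneous cochains -/

section Homogeneous

variable {ι : Type*} [LinearOrder ι] {F A : Type u} [CommRing F] [CommRing A] [Algebra F A]
  (𝒜 : ℕ → Submodule F A) [GradedAlgebra 𝒜] {x : ι → A} (hx : ∀ i, x i ∈ 𝒜 1)

theorem res_mem_degreePiece {T U : Finset ι} (h : T ⊆ U) {j : ℤ} {z : Loc x T}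
    (hz : z ∈ Loc.degreePiece 𝒜 x hx T j) : Loc.res x h z ∈ Loc.degreePiece 𝒜 x hx U j := by
  obtain ⟨e, a, ha, hza⟩ := hz
  refine ⟨e, a * (∏ i ∈ U \ T, x i) ^ e, ?_, ?_⟩
  · have := mul_mem_intPiece 𝒜 ha (prod_pow_mem 𝒜 x hx (U \ T) e)
    rwa [add_assoc, ← Nat.cast_add, ← mul_add, add_comm T.card,
      Finset.card_sdiff_add_card_eq_card h] at this
  · have hp : (∏ i ∈ U, x i) ^ e = (∏ i ∈ T, x i) ^ e * (∏ i ∈ U \ T, x i) ^ e := by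
      rw [← mul_pow, mul_comm, Finset.prod_sdiff h]
    rw [hp, map_mul, map_mul, ← mul_assoc]
    congr 1
    rw [← (Loc.res x h).commutes, ← map_mul, hza, (Loc.res x h).commutes]

theorem cechD_mem_degreePiece {k : ℕ} {j : ℤ} {σ : Cochain x k}
    (hσ : ∀ T, σ T ∈ Loc.degreePiece 𝒜 x hx T.1 j) (T : {T : Finset ι // T.card = k + 1}) :
    cechD x k σ T ∈ Loc.degreePiece 𝒜 x hx T.1 j := by
  rw [cechD_apply]
  refine sum_mem fun i _ => ?_
  have := res_mem_degreePiece 𝒜 hx (face_subset T i) (hσ (face T i))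
  rcases neg_one_pow_eq_or A (T.1.filter (· < i.1)).card with h | h
  · rwa [h, one_smul]
  · rw [h, neg_one_smul]
    exact neg_mem this

theorem exists_mul_of_mem_sup {J : Ideal A} (hJ : J.IsHomogeneous 𝒜) {f : A} {d : ℕ}
    (hf : f ∈ 𝒜 d) {m : ℤ} {a : A} (ha : a ∈ intPiece 𝒜 m) (haJ : a ∈ J ⊔ Ideal.span {f}) :
    ∃ h ∈ intPiece 𝒜 (m - d), a - f * h ∈ J := by
  cases m with
  | negSucc m =>
    obtain rfl : a = 0 := ha
    exact ⟨0, zero_mem _, by rw [mul_zero, sub_zero]; exact zero_mem _⟩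
  | ofNat m =>
    obtain ⟨b, hb, h, rfl⟩ := mem_sup_span_singleton.mp haJ
    have h1 := DirectSum.decompose_of_mem_same 𝒜 ha
    rw [DirectSum.decompose_add, DirectSum.add_apply, Submodule.coe_add] at h1
    by_cases hdm : d ≤ m
    · refine ⟨DirectSum.decompose 𝒜 h (m - d), ?_, ?_⟩
      · rw [Int.ofNat_eq_natCast, ← Nat.cast_sub hdm]
        exact SetLike.coe_mem _
      · rw [← h1, DirectSum.coe_decompose_mul_of_left_mem_of_le 𝒜 hf hdm, add_sub_cancel_right]
        exact hJ m hb
    · refine ⟨0, zero_mem _, ?_⟩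
      rw [← h1, DirectSum.coe_decompose_mul_of_left_mem_of_not_le 𝒜 hf hdm, mul_zero, sub_zero,
        add_zero]
      exact hJ m hb

/-- A homogeneous cochain that vanishes modulo `J + (f)` is `f τ` modulo `J` for a
homogeneous `τ`. -/
theorem exists_homogeneous_smul {J : Ideal A} (hJ : J.IsHomogeneous 𝒜) {f : A} {d : ℕ}
    (hf : f ∈ 𝒜 d) {k : ℕ} {j : ℤ} {σ : Cochain x k}
    (hσ : ∀ T, σ T ∈ Loc.degreePiece 𝒜 x hx T.1 j)
    (hσJ : σ ∈ cochainIdeal x (J ⊔ Ideal.span {f}) k) :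
    ∃ τ : Cochain x k, (∀ T, τ T ∈ Loc.degreePiece 𝒜 x hx T.1 (j - d)) ∧
      σ - f • τ ∈ cochainIdeal x J k := by
  have key : ∀ T : {T : Finset ι // T.card = k}, ∃ w ∈ Loc.degreePiece 𝒜 x hx T.1 (j - d),
      σ T - f • w ∈ J.map (algebraMap A (Loc x T.1)) := by
    intro T
    obtain ⟨e, a, ha, hz⟩ := hσ T
    have h1 : algebraMap A (Loc x T.1) a ∈
        (J ⊔ Ideal.span {f}).map (algebraMap A (Loc x T.1)) := by
      rw [← hz, Loc.mul_mem_map_iff]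
      exact hσJ T
    obtain ⟨M, hM⟩ := (Loc.algebraMap_mem_map_iff x _).mp h1
    rw [mul_comm] at hM
    obtain ⟨b, hb, hab⟩ := exists_mul_of_mem_sup 𝒜 hJ hf
      (mul_mem_intPiece 𝒜 ha (prod_pow_mem 𝒜 x hx T.1 M)) hM
    obtain ⟨u, hu⟩ := Loc.isUnit_prod x T.1 (e + M)
    refine ⟨algebraMap A _ b * (↑u⁻¹ : Loc x T.1), ⟨e + M, b, ?_, ?_⟩, ?_⟩
    · convert hb using 2
      push_cast
      ring
    · rw [← hu, mul_assoc, Units.inv_mul, mul_one]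
    · rw [← Loc.mul_mem_map_iff x J (e + M), sub_mul, Algebra.smul_def, ← hu, mul_assoc,
        mul_assoc, Units.inv_mul, mul_one, hu, pow_add, map_mul, ← mul_assoc, hz, ← map_mul,
        ← map_mul, ← map_sub]
      exact Ideal.mem_map_of_mem _ hab
  choose τ hτ hτ' using key
  exact ⟨τ, hτ, hτ'⟩

end Homogeneous

/-! ### Čech cohomology of the polynomial ring -/

section PolynomialRing

open MvPolynomial

variable {R : Type u} [CommRing R] {n : ℕ}

theorem nzdMod_X_span {σ : Type*} {s : Set σ} {i : σ} (hi : i ∉ s) :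
    NzdMod (Ideal.span (X '' s)) (X i : MvPolynomial σ R) := by
  intro a ha
  rw [mem_ideal_span_X_image] at ha ⊢
  intro m hm
  obtain ⟨j, hj, hmj⟩ := ha (Finsupp.single i 1 + m) (by
    rw [mem_support_iff, coeff_X_mul]
    exact mem_support_iff.mp hm)
  have hij : i ≠ j := fun h => hi (h ▸ hj)
  refine ⟨j, hj, ?_⟩
  rwa [Finsupp.add_apply, Finsupp.single_eq_of_ne hij.symm, zero_add] at hmj

theorem span_image_lt_succ {c : ℕ} {B : Type*} [CommRing B] (f : Fin c → B) (i : Fin c) :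
    Ideal.span (f '' {j | j.1 < i.1}) ⊔ Ideal.span {f i} =
      Ideal.span (f '' {j | j.1 < i.1 + 1}) := by
  rw [← Ideal.span_union]
  congr 1
  ext a
  constructor
  · rintro (⟨j, hj, rfl⟩ | rfl)
    · exact ⟨j, Nat.lt_succ_of_lt hj, rfl⟩
    · exact ⟨i, Nat.lt_succ_self _, rfl⟩
  · rintro ⟨j, hj, rfl⟩
    rcases (Nat.lt_succ_iff_lt_or_eq.mp hj) with h | h
    · exact Or.inl ⟨j, h, rfl⟩
    · exact Or.inr (congrArg f (Fin.ext h))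

theorem span_image_lt_eq {A : Type*} [CommRing A] {c : ℕ} (f : Fin c → A) :
    Ideal.span (f '' {j | j.1 < c}) = genIdeal f := by
  rw [genIdeal, ← Set.image_univ]
  congr 2
  ext j
  simp

/-- The local cohomology of the polynomial ring in `n + 1` variables vanishes below degree
`n + 1`. -/
theorem vanishes_bot (n : ℕ) {k : ℕ} (hk : k < n + 1) :
    Vanishes (X : Fin (n + 1) → MvPolynomial (Fin (n + 1)) R) ⊥ k := by
  -- descending induction on the number `m` of variables that are divided out
  have key : ∀ r m k : ℕ, m + r = n + 1 → k < r →
      Vanishes (X : Fin (n + 1) → MvPolynomial (Fin (n + 1)) R)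
        (Ideal.span (X '' {j | j.1 < m})) k := by
    intro r
    induction r with
    | zero => intro m k _ hk; exact absurd hk (Nat.not_lt_zero k)
    | succ r ih =>
      intro m k hm hk
      refine Vanishes.of_sup_variable (i := ⟨m, by omega⟩)
        (nzdMod_X_span (fun h => lt_irrefl m h)) ?_
      rintro k' rfl
      rw [span_image_lt_succ X ⟨m, by omega⟩]
      exact ih (m + 1) k' (by omega) (by omega)
  have := key (n + 1) 0 k (zero_add _) hk
  simpa using this

end PolynomialRing

/-! ### Cochains over a quotient ring -/

section Quotient

variable {ι : Type*} [LinearOrder ι] {A B : Type u} [CommRing A] [CommRing B] {x : ι → A}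
  {y : ι → B} {π : A →+* B} (hπ : Function.Surjective π) (h : ∀ i, π (x i) = y i ^ 1)

theorem map_prod_pow (h : ∀ i, π (x i) = y i ^ 1) (T : Finset ι) (e : ℕ) :
    π ((∏ i ∈ T, x i) ^ e) = (∏ i ∈ T, y i) ^ e := by
  rw [map_pow, map_prod]
  congr 1
  exact Finset.prod_congr rfl fun i _ => by rw [h, pow_one]

theorem Loc.exists_map_eq {T : Finset ι} {z : Loc y T} {e : ℕ} {a : A}
    (hz : z * algebraMap B (Loc y T) ((∏ i ∈ T, y i) ^ e) = algebraMap B (Loc y T) (π a)) :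
    ∃ w : Loc x T, w * algebraMap A (Loc x T) ((∏ i ∈ T, x i) ^ e) = algebraMap A (Loc x T) a ∧
      Loc.map π x y 1 h T w = z := by
  obtain ⟨u, hu⟩ := Loc.isUnit_prod x T e
  have hw : algebraMap A _ a * (↑u⁻¹ : Loc x T) *
      algebraMap A (Loc x T) ((∏ i ∈ T, x i) ^ e) = algebraMap A (Loc x T) a := by
    rw [← hu, mul_assoc, Units.inv_mul, mul_one]
  refine ⟨_, hw, (Loc.isUnit_prod y T e).mul_right_cancel ?_⟩
  rw [hz, ← map_prod_pow h, ← Loc.map_algebraMap π x y 1 h T, ← map_mul, hw, Loc.map_algebraMap]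

theorem cochainMap_surjective (hπ : Function.Surjective π) (k : ℕ) :
    Function.Surjective (cochainMap π x y 1 h k) := by
  intro τ
  have key : ∀ T : {T : Finset ι // T.card = k}, ∃ w, Loc.map π x y 1 h T.1 w = τ T := by
    intro T
    obtain ⟨e, b, hb⟩ := Loc.exists_mul_eq y (τ T)
    obtain ⟨a, rfl⟩ := hπ b
    obtain ⟨w, -, hw⟩ := Loc.exists_map_eq h hb
    exact ⟨w, hw⟩
  choose w hw using key
  exact ⟨w, funext hw⟩

theorem cochainMap_eq_zero_iff {k : ℕ} {σ : Cochain x k} :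
    cochainMap π x y 1 h k σ = 0 ↔ σ ∈ cochainIdeal x (RingHom.ker π) k := by
  rw [funext_iff, mem_cochainIdeal]
  refine forall_congr' fun T => ?_
  change Loc.map π x y 1 h T.1 (σ T) = 0 ↔ _
  obtain ⟨e, a, ha⟩ := Loc.exists_mul_eq x (σ T)
  rw [← Loc.mul_mem_map_iff x _ e, ha, Loc.algebraMap_mem_map_iff,
    ← (Loc.isUnit_prod y T.1 e).mul_left_eq_zero, ← map_prod_pow h,
    ← Loc.map_algebraMap π x y 1 h T.1, ← map_mul, ha, Loc.map_algebraMap,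
    IsLocalization.map_eq_zero_iff (Submonoid.powers (∏ i ∈ T.1, y i))]
  constructor
  · rintro ⟨⟨_, N, rfl⟩, hN⟩
    refine ⟨N, ?_⟩
    rw [RingHom.mem_ker, map_mul, map_prod_pow h]
    exact hN
  · rintro ⟨N, hN⟩
    refine ⟨⟨_, N, rfl⟩, ?_⟩
    rw [RingHom.mem_ker, map_mul, map_prod_pow h] at hN
    exact hN

theorem cochainMap_mem_coboundaries_iff (hπ : Function.Surjective π) {k : ℕ} {σ : Cochain x k} :
    cochainMap π x y 1 h k σ ∈ coboundaries y k ↔ σ ∈ cobMod x (RingHom.ker π) k := by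
  constructor
  · intro hσ
    cases k with
    | zero => exact Submodule.mem_sup_right ((cochainMap_eq_zero_iff h).mp hσ)
    | succ k =>
      obtain ⟨τ, hτ⟩ := hσ
      obtain ⟨ρ, rfl⟩ := cochainMap_surjective h hπ k τ
      refine mem_cobMod_succ.mpr ⟨ρ, (cochainMap_eq_zero_iff h).mp ?_⟩
      rw [map_sub, ← hτ, cochainMap_cechD, sub_self]
  · intro hσ
    obtain ⟨ρ, hρ, σ', hσ', rfl⟩ := Submodule.mem_sup.mp hσ
    rw [map_add, (cochainMap_eq_zero_iff h).mpr hσ', add_zero]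
    exact cochainMap_mem_coboundaries π x y 1 h k ρ hρ

/-- Injectivity of the map of degree `0` pieces, in terms of cochains. -/
theorem degreeZeroMap_injective {F : Type u} [CommRing F] [Algebra F A] [Algebra F B]
    (𝒜 : ℕ → Submodule F A) [SetLike.GradedMonoid 𝒜] (hx : ∀ i, x i ∈ 𝒜 1)
    (ℬ : ℕ → Submodule F B) [SetLike.GradedMonoid ℬ] (φ : A →+* B) (hy : ∀ i, y i ∈ ℬ 1) (p : ℕ)
    (h : ∀ i, φ (x i) = y i ^ p) (hφ : ∀ i, ∀ a ∈ 𝒜 i, φ a ∈ ℬ (p * i)) (k : ℕ)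
    (hinj : ∀ σ : Cochain x k, (∀ T, σ T ∈ Loc.degreePiece 𝒜 x hx T.1 0) → cechD x k σ = 0 →
      cochainMap φ x y p h k σ ∈ coboundaries y k → σ ∈ coboundaries x k) :
    Function.Injective (degreeZeroMap 𝒜 x hx ℬ φ y hy p h hφ k) := by
  rw [injective_iff_map_eq_zero]
  rintro ⟨ξ, σ, hσ, rfl⟩ h0
  refine Subtype.ext ((Submodule.Quotient.mk_eq_zero _).mpr ?_)
  have h1 : (Submodule.Quotient.mk (cocycleMap φ x y p h k σ) : LocalCohomology y k) = 0 :=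
    congrArg Subtype.val h0
  have h2 := (Submodule.Quotient.mk_eq_zero _).mp h1
  exact hinj σ.1 hσ σ.2 h2

end Quotient

/-! ### Reduction to the top local cohomology of the polynomial ring -/

section Reduction

open MvPolynomial

attribute [local instance] MvPolynomial.gradedAlgebra

variable {F : Type u} [Field F] {n c : ℕ}

theorem span_image_isHomogeneous {f : Fin c → MvPolynomial (Fin (n + 1)) F} {d : Fin c → ℕ}
    (hf : ∀ i, (f i).IsHomogeneous (d i)) (s : Set (Fin c)) :
    (Ideal.span (f '' s)).IsHomogeneous (homogeneousSubmodule (Fin (n + 1)) F) := by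
  refine Ideal.homogeneous_span _ _ ?_
  rintro _ ⟨i, -, rfl⟩
  exact ⟨d i, hf i⟩

theorem RegSeq.nzdMod {A : Type*} [CommRing A] {f : Fin c → A} (h : RegSeq ⊥ (List.ofFn f))
    (i : Fin c) : NzdMod (Ideal.span (f '' {j | j.1 < i.1})) (f i) := by
  have := (regSeq_ofFn_iff f ⊥).mp h i
  rwa [bot_sup_eq] at this

/-- The local cohomology of `S/(f_1, …, f_i)` vanishes below degree `n + 1 - i`. -/
theorem vanishes_span {f : Fin c → MvPolynomial (Fin (n + 1)) F} (hreg : RegSeq ⊥ (List.ofFn f))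
    (i : ℕ) (hi : i ≤ c) {k : ℕ} (hk : k + i < n + 1) :
    Vanishes X (Ideal.span (f '' {j | j.1 < i})) k := by
  induction i generalizing k with
  | zero => simpa using vanishes_bot n hk
  | succ i ih =>
    rw [← span_image_lt_succ f ⟨i, hi⟩]
    exact (ih (by omega) (by omega)).sup (hreg.nzdMod ⟨i, hi⟩) (ih (by omega) (by omega))

theorem map_mem_span_pow {p t : ℕ} (htp : t ≤ p) [ExpChar F p]
    (f : Fin c → MvPolynomial (Fin (n + 1)) F) (s : Set (Fin c)) :
    Ideal.span (f '' s) ≤ (Ideal.span ((fun i => f i ^ t) '' s)).comap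
      (frobenius (MvPolynomial (Fin (n + 1)) F) p) := by
  rw [Ideal.span_le]
  rintro _ ⟨i, hi, rfl⟩
  change frobenius _ p (f i) ∈ Ideal.span ((fun i => f i ^ t) '' s)
  rw [frobenius_def]
  exact Ideal.mem_of_dvd _ (pow_dvd_pow (f i) htp) (Ideal.subset_span
    (Set.mem_image_of_mem (fun i => f i ^ t) hi))

theorem frobenius_X (p : ℕ) [ExpChar F p] (i : Fin (n + 1)) :
    frobenius (MvPolynomial (Fin (n + 1)) F) p (X i) = X i ^ p := rfl

theorem mk_X (f : Fin c → MvPolynomial (Fin (n + 1)) F) (i : Fin (n + 1)) :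
    Ideal.Quotient.mk (genIdeal f) (X i) = varClass f i ^ 1 := (pow_one _).symm

/-- The map of Čech cochains of the polynomial ring induced by Frobenius. -/
noncomputable abbrev frobeniusCochain (F : Type u) [Field F] (p n : ℕ) [ExpChar F p] (k : ℕ) :=
  cochainMap (frobenius (MvPolynomial (Fin (n + 1)) F) p) X X p (frobenius_X p) k

/-- Injectivity on `H^(n+1-i)(S/(f_1, …, f_i))` in degree `-(d_{i+1} + ⋯ + d_c)`, on the classes
killed by all `f_l`, of the composition of Frobenius with multiplication by
`(f_{i+1} ⋯ f_c) ^ (p - t)`: the connecting homomorphisms reduce it to the case `i = 0`. -/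
theorem mem_cobMod_of_top {p t : ℕ} [ExpChar F p] (htp : t ≤ p)
    {f : Fin c → MvPolynomial (Fin (n + 1)) F} {d : Fin c → ℕ}
    (hf : ∀ i, (f i).IsHomogeneous (d i)) (hreg : RegSeq ⊥ (List.ofFn f))
    (htop : ∀ σ : Cochain (X : Fin (n + 1) → MvPolynomial (Fin (n + 1)) F) (n + 1),
      (∀ T, σ T ∈ Loc.degreePiece (homogeneousSubmodule (Fin (n + 1)) F) X
        (isHomogeneous_X F) T.1 (-∑ i, (d i : ℤ))) →
      (∀ l, f l • σ ∈ coboundaries X (n + 1)) →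
      (∏ l, f l) ^ (p - t) • frobeniusCochain F p n (n + 1) σ ∈ coboundaries X (n + 1) →
      σ ∈ coboundaries X (n + 1))
    (i : ℕ) (hi : i ≤ c) {k : ℕ} (hk : k + i = n + 1)
    {σ : Cochain (X : Fin (n + 1) → MvPolynomial (Fin (n + 1)) F) k}
    (hσ : ∀ T, σ T ∈ Loc.degreePiece (homogeneousSubmodule (Fin (n + 1)) F) X
        (isHomogeneous_X F) T.1 (-∑ l with i ≤ l.1, (d l : ℤ)))
    (hd : cechD X k σ ∈ cochainIdeal X (Ideal.span (f '' {j | j.1 < i})) (k + 1))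
    (hfl : ∀ l, f l • σ ∈ cobMod X (Ideal.span (f '' {j | j.1 < i})) k)
    (hF : (∏ l with i ≤ l.1, f l) ^ (p - t) • frobeniusCochain F p n k σ ∈
      cobMod X (Ideal.span ((fun l => f l ^ t) '' {j | j.1 < i})) k) :
    σ ∈ cobMod X (Ideal.span (f '' {j | j.1 < i})) k := by
  induction i generalizing k with
  | zero =>
    obtain rfl : k = n + 1 := hk
    have hbot : cobMod (X : Fin (n + 1) → MvPolynomial (Fin (n + 1)) F) ⊥ (n + 1) =
        coboundaries X (n + 1) := by
      refine sup_eq_left.mpr fun τ hτ => ?_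
      have : τ = 0 := funext fun T => by simpa using hτ T
      rw [this]
      exact zero_mem _
    simp only [zero_le, Finset.filter_true, Nat.not_lt_zero, Set.ofPred_false, Set.image_empty,
      Ideal.span_empty, hbot] at *
    exact htop σ hσ hfl hF
  | succ i ih =>
    have hins : (Finset.univ.filter fun l : Fin c => i ≤ l.1) =
        insert ⟨i, hi⟩ (Finset.univ.filter fun l : Fin c => i + 1 ≤ l.1) := by
      ext l
      simp only [Finset.mem_filter, Finset.mem_univ, true_and, Finset.mem_insert, Fin.ext_iff]
      omega
    have hnot : (⟨i, hi⟩ : Fin c) ∉ (Finset.univ.filter fun l : Fin c => i + 1 ≤ l.1) := by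
      simp
    have hnzd := hreg.nzdMod ⟨i, hi⟩
    have hnzd' := (hreg.pow fun _ => t).nzdMod ⟨i, hi⟩
    rw [← span_image_lt_succ f ⟨i, hi⟩] at hd hfl ⊢
    rw [← span_image_lt_succ (fun l => f l ^ t) ⟨i, hi⟩] at hF
    obtain ⟨τ, hτ, hστ⟩ := exists_homogeneous_smul (homogeneousSubmodule (Fin (n + 1)) F)
      (isHomogeneous_X F) (span_image_isHomogeneous hf _) (hf ⟨i, hi⟩)
      (cechD_mem_degreePiece _ _ hσ) hd
    refine mem_cobMod_of_connecting (vanishes_span hreg i (by omega) (by omega)) hστ ?_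
    refine ih (by omega) (by omega) ?_ (cechD_mem_of_cechD_sub_smul_mem hnzd hστ) ?_ ?_
    · rw [hins, Finset.sum_insert hnot, neg_add_rev, ← sub_eq_add_neg]
      exact hτ
    · intro l
      refine connecting_mem_cobMod hnzd ?_ (hfl l)
      have := Submodule.smul_mem _ (f l) hστ
      rwa [smul_sub, ← map_smul, smul_comm] at this
    · rw [hins, Finset.prod_insert hnot, mul_comm, mul_pow]
      exact connecting_cochainMap_mem_cobMod _ _ htp (map_mem_span_pow htp f _) rfl hnzd' hστ _ hF

theorem frobeniusQuotient_cochainMap {p : ℕ} [Fact p.Prime] [CharP F p]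
    (f : Fin c → MvPolynomial (Fin (n + 1)) F) {t : ℕ} (htp : t ≤ p) {k : ℕ}
    (σ : Cochain (X : Fin (n + 1) → MvPolynomial (Fin (n + 1)) F) k) :
    cochainMap (frobeniusQuotient p f t htp) (varClass f) (varClass fun i => f i ^ t) p
        (frobeniusQuotient_varClass p f t htp) k
        (cochainMap (Ideal.Quotient.mk (genIdeal f)) X (varClass f) 1 (mk_X f)
          k σ) =
      cochainMap (Ideal.Quotient.mk (genIdeal fun i => f i ^ t)) X (varClass fun i => f i ^ t) 1
        (mk_X fun i => f i ^ t) k (frobeniusCochain F p n k σ) := by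
  funext T
  refine DFunLike.congr_fun (f := (Loc.map (frobeniusQuotient p f t htp) _ _ p
      (frobeniusQuotient_varClass p f t htp) T.1).comp (Loc.map (Ideal.Quotient.mk (genIdeal f)) X
        (varClass f) 1 (mk_X f) T.1))
    (g := (Loc.map (Ideal.Quotient.mk (genIdeal fun i => f i ^ t)) X (varClass fun i => f i ^ t) 1
      (mk_X fun i => f i ^ t) T.1).comp
      (Loc.map (frobenius (MvPolynomial (Fin (n + 1)) F) p) X X p (frobenius_X p) T.1)) ?_ (σ T)
  refine IsLocalization.ringHom_ext
    (Submonoid.powers (∏ i ∈ T.1, (X i : MvPolynomial (Fin (n + 1)) F))) (RingHom.ext fun a => ?_)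
  simp only [RingHom.comp_apply, Loc.map_algebraMap, frobeniusQuotient_mk, frobenius_def]

theorem exists_homogeneous_lift (f : Fin c → MvPolynomial (Fin (n + 1)) F) {k : ℕ} {j : ℤ}
    {τ : Cochain (varClass f) k}
    (hτ : ∀ T, τ T ∈ Loc.degreePiece (stdGrading f) (varClass f) (varClass_mem f) T.1 j) :
    ∃ σ : Cochain (X : Fin (n + 1) → MvPolynomial (Fin (n + 1)) F) k,
      (∀ T, σ T ∈ Loc.degreePiece (homogeneousSubmodule (Fin (n + 1)) F) X
        (isHomogeneous_X F) T.1 j) ∧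
      cochainMap (Ideal.Quotient.mk (genIdeal f)) X (varClass f) 1 (mk_X f)
        k σ = τ := by
  have hlift : ∀ (m : ℤ) (b), b ∈ intPiece (stdGrading f) m →
      ∃ a ∈ intPiece (homogeneousSubmodule (Fin (n + 1)) F) m,
        Ideal.Quotient.mk (genIdeal f) a = b := by
    intro m b hb
    cases m with
    | ofNat m => exact hb
    | negSucc m =>
      obtain rfl : b = 0 := hb
      exact ⟨0, zero_mem _, map_zero _⟩
  have key : ∀ T : {T : Finset (Fin (n + 1)) // T.card = k},
      ∃ w ∈ Loc.degreePiece (homogeneousSubmodule (Fin (n + 1)) F) X (isHomogeneous_X F) T.1 j,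
        Loc.map (Ideal.Quotient.mk (genIdeal f)) X (varClass f) 1 (mk_X f)
          T.1 w = τ T := by
    intro T
    obtain ⟨e, b, hb, hz⟩ := hτ T
    obtain ⟨a, ha, rfl⟩ := hlift _ _ hb
    obtain ⟨w, hw, hw'⟩ := Loc.exists_map_eq (x := X) (mk_X f) hz
    exact ⟨w, ⟨e, a, ha, hw⟩, hw'⟩
  choose σ hσ hσ' using key
  exact ⟨σ, hσ, funext hσ'⟩

/-- The theorem follows from a statement on the top local cohomology of the polynomial ring, in
degree `-∑ d_i`. -/
theorem injective_of_top {p t : ℕ} [Fact p.Prime] [CharP F p] (htp : t ≤ p)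
    {f : Fin c → MvPolynomial (Fin (n + 1)) F} {d : Fin c → ℕ}
    (hf : ∀ i, (f i).IsHomogeneous (d i)) (hreg : RegSeq ⊥ (List.ofFn f)) (hc : c ≤ n + 1)
    (htop : ∀ σ : Cochain (X : Fin (n + 1) → MvPolynomial (Fin (n + 1)) F) (n + 1),
      (∀ T, σ T ∈ Loc.degreePiece (homogeneousSubmodule (Fin (n + 1)) F) X
        (isHomogeneous_X F) T.1 (-∑ i, (d i : ℤ))) →
      (∀ l, f l • σ ∈ coboundaries X (n + 1)) →
      (∏ l, f l) ^ (p - t) • frobeniusCochain F p n (n + 1) σ ∈ coboundaries X (n + 1) →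
      σ ∈ coboundaries X (n + 1)) :
    Function.Injective (frobeniusLocalCohomologyZero p f t htp (n + 1 - c)) := by
  have hall : ∀ g : Fin c → MvPolynomial (Fin (n + 1)) F,
      Ideal.span (g '' {j | j.1 < c}) = RingHom.ker (Ideal.Quotient.mk (genIdeal g)) := by
    intro g
    rw [Ideal.mk_ker, span_image_lt_eq]
  have hnone : (Finset.univ.filter fun l : Fin c => c ≤ l.1) = ∅ :=
    Finset.filter_eq_empty_iff.mpr fun l _ => not_le.mpr l.2
  refine degreeZeroMap_injective _ _ _ _ _ _ _ _ _ fun τ hτ hdτ h1 => ?_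
  obtain ⟨σ, hσ, hστ⟩ := exists_homogeneous_lift f hτ
  rw [← hστ, frobeniusQuotient_cochainMap, cochainMap_mem_coboundaries_iff _
    Ideal.Quotient.mk_surjective, ← hall] at h1
  rw [← hστ, cochainMap_mem_coboundaries_iff _ Ideal.Quotient.mk_surjective, ← hall]
  have hd : cechD X _ σ ∈ cochainIdeal X (Ideal.span (f '' {j | j.1 < c})) (n + 1 - c + 1) := by
    rw [hall, ← cochainMap_eq_zero_iff (y := varClass f) (mk_X f),
      cochainMap_cechD, hστ]
    exact hdτ
  refine mem_cobMod_of_top htp hf hreg htop c le_rfl (Nat.sub_add_cancel hc) ?_ hd ?_ ?_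
  · simpa [hnone] using hσ
  · exact fun l => Submodule.mem_sup_right (smul_mem_cochainIdeal
      (Ideal.subset_span (Set.mem_image_of_mem f l.2)) σ)
  · rw [hnone, Finset.prod_empty, one_pow, one_smul]
    exact h1

end Reduction

/-! ### The top local cohomology of the polynomial ring -/

section Top

open MvPolynomial

attribute [local instance] MvPolynomial.gradedAlgebra

variable {F : Type u} [Field F] {n c : ℕ}

/-- The ideal `(x_0 ^ N, …, x_n ^ N)`. -/
noncomputable abbrev powIdeal (F : Type u) [Field F] (n N : ℕ) :
    Ideal (MvPolynomial (Fin (n + 1)) F) :=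
  Ideal.span (Set.range fun i => X i ^ N)

theorem mem_powIdeal_iff {N : ℕ} {s : MvPolynomial (Fin (n + 1)) F} :
    s ∈ powIdeal F n N ↔ ∀ m ∈ s.support, ∃ i, N ≤ m i := by
  have : (Set.range fun i : Fin (n + 1) => (X i ^ N : MvPolynomial (Fin (n + 1)) F)) =
      (fun m => monomial m (1 : F)) '' Set.range fun i => Finsupp.single i N := by
    rw [← Set.range_comp]
    congr 1
    funext i
    exact X_pow_eq_monomial
  rw [powIdeal, this, mem_ideal_span_monomial_image]
  simp

theorem prod_X_pow (N : ℕ) : (∏ i : Fin (n + 1), (X i : MvPolynomial (Fin (n + 1)) F)) ^ N =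
    monomial (Finsupp.equivFunOnFinite.symm fun _ => N) 1 := by
  rw [← Finset.prod_pow, monomial_eq, C_1, one_mul, Finsupp.prod_fintype _ _ fun i => pow_zero _]
  rfl

theorem mul_prod_pow_mem_powIdeal_iff {N L : ℕ} {s : MvPolynomial (Fin (n + 1)) F} :
    s * (∏ i : Fin (n + 1), X i) ^ L ∈ powIdeal F n (N + L) ↔ s ∈ powIdeal F n N := by
  rw [prod_X_pow, mem_powIdeal_iff, mem_powIdeal_iff]
  constructor
  · intro h m hm
    obtain ⟨i, hi⟩ := h (m + Finsupp.equivFunOnFinite.symm fun _ => L) (by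
      rw [mem_support_iff, coeff_mul_monomial, mul_one]
      exact mem_support_iff.mp hm)
    exact ⟨i, Nat.le_of_add_le_add_right hi⟩
  · intro h m hm
    rw [mem_support_iff, coeff_mul_monomial'] at hm
    split_ifs at hm with hle
    · rw [mul_one] at hm
      obtain ⟨i, hi⟩ := h _ (mem_support_iff.mpr hm)
      refine ⟨i, ?_⟩
      have h1 : L ≤ m i := hle i
      have h2 : N ≤ m i - L := hi
      omega
    · exact absurd rfl hm

theorem mul_prod_erase_pow (i : Fin (n + 1)) (N : ℕ) :
    (∏ j : Fin (n + 1), (X j : MvPolynomial (Fin (n + 1)) F)) ^ N =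
      X i ^ N * (∏ j ∈ Finset.univ.erase i, X j) ^ N := by
  rw [← mul_pow, Finset.mul_prod_erase _ _ (Finset.mem_univ i)]

/-- The localization of `F[x_0, …, x_n]` at `x_0 ⋯ x_n`. -/
abbrev TopLoc (F : Type u) [Field F] (n : ℕ) : Type u :=
  Loc (X : Fin (n + 1) → MvPolynomial (Fin (n + 1)) F) Finset.univ

theorem eq_univ_of_card (T : {T : Finset (Fin (n + 1)) // T.card = n + 1}) :
    T = ⟨Finset.univ, by simp⟩ :=
  Subtype.ext (Finset.eq_univ_of_card _ (by rw [T.2, Fintype.card_fin]))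

/-- The class of `s / (x_0 ⋯ x_n) ^ N` in the top local cohomology of `F[x_0, …, x_n]` vanishes
if and only if `s` lies in `(x_0 ^ N, …, x_n ^ N)`. -/
theorem mem_coboundaries_iff
    {σ : Cochain (X : Fin (n + 1) → MvPolynomial (Fin (n + 1)) F) (n + 1)} {N : ℕ}
    {s : MvPolynomial (Fin (n + 1)) F}
    (hs : σ ⟨Finset.univ, by simp⟩ * algebraMap (MvPolynomial (Fin (n + 1)) F)
      (TopLoc F n) ((∏ i : Fin (n + 1), X i) ^ N) =
        algebraMap (MvPolynomial (Fin (n + 1)) F) (TopLoc F n) s) :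
    σ ∈ coboundaries X (n + 1) ↔ s ∈ powIdeal F n N := by
  set T₀ : {T : Finset (Fin (n + 1)) // T.card = n + 1} := ⟨Finset.univ, by simp⟩ with hT₀
  have hcard : ∀ i : Fin (n + 1), (Finset.univ.erase i).card = n := fun i => by
    rw [Finset.card_erase_of_mem (Finset.mem_univ i), Finset.card_univ, Fintype.card_fin,
      Nat.add_sub_cancel]
  have hsgn : ∀ q : ℕ, (-1 : MvPolynomial (Fin (n + 1)) F) ^ q * (-1) ^ q = 1 := fun q => by
    rw [← mul_pow, neg_one_mul, neg_neg, one_pow]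
  -- clearing the denominator of a component of a cochain at the complement of `i`
  have hres : ∀ (i : Fin (n + 1)) (M : ℕ)
      (w : Loc (X : Fin (n + 1) → MvPolynomial (Fin (n + 1)) F) (Finset.univ.erase i))
      (g : MvPolynomial (Fin (n + 1)) F),
      w * algebraMap (MvPolynomial (Fin (n + 1)) F) _ ((∏ j ∈ Finset.univ.erase i, X j) ^ M) =
        algebraMap _ _ g →
      Loc.res (X : Fin (n + 1) → MvPolynomial (Fin (n + 1)) F) (Finset.subset_univ _) w *
        algebraMap (MvPolynomial (Fin (n + 1)) F) (TopLoc F n)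
          ((∏ j : Fin (n + 1), X j) ^ M) =
        algebraMap (MvPolynomial (Fin (n + 1)) F) (TopLoc F n) (g * X i ^ M) := by
    intro i M w g h
    rw [mul_prod_erase_pow i, mul_comm (X i ^ M : MvPolynomial (Fin (n + 1)) F),
      map_mul, map_mul, ← mul_assoc,
      ← (Loc.res X (Finset.subset_univ (Finset.univ.erase i))).commutes, ← map_mul, h,
      (Loc.res X (Finset.subset_univ (Finset.univ.erase i))).commutes]
  constructor
  · rintro ⟨ρ, rfl⟩
    have h1 : ∀ i : Fin (n + 1), ∃ (e : ℕ) (g : MvPolynomial (Fin (n + 1)) F),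
        ρ ⟨_, hcard i⟩ * algebraMap (MvPolynomial (Fin (n + 1)) F) _
            ((∏ j ∈ Finset.univ.erase i, X j) ^ e) =
          algebraMap _ _ g := fun i => Loc.exists_mul_eq X (ρ ⟨_, hcard i⟩)
    choose e g hg using h1
    set M := Finset.univ.sup e with hM
    have h2 : cechD X n ρ T₀ * algebraMap (MvPolynomial (Fin (n + 1)) F) (TopLoc F n)
          ((∏ j : Fin (n + 1), X j) ^ M) =
        algebraMap (MvPolynomial (Fin (n + 1)) F) _ (∑ i, (-1) ^ (Finset.univ.filter (· < i)).card *
          (g i * (∏ j ∈ Finset.univ.erase i, X j) ^ (M - e i) * X i ^ M)) := by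
      rw [cechD_eq_sum, Finset.sum_mul, map_sum]
      refine Finset.sum_congr rfl fun i _ => ?_
      rw [smul_mul_assoc, Algebra.smul_def, map_mul,
        evalAt_eq ρ ⟨_, hcard i⟩ (Finset.subset_univ _)]
      congr 1
      refine hres i M _ _ ?_
      rw [map_mul, ← hg, mul_assoc, ← map_mul, ← pow_add,
        Nat.add_sub_cancel' (Finset.le_sup (Finset.mem_univ i))]
    set s' := ∑ i, (-1) ^ (Finset.univ.filter (· < i)).card *
          (g i * (∏ j ∈ Finset.univ.erase i, X j) ^ (M - e i) * X i ^ M) with hs'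
    have hs'mem : s' ∈ powIdeal F n M := sum_mem fun i _ =>
      Ideal.mul_mem_left _ _ (Ideal.mul_mem_left _ _ (Ideal.subset_span ⟨i, rfl⟩))
    have h3 : algebraMap (MvPolynomial (Fin (n + 1)) F) (TopLoc F n)
          (s * (∏ j : Fin (n + 1), X j) ^ M) =
        algebraMap (MvPolynomial (Fin (n + 1)) F) (TopLoc F n)
          (s' * (∏ j : Fin (n + 1), X j) ^ N) := by
      rw [map_mul, map_mul, ← hs, ← h2]
      ring
    obtain ⟨⟨_, K, rfl⟩, h4⟩ := IsLocalization.exists_of_eq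
      (M := Submonoid.powers (∏ j : Fin (n + 1), (X j : MvPolynomial (Fin (n + 1)) F))) h3
    have h5 : s * (∏ j : Fin (n + 1), X j) ^ (M + K) =
        s' * (∏ j : Fin (n + 1), X j) ^ (N + K) := by
      have h4' : (∏ j : Fin (n + 1), (X j : MvPolynomial (Fin (n + 1)) F)) ^ K *
          (s * (∏ j : Fin (n + 1), X j) ^ M) =
        (∏ j : Fin (n + 1), X j) ^ K * (s' * (∏ j : Fin (n + 1), X j) ^ N) := h4
      rw [pow_add, pow_add]
      linear_combination h4'
    rw [← mul_prod_pow_mem_powIdeal_iff (L := M + K), h5, add_left_comm,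
      mul_prod_pow_mem_powIdeal_iff]
    exact hs'mem
  · intro hmem
    obtain ⟨g, hg⟩ := Ideal.mem_span_range_iff_exists_fun.mp hmem
    have h1 : ∀ V : {V : Finset (Fin (n + 1)) // V.card = n},
        ∃ w : Loc (X : Fin (n + 1) → MvPolynomial (Fin (n + 1)) F) V.1, ∀ i,
        V.1 = Finset.univ.erase i →
          w * algebraMap (MvPolynomial (Fin (n + 1)) F) _ ((∏ j ∈ V.1, X j) ^ N) =
            algebraMap (MvPolynomial (Fin (n + 1)) F) _
              ((-1) ^ (Finset.univ.filter (· < i)).card * g i) := by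
      intro V
      obtain ⟨u, hu⟩ := Loc.isUnit_prod (X : Fin (n + 1) → MvPolynomial (Fin (n + 1)) F) V.1 N
      by_cases hV : ∃ i, V.1 = Finset.univ.erase i
      · obtain ⟨i, hi⟩ := hV
        refine ⟨algebraMap (MvPolynomial (Fin (n + 1)) F) _
          ((-1) ^ (Finset.univ.filter (· < i)).card * g i) * (u⁻¹).val, fun i' hi' => ?_⟩
        have : i' = i := by
          by_contra hne
          have h2 : i' ∈ V.1 := by rw [hi]; exact Finset.mem_erase.mpr ⟨hne, Finset.mem_univ _⟩
          rw [hi'] at h2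
          exact Finset.notMem_erase _ _ h2
        rw [this, ← hu, mul_assoc, Units.inv_mul, mul_one]
      · exact ⟨0, fun i hi => absurd ⟨i, hi⟩ hV⟩
    choose ρ hρ using h1
    refine ⟨ρ, funext fun T => ?_⟩
    rw [eq_univ_of_card T]
    refine (Loc.isUnit_prod X Finset.univ N).mul_right_cancel ?_
    rw [hs, cechD_eq_sum, Finset.sum_mul, ← hg, map_sum]
    refine Finset.sum_congr rfl fun i _ => ?_
    rw [smul_mul_assoc, evalAt_eq ρ ⟨_, hcard i⟩ (Finset.subset_univ _),
      hres i N _ _ (hρ ⟨_, hcard i⟩ i rfl), Algebra.smul_def, ← map_mul]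
    congr 1
    rw [← mul_assoc, ← mul_assoc, hsgn, one_mul]

/-- The injectivity statement for the top local cohomology of the polynomial ring, in terms of
polynomials. -/
theorem top_of_polynomial {p t : ℕ} [ExpChar F p]
    {f : Fin c → MvPolynomial (Fin (n + 1)) F} {d : Fin c → ℕ}
    (hpoly : ∀ (N m : ℕ) (s : MvPolynomial (Fin (n + 1)) F), s.IsHomogeneous m →
      m + ∑ i, d i = N * (n + 1) → (∀ l, f l * s ∈ powIdeal F n N) →
      (∏ l, f l) ^ (p - t) * s ^ p ∈ powIdeal F n (p * N) → s ∈ powIdeal F n N)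
    (σ : Cochain (X : Fin (n + 1) → MvPolynomial (Fin (n + 1)) F) (n + 1))
    (hσ : ∀ T, σ T ∈ Loc.degreePiece (homogeneousSubmodule (Fin (n + 1)) F) X
        (isHomogeneous_X F) T.1 (-∑ i, (d i : ℤ)))
    (hf : ∀ l, f l • σ ∈ coboundaries X (n + 1))
    (hF : (∏ l, f l) ^ (p - t) • frobeniusCochain F p n (n + 1) σ ∈ coboundaries X (n + 1)) :
    σ ∈ coboundaries X (n + 1) := by
  obtain ⟨N, s, hsdeg, hs⟩ := hσ ⟨Finset.univ, by simp⟩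
  rw [mem_coboundaries_iff hs]
  have hsmul : ∀ (g : MvPolynomial (Fin (n + 1)) F) (M : ℕ)
      (τ : Cochain (X : Fin (n + 1) → MvPolynomial (Fin (n + 1)) F) (n + 1))
      (s : MvPolynomial (Fin (n + 1)) F),
      τ ⟨Finset.univ, by simp⟩ * algebraMap (MvPolynomial (Fin (n + 1)) F) _
          ((∏ i : Fin (n + 1), X i) ^ M) =
        algebraMap (MvPolynomial (Fin (n + 1)) F) (TopLoc F n) s →
      (g • τ) ⟨Finset.univ, by simp⟩ * algebraMap (MvPolynomial (Fin (n + 1)) F) _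
          ((∏ i : Fin (n + 1), X i) ^ M) =
        algebraMap (MvPolynomial (Fin (n + 1)) F) (TopLoc F n) (g * s) := by
    intro g M τ s h
    rw [Pi.smul_apply, smul_mul_assoc, h, Algebra.smul_def, map_mul]
  have h1 : ∀ l, f l * s ∈ powIdeal F n N := fun l =>
    (mem_coboundaries_iff (hsmul _ _ _ _ hs)).mp (hf l)
  have h2 : frobeniusCochain F p n (n + 1) σ ⟨Finset.univ, by simp⟩ *
      algebraMap (MvPolynomial (Fin (n + 1)) F) _ ((∏ i : Fin (n + 1), X i) ^ (p * N)) =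
        algebraMap (MvPolynomial (Fin (n + 1)) F) (TopLoc F n) (s ^ p) := by
    have := congrArg (Loc.map (frobenius (MvPolynomial (Fin (n + 1)) F) p) X X p
      (frobenius_X p) Finset.univ) hs
    rw [map_mul, Loc.map_algebraMap, Loc.map_algebraMap, frobenius_def, frobenius_def, ← pow_mul,
      mul_comm N] at this
    exact this
  have h3 := (mem_coboundaries_iff (hsmul _ _ _ _ h2)).mp hF
  have hcases : s = 0 ∨ ∃ m : ℕ, s.IsHomogeneous m ∧ m + ∑ i, d i = N * (n + 1) := by
    rw [Finset.card_univ, Fintype.card_fin] at hsdeg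
    obtain ⟨m, hm⟩ : ∃ m : ℤ, m = -∑ i, (d i : ℤ) + ((N * (n + 1) : ℕ) : ℤ) := ⟨_, rfl⟩
    rw [← hm] at hsdeg
    cases m with
    | negSucc m => exact Or.inl hsdeg
    | ofNat m =>
      refine Or.inr ⟨m, hsdeg, ?_⟩
      rw [Int.ofNat_eq_natCast] at hm
      zify
      push_cast at hm
      linarith
  rcases hcases with rfl | ⟨m, hm, hmd⟩
  · exact zero_mem _
  · exact hpoly N m s hm hmd h1 h3

end Top

/-! ### Differentiating the relation -/

section Differentiation

open MvPolynomial

variable {F : Type u} [Field F] {n c : ℕ}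

/-- The ideal generated by the `c × c` minors of the Jacobian matrix of `f_1, …, f_c`. -/
noncomputable def minorIdeal (f : Fin c → MvPolynomial (Fin (n + 1)) F) :
    Ideal (MvPolynomial (Fin (n + 1)) F) :=
  Ideal.span (Set.range fun s : Fin c → Fin (n + 1) =>
    (Matrix.of fun l j => pderiv (s l) (f j)).det)

theorem derivation_prod_pow {R A : Type*} [CommRing R] [CommRing A] [Algebra R A]
    (D : Derivation R A A) {ι : Type*} [DecidableEq ι] (s : Finset ι) (f : ι → A) (k : ι → ℕ) :
    D (∏ l ∈ s, f l ^ k l) =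
      ∑ j ∈ s, D (f j) * (k j * (f j ^ (k j - 1) * ∏ l ∈ s.erase j, f l ^ k l)) := by
  induction s using Finset.induction_on with
  | empty => simp
  | insert i s hi ih =>
    rw [Finset.prod_insert hi, D.leibniz, ih, D.leibniz_pow, Finset.sum_insert hi,
      Finset.erase_insert hi, add_comm, Finset.smul_sum]
    congr 1
    · simp only [smul_eq_mul, nsmul_eq_mul]
      ring
    · refine Finset.sum_congr rfl fun j hj => ?_
      rw [Finset.erase_insert_of_ne (ne_of_mem_of_not_mem hj hi).symm,
        Finset.prod_insert (fun h => hi (Finset.mem_of_mem_erase h)), smul_eq_mul]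
      ring

theorem derivation_pow_char {R A : Type*} [CommRing R] [CommRing A] [Algebra R A]
    (D : Derivation R A A) (p : ℕ) [CharP A p] (y : A) (N : ℕ) : D (y ^ (p * N)) = 0 := by
  rw [D.leibniz_pow, nsmul_eq_mul, Nat.cast_mul, CharP.cast_eq_zero, zero_mul, zero_mul]

theorem derivation_mem_powIdeal (p : ℕ) [CharP F p]
    (D : Derivation F (MvPolynomial (Fin (n + 1)) F) (MvPolynomial (Fin (n + 1)) F)) {N : ℕ}
    {y : MvPolynomial (Fin (n + 1)) F} (hy : y ∈ powIdeal F n (p * N)) :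
    D y ∈ powIdeal F n (p * N) := by
  obtain ⟨g, rfl⟩ := Ideal.mem_span_range_iff_exists_fun.mp hy
  rw [map_sum]
  refine sum_mem fun i _ => ?_
  rw [D.leibniz, derivation_pow_char D p, smul_zero, zero_add, smul_eq_mul]
  exact Ideal.mul_mem_right _ _ (Ideal.subset_span ⟨i, rfl⟩)

/-- Cramer's rule modulo an ideal. -/
theorem det_mul_mem {A ι : Type*} [CommRing A] [Fintype ι] [DecidableEq ι] (Q : Ideal A)
    (M : Matrix ι ι A) (v : ι → A) (h : ∀ l, ∑ j, M l j * v j ∈ Q) (j : ι) : M.det * v j ∈ Q := by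
  have h1 : M.det * v j = ∑ l, M.adjugate j l * (M.mulVec v) l := by
    have := congrFun (congrArg (fun B => B.mulVec v) M.adjugate_mul) j
    simp only [← Matrix.mulVec_mulVec, Matrix.smul_mulVec, Matrix.one_mulVec, Pi.smul_apply,
      smul_eq_mul] at this
    exact this.symm
  rw [h1]
  exact sum_mem fun l _ => Q.mul_mem_left _ (h l)

theorem pow_mem_powIdeal {p : ℕ} [ExpChar F p] {N : ℕ} {s : MvPolynomial (Fin (n + 1)) F}
    (hs : s ∈ powIdeal F n N) : s ^ p ∈ powIdeal F n (p * N) := by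
  have : powIdeal F n N ≤
      (powIdeal F n (p * N)).comap (frobenius (MvPolynomial (Fin (n + 1)) F) p) := by
    rw [powIdeal, Ideal.span_le]
    rintro _ ⟨i, rfl⟩
    change frobenius _ p (X i ^ N) ∈ powIdeal F n (p * N)
    rw [frobenius_def, ← pow_mul, mul_comm]
    exact Ideal.subset_span ⟨i, rfl⟩
  exact this hs

/-- The Frobenius action on the top local cohomology of the polynomial ring is injective. -/
theorem mem_powIdeal_of_pow_mem {p : ℕ} [Fact p.Prime] [CharP F p] {N : ℕ}
    {s : MvPolynomial (Fin (n + 1)) F} (hs : s ^ p ∈ powIdeal F n (p * N)) :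
    s ∈ powIdeal F n N := by
  have hp := (Fact.out : p.Prime)
  rw [mem_powIdeal_iff] at hs ⊢
  intro m hm
  obtain ⟨i, hi⟩ := hs (p • m) (by
    rw [mem_support_iff, ← map_frobenius_expand p, coeff_map, coeff_expand_smul p hp.ne_zero,
      frobenius_def]
    exact pow_ne_zero _ (mem_support_iff.mp hm))
  exact ⟨i, Nat.le_of_mul_le_mul_left hi hp.pos⟩

/-- The pairing of `F[x_0, …, x_n]` with its top local cohomology is perfect: a homogeneous form
`v` lies in `(x_0 ^ Q, …, x_n ^ Q)` if it is multiplied into this ideal by all forms of the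
complementary degree. -/
theorem mem_powIdeal_of_mul_mem {Q r : ℕ} {v : MvPolynomial (Fin (n + 1)) F}
    (hv : v.IsHomogeneous r) (I : Ideal (MvPolynomial (Fin (n + 1)) F))
    (hI : ∀ M, r + M + (n + 1) = (n + 1) * Q →
      ∀ w : MvPolynomial (Fin (n + 1)) F, w.IsHomogeneous M → w ∈ I)
    (hIv : ∀ w ∈ I, w * v ∈ powIdeal F n Q) : v ∈ powIdeal F n Q := by
  rw [mem_powIdeal_iff]
  intro m hm
  by_contra! hlt
  set m' : Fin (n + 1) →₀ ℕ := Finsupp.equivFunOnFinite.symm fun i => Q - 1 - m i with hm'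
  have hmm' : ∀ i, (m' + m) i = Q - 1 := fun i => by
    have h1 : m' i = Q - 1 - m i := rfl
    have h2 := hlt i
    rw [Finsupp.add_apply, h1]
    omega
  have hr : ∑ i, m i = r := by
    rw [← hv (mem_support_iff.mp hm), Finsupp.weight_apply, Finsupp.sum_fintype _ _ (by simp)]
    simp
  have hsum : ∑ i, m' i + ∑ i, m i + (n + 1) = (n + 1) * Q := by
    have : ∀ i, m' i + m i + 1 = Q := fun i => by
      have h1 := hmm' i
      rw [Finsupp.add_apply] at h1
      have h2 := hlt i
      omega
    calc ∑ i, m' i + ∑ i, m i + (n + 1) = ∑ i, (m' i + m i + 1) := by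
          rw [Finset.sum_add_distrib, Finset.sum_add_distrib]; simp
      _ = (n + 1) * Q := by rw [Finset.sum_congr rfl fun i _ => this i]; simp
  have hw : monomial m' (1 : F) ∈ I := hI (∑ i, m' i) (by omega) _
    (isHomogeneous_monomial _ (by rw [Finsupp.degree_eq_sum]))
  obtain ⟨i, hi⟩ := mem_powIdeal_iff.mp (hIv _ hw) (m' + m) (by
    rw [mem_support_iff, coeff_monomial_mul, one_mul]
    exact mem_support_iff.mp hm)
  have h1 := hmm' i
  have h2 := hlt i
  omega

theorem prod_update_pow {A : Type*} [CommRing A] (f : Fin c → A) (k : Fin c → ℕ) (j : Fin c)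
    (a : ℕ) : ∏ l, f l ^ Function.update k j a l =
      f j ^ a * ∏ l ∈ Finset.univ.erase j, f l ^ k l := by
  rw [← Finset.mul_prod_erase _ _ (Finset.mem_univ j), Function.update_self]
  congr 1
  exact Finset.prod_congr rfl fun l hl => by
    rw [Function.update_of_ne (Finset.ne_of_mem_erase hl)]

/-- The heart of the argument. If `s` is killed by all `f_l` and `∏ f_l ^ k_l * s ^ p` vanishes in
the top local cohomology, where `k_l ≤ p - t`, then the relation can be differentiated: by Cramer's
rule the maximal minors of the Jacobian matrix kill `f ^ (k - e_j) * s ^ p`, and for degree reasons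
this element vanishes too. -/
theorem descend {p t : ℕ} [Fact p.Prime] [CharP F p] (ht : 0 < t) (htp : t ≤ p)
    {f : Fin c → MvPolynomial (Fin (n + 1)) F} {d : Fin c → ℕ}
    (hf : ∀ i, (f i).IsHomogeneous (d i)) {b : ℕ} (hb : ∀ i, b < t * d i)
    (hC : ∀ (a : Fin c → ℕ) (M : ℕ), ∑ i, a i * d i + b < M + (n + 1) →
      ∀ w : MvPolynomial (Fin (n + 1)) F, w.IsHomogeneous M →
        w ∈ Ideal.span (Set.range fun i => f i ^ a i) ⊔ minorIdeal f)
    {N m : ℕ} {s : MvPolynomial (Fin (n + 1)) F} (hs : s.IsHomogeneous m)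
    (hmd : m + ∑ i, d i = N * (n + 1)) (hfs : ∀ l, f l * s ∈ powIdeal F n N)
    (k : Fin c → ℕ) (hk : ∀ i, k i ≤ p - t)
    (h : (∏ l, f l ^ k l) * s ^ p ∈ powIdeal F n (p * N)) (j : Fin c) (hj : 0 < k j) :
    (∏ l, f l ^ Function.update k j (k j - 1) l) * s ^ p ∈ powIdeal F n (p * N) := by
  set Q := powIdeal F n (p * N) with hQ
  set v : Fin c → MvPolynomial (Fin (n + 1)) F := fun j =>
    k j * (f j ^ (k j - 1) * ∏ l ∈ Finset.univ.erase j, f l ^ k l) * s ^ p with hv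
  have hrel : ∀ i, ∑ j, pderiv i (f j) * v j ∈ Q := by
    intro i
    have h1 := derivation_mem_powIdeal p (pderiv i) h
    have h2 : pderiv i (s ^ p) = 0 := by
      have := derivation_pow_char (pderiv (R := F) i) p s 1
      rwa [mul_one] at this
    rw [Derivation.leibniz, h2, smul_zero, zero_add, derivation_prod_pow, smul_eq_mul,
      Finset.mul_sum] at h1
    refine (congrArg (· ∈ Q) (Finset.sum_congr rfl fun j _ => ?_)).mpr h1
    rw [hv]
    ring
  set w := (∏ l, f l ^ Function.update k j (k j - 1) l) * s ^ p with hw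
  have hwv : v j = (k j : MvPolynomial (Fin (n + 1)) F) * w := by
    rw [hw, prod_update_pow, hv]
    ring
  have hkj : (k j : F) ≠ 0 := by
    rw [Ne, CharP.cast_eq_zero_iff F p]
    exact fun hdvd => absurd (Nat.le_of_dvd hj hdvd) (by have := hk j; omega)
  have hminor : ∀ g ∈ minorIdeal f, g * w ∈ Q := by
    intro g hg
    refine Submodule.span_induction (p := fun g _ => g * w ∈ Q) ?_ ?_ ?_ ?_ hg
    · rintro _ ⟨σ, rfl⟩
      have h1 := det_mul_mem Q (Matrix.of fun l j => pderiv (σ l) (f j)) v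
        (fun l => hrel (σ l)) j
      rw [hwv] at h1
      have h2 := Q.mul_mem_left (C (k j : F)⁻¹) h1
      have h3 : (C (k j : F)⁻¹ : MvPolynomial (Fin (n + 1)) F) * (k j : MvPolynomial _ F) = 1 := by
        rw [← map_natCast (C : F →+* MvPolynomial (Fin (n + 1)) F), ← C_mul, inv_mul_cancel₀ hkj,
          C_1]
      convert h2 using 1
      linear_combination -(Matrix.of fun l j => pderiv (σ l) (f j)).det * w * h3
    · rw [zero_mul]; exact zero_mem _
    · intro a b _ _ ha hb
      rw [add_mul]; exact add_mem ha hb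
    · intro a b _ hb
      rw [smul_eq_mul, mul_assoc]; exact Q.mul_mem_left _ hb
  -- `f_j w` is the given element of `Q`, and `f_l ^ (p - k_l) w` is a multiple of `(f_l s) ^ p`
  set a : Fin c → ℕ := Function.update (fun l => p - k l) j 1 with ha
  have hfw : ∀ l, f l ^ a l * w ∈ Q := by
    intro l
    by_cases hl : l = j
    · subst hl
      have : f l ^ a l * w = (∏ l, f l ^ k l) * s ^ p := by
        rw [hw, prod_update_pow, ha, Function.update_self,
          ← Finset.mul_prod_erase _ (fun l => f l ^ k l) (Finset.mem_univ l)]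
        obtain ⟨q, hq⟩ := Nat.exists_eq_add_of_lt hj
        rw [hq]
        simp only [zero_add, Nat.add_sub_cancel]
        ring
      rw [this]
      exact h
    · have h1 : f l ^ a l * w = (∏ i ∈ Finset.univ.erase l,
          f i ^ Function.update k j (k j - 1) i) * (f l * s) ^ p := by
        rw [hw, ← Finset.mul_prod_erase _ _ (Finset.mem_univ l), ha, Function.update_of_ne hl,
          Function.update_of_ne hl, mul_pow]
        have : f l ^ p = f l ^ (p - k l) * f l ^ k l := by
          rw [← pow_add, Nat.sub_add_cancel (by have := hk l; omega)]
        rw [this]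
        ring
      rw [h1]
      exact Q.mul_mem_left _ (pow_mem_powIdeal (hfs l))
  have hwdeg : w.IsHomogeneous (∑ l, d l * Function.update k j (k j - 1) l + m * p) :=
    (IsHomogeneous.prod _ _ _ fun l _ => (hf l).pow _).mul (hs.pow p)
  refine mem_powIdeal_of_mul_mem hwdeg _ (fun M hM => hC a M ?_) ?_
  · -- the degrees of `f ^ a` and of `w` add up to `(n + 1) p N`, up to `(p - k_j) d_j ≥ t d_j`
    have hbj : b < (p - k j) * d j :=
      (hb j).trans_le (Nat.mul_le_mul_right _ (by have := hk j; omega))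
    have hsum : ∑ l, a l * d l + (p - k j) * d j + ∑ l, d l * Function.update k j (k j - 1) l =
        p * ∑ l, d l := by
      rw [← Finset.add_sum_erase _ (fun l => a l * d l) (Finset.mem_univ j),
        ← Finset.add_sum_erase _ (fun l => d l * Function.update k j (k j - 1) l)
          (Finset.mem_univ j), ← Finset.add_sum_erase _ d (Finset.mem_univ j), mul_add]
      have h1 : ∑ l ∈ Finset.univ.erase j, a l * d l +
          ∑ l ∈ Finset.univ.erase j, d l * Function.update k j (k j - 1) l =
          p * ∑ l ∈ Finset.univ.erase j, d l := by
        rw [← Finset.sum_add_distrib, Finset.mul_sum]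
        refine Finset.sum_congr rfl fun l hl => ?_
        rw [ha, Function.update_of_ne (Finset.ne_of_mem_erase hl),
          Function.update_of_ne (Finset.ne_of_mem_erase hl), mul_comm (d l), ← add_mul,
          Nat.sub_add_cancel (by have := hk l; omega)]
      have h2 : a j * d j + (p - k j) * d j + d j * Function.update k j (k j - 1) j =
          p * d j := by
        rw [ha, Function.update_self, Function.update_self, mul_comm (d j), ← add_mul, ← add_mul]
        congr 1
        have := hk j
        omega
      linarith
    have hmul : p * m + p * ∑ l, d l = p * (N * (n + 1)) := by rw [← mul_add, hmd]
    have hcomm : (n + 1) * (p * N) = p * (N * (n + 1)) := by ring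
    have hcomm' : m * p = p * m := mul_comm _ _
    omega
  · intro g hg
    obtain ⟨g₁, hg₁, g₂, hg₂, rfl⟩ := Submodule.mem_sup.mp hg
    rw [add_mul]
    refine add_mem ?_ (hminor g₂ hg₂)
    obtain ⟨y, rfl⟩ := Ideal.mem_span_range_iff_exists_fun.mp hg₁
    rw [Finset.sum_mul]
    refine sum_mem fun l _ => ?_
    rw [mul_assoc]
    exact Q.mul_mem_left _ (hfw l)

/-- Repeated differentiation of the relation `(∏ f_l) ^ (p - t) * s ^ p = 0` in the top local
cohomology leads to `s ^ p = 0`, and the Frobenius action there is injective. -/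
theorem mem_powIdeal_of_prod_mul_pow_mem {p t : ℕ} [Fact p.Prime] [CharP F p]
    (htp : t ≤ p)
    {f : Fin c → MvPolynomial (Fin (n + 1)) F} {d : Fin c → ℕ}
    (hf : ∀ i, (f i).IsHomogeneous (d i)) {b : ℕ} (hb : ∀ i, b < t * d i)
    (hC : ∀ (a : Fin c → ℕ) (M : ℕ), ∑ i, a i * d i + b < M + (n + 1) →
      ∀ w : MvPolynomial (Fin (n + 1)) F, w.IsHomogeneous M →
        w ∈ Ideal.span (Set.range fun i => f i ^ a i) ⊔ minorIdeal f)
    {N m : ℕ} {s : MvPolynomial (Fin (n + 1)) F} (hs : s.IsHomogeneous m)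
    (hmd : m + ∑ i, d i = N * (n + 1)) (hfs : ∀ l, f l * s ∈ powIdeal F n N)
    (h : (∏ l, f l) ^ (p - t) * s ^ p ∈ powIdeal F n (p * N)) : s ∈ powIdeal F n N := by
  refine mem_powIdeal_of_pow_mem (p := p) ?_
  have key : ∀ (K : ℕ) (k : Fin c → ℕ), ∑ i, k i = K → (∀ i, k i ≤ p - t) →
      (∏ l, f l ^ k l) * s ^ p ∈ powIdeal F n (p * N) → s ^ p ∈ powIdeal F n (p * N) := by
    intro K
    induction K with
    | zero =>
      intro k hk0 _ h
      have : ∀ i, k i = 0 := fun i => Finset.sum_eq_zero_iff.mp hk0 i (Finset.mem_univ i)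
      simpa [this] using h
    | succ K ih =>
      intro k hkK hk h
      obtain ⟨j, hj⟩ : ∃ j, 0 < k j := by
        by_contra! h0
        rw [Finset.sum_eq_zero fun i _ => Nat.le_zero.mp (h0 i)] at hkK
        omega
      have ht : 0 < t := Nat.pos_of_ne_zero fun h0 => by
        have := hb j
        rw [h0, zero_mul] at this
        omega
      refine ih (Function.update k j (k j - 1)) ?_ ?_
        (descend ht htp hf hb hC hs hmd hfs k hk h j hj)
      · have hsc : ∑ l ∈ Finset.univ.erase j, Function.update k j (k j - 1) l =
            ∑ l ∈ Finset.univ.erase j, k l :=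
          Finset.sum_congr rfl fun l hl => Function.update_of_ne (Finset.ne_of_mem_erase hl) _ _
        rw [← Finset.add_sum_erase _ _ (Finset.mem_univ j)] at hkK ⊢
        rw [Function.update_self, hsc]
        omega
      · intro i
        by_cases hi : i = j
        · subst hi
          rw [Function.update_self]
          exact (Nat.sub_le _ _).trans (hk i)
        · rw [Function.update_of_ne hi]
          exact hk i
  refine key _ (fun _ => p - t) rfl (fun _ => le_rfl) ?_
  rwa [Finset.prod_pow]

end Differentiation

/-! ### Hilbert series of complete intersections -/

section Hilbert

open MvPolynomial

attribute [local instance] MvPolynomial.gradedAlgebra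

variable {K : Type u} [Field K] {n : ℕ}

theorem quotientGrading_finite (J : Ideal (MvPolynomial (Fin (n + 1)) K)) (m : ℕ) :
    Module.Finite K (quotientGrading (homogeneousSubmodule (Fin (n + 1)) K) J m) :=
  Module.Finite.iff_fg.mpr ((homogeneousSubmodule_fg _ K m).map _)

/-- The Hilbert series of the quotient by `J` of the polynomial ring. -/
noncomputable def hilbertSeries (J : Ideal (MvPolynomial (Fin (n + 1)) K)) : PowerSeries ℤ :=
  PowerSeries.mk fun m =>
    (Module.finrank K (quotientGrading (homogeneousSubmodule (Fin (n + 1)) K) J m) : ℤ)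

theorem quotientGrading_map_factor {J J' : Ideal (MvPolynomial (Fin (n + 1)) K)} (h : J ≤ J')
    (m : ℕ) : (quotientGrading (homogeneousSubmodule (Fin (n + 1)) K) J m).map
      (Ideal.Quotient.factorₐ K h).toLinearMap =
        quotientGrading (homogeneousSubmodule (Fin (n + 1)) K) J' m := by
  rw [quotientGrading, ← Submodule.map_comp]
  rfl

/-- Multiplication by `g` on the quotient by `J`. -/
noncomputable def mulMk (J : Ideal (MvPolynomial (Fin (n + 1)) K))
    (g : MvPolynomial (Fin (n + 1)) K) :
    (MvPolynomial (Fin (n + 1)) K ⧸ J) →ₗ[K] (MvPolynomial (Fin (n + 1)) K ⧸ J) :=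
  LinearMap.mulLeft K (Ideal.Quotient.mk J g)

theorem mulMk_injective {J : Ideal (MvPolynomial (Fin (n + 1)) K)}
    {g : MvPolynomial (Fin (n + 1)) K} (hg : NzdMod J g) : Function.Injective (mulMk J g) := by
  rw [injective_iff_map_eq_zero]
  intro a ha
  obtain ⟨a, rfl⟩ := Ideal.Quotient.mk_surjective a
  refine Ideal.Quotient.eq_zero_iff_mem.mpr (hg a (Ideal.Quotient.eq_zero_iff_mem.mp ?_))
  rw [map_mul]
  exact ha

theorem finrank_quotientGrading_sup {J : Ideal (MvPolynomial (Fin (n + 1)) K)}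
    (hJ : J.IsHomogeneous (homogeneousSubmodule (Fin (n + 1)) K))
    {g : MvPolynomial (Fin (n + 1)) K} {e : ℕ} (hge : g.IsHomogeneous e) (hg : NzdMod J g) (m : ℕ) :
    Module.finrank K (quotientGrading (homogeneousSubmodule (Fin (n + 1)) K) J m) =
      Module.finrank K (quotientGrading (homogeneousSubmodule (Fin (n + 1)) K)
        (J ⊔ Ideal.span {g}) m) +
      if e ≤ m then
        Module.finrank K (quotientGrading (homogeneousSubmodule (Fin (n + 1)) K) J (m - e))
      else 0 := by
  set V := fun (J : Ideal (MvPolynomial (Fin (n + 1)) K)) m =>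
    quotientGrading (homogeneousSubmodule (Fin (n + 1)) K) J m with hV
  have hle : J ≤ J ⊔ Ideal.span {g} := le_sup_left
  have := quotientGrading_finite J m
  set φ := (Ideal.Quotient.factorₐ K hle).toLinearMap.domRestrict (V J m) with hφ
  have hrange : φ.range = V (J ⊔ Ideal.span {g}) m := by
    rw [hφ, LinearMap.range_domRestrict]
    exact quotientGrading_map_factor hle m
  have hker : ∀ (h : MvPolynomial (Fin (n + 1)) K) (hm : h.IsHomogeneous m),
      h ∈ J ⊔ Ideal.span {g} → ∃ h' ∈ intPiece (homogeneousSubmodule (Fin (n + 1)) K) (m - e),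
        h - g * h' ∈ J := fun h hm hh =>
    exists_mul_of_mem_sup (homogeneousSubmodule (Fin (n + 1)) K) hJ hge (m := m) hm hh
  have hfac : ∀ h : MvPolynomial (Fin (n + 1)) K,
      Ideal.Quotient.factorₐ K hle (Ideal.Quotient.mk J h) = 0 ↔ h ∈ J ⊔ Ideal.span {g} :=
    fun h => Ideal.Quotient.eq_zero_iff_mem
  rw [← LinearMap.finrank_range_add_finrank_ker φ, hrange]
  congr 1
  split_ifs with hem
  · have hcast : ((m : ℤ) - e) = ((m - e : ℕ) : ℤ) := (Nat.cast_sub hem).symm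
    have hle' : (V J (m - e)).map (mulMk J g) ≤ V J m := by
      rintro _ ⟨_, ⟨a, ha, rfl⟩, rfl⟩
      refine ⟨g * a, ?_, map_mul (Ideal.Quotient.mk J) g a⟩
      have := hge.mul (show a.IsHomogeneous (m - e) from ha)
      rwa [Nat.add_sub_cancel' hem] at this
    have hker' : φ.ker = ((V J (m - e)).map (mulMk J g)).comap (V J m).subtype := by
      ext ⟨z, h, hh, rfl⟩
      rw [LinearMap.mem_ker, Submodule.mem_comap]
      constructor
      · intro h0
        obtain ⟨h', hh', hsub⟩ := hker h hh ((hfac h).mp h0)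
        rw [hcast] at hh'
        exact ⟨_, ⟨h', hh', rfl⟩, ((Ideal.Quotient.eq.mpr hsub).trans (map_mul _ _ _)).symm⟩
      · rintro ⟨_, ⟨a, ha, rfl⟩, h1⟩
        refine (hfac h).mpr ?_
        have h2 : Ideal.Quotient.mk J (g * a) = Ideal.Quotient.mk J h := h1
        rw [← sub_sub_cancel (g * a) h]
        exact sub_mem (Ideal.mul_mem_right _ _ (Ideal.mem_sup_right
          (Ideal.mem_span_singleton_self g))) (Ideal.mem_sup_left (Ideal.Quotient.eq.mp h2))
    rw [hker', (Submodule.comapSubtypeEquivOfLe hle').finrank_eq]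
    exact (Submodule.equivMapOfInjective _ (mulMk_injective hg) _).finrank_eq.symm
  · have hker' : φ.ker = ⊥ := by
      rw [eq_bot_iff]
      rintro ⟨z, h, hh, rfl⟩ h0
      obtain ⟨h', hh', hsub⟩ := hker h hh ((hfac h).mp (LinearMap.mem_ker.mp h0))
      obtain ⟨q, hq⟩ : ∃ q, (m : ℤ) - e = Int.negSucc q :=
        Int.eq_negSucc_of_lt_zero (by omega)
      rw [hq] at hh'
      obtain rfl : h' = 0 := hh'
      rw [mul_zero, sub_zero] at hsub
      exact Subtype.ext (Ideal.Quotient.eq_zero_iff_mem.mpr hsub)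
    rw [hker', finrank_bot]

theorem hilbertSeries_sup {J : Ideal (MvPolynomial (Fin (n + 1)) K)}
    (hJ : J.IsHomogeneous (homogeneousSubmodule (Fin (n + 1)) K))
    {g : MvPolynomial (Fin (n + 1)) K} {e : ℕ} (hge : g.IsHomogeneous e) (hg : NzdMod J g) :
    hilbertSeries (J ⊔ Ideal.span {g}) = (1 - PowerSeries.X ^ e) * hilbertSeries J := by
  ext m
  rw [sub_mul, one_mul, map_sub, PowerSeries.coeff_X_pow_mul', hilbertSeries, hilbertSeries,
    PowerSeries.coeff_mk, PowerSeries.coeff_mk, finrank_quotientGrading_sup hJ hge hg m]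
  split_ifs
  · rw [PowerSeries.coeff_mk]
    push_cast
    ring
  · simp

theorem isHomogeneous_span_X_image (s : Set (Fin (n + 1))) :
    (Ideal.span ((X : Fin (n + 1) → MvPolynomial (Fin (n + 1)) K) '' s)).IsHomogeneous
      (homogeneousSubmodule (Fin (n + 1)) K) := by
  refine Ideal.homogeneous_span _ _ ?_
  rintro _ ⟨i, -, rfl⟩
  exact ⟨1, isHomogeneous_X K i⟩

theorem hilbertSeries_span_range_X :
    hilbertSeries
      (Ideal.span (Set.range (X : Fin (n + 1) → MvPolynomial (Fin (n + 1)) K))) = 1 := by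
  set J := Ideal.span (Set.range (X : Fin (n + 1) → MvPolynomial (Fin (n + 1)) K)) with hJ
  have hmem : ∀ h : MvPolynomial (Fin (n + 1)) K, h ∈ J ↔ coeff 0 h = 0 := by
    intro h
    rw [hJ, ← Set.image_univ, mem_ideal_span_X_image]
    constructor
    · intro hh
      by_contra h0
      obtain ⟨i, -, hi⟩ := hh 0 (mem_support_iff.mpr h0)
      exact hi rfl
    · intro h0 m hm
      by_contra! hm0
      obtain rfl : m = 0 := Finsupp.ext fun i => hm0 i trivial
      exact mem_support_iff.mp hm h0
  ext m
  rw [hilbertSeries, PowerSeries.coeff_mk, PowerSeries.coeff_one]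
  split_ifs with hm
  · subst hm
    have h1 : quotientGrading (homogeneousSubmodule (Fin (n + 1)) K) J 0 =
        Submodule.span K {(1 : MvPolynomial (Fin (n + 1)) K ⧸ J)} := by
      rw [quotientGrading, homogeneousSubmodule_zero, Submodule.one_eq_span, Submodule.map_span,
        Set.image_singleton]
      rfl
    have h2 : (1 : MvPolynomial (Fin (n + 1)) K ⧸ J) ≠ 0 := by
      rw [← map_one (Ideal.Quotient.mk J), Ne, Ideal.Quotient.eq_zero_iff_mem, hmem]
      simp
    rw [h1, finrank_span_singleton h2, Nat.cast_one]
  · have h1 : quotientGrading (homogeneousSubmodule (Fin (n + 1)) K) J m = ⊥ := by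
      rw [eq_bot_iff]
      rintro _ ⟨h, hh, rfl⟩
      refine Ideal.Quotient.eq_zero_iff_mem.mpr ((hmem h).mpr ?_)
      exact IsHomogeneous.coeff_eq_zero hh (by simpa using Ne.symm hm)
    rw [h1, finrank_bot, Nat.cast_zero]

/-- `∏_e (1 - T ^ e) / (1 - T) ^ (n + 1)`, where `e` runs over the multiset `E`, is the Hilbert
series of the quotient by `J`. -/
def HasDegrees (J : Ideal (MvPolynomial (Fin (n + 1)) K)) (E : Multiset ℕ) : Prop :=
  (1 - PowerSeries.X) ^ (n + 1) * hilbertSeries J =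
    (E.map fun e => 1 - (PowerSeries.X : PowerSeries ℤ) ^ e).prod

theorem HasDegrees.sup {J : Ideal (MvPolynomial (Fin (n + 1)) K)} {E : Multiset ℕ}
    (h : HasDegrees J E) (hJ : J.IsHomogeneous (homogeneousSubmodule (Fin (n + 1)) K))
    {g : MvPolynomial (Fin (n + 1)) K} {e : ℕ} (hge : g.IsHomogeneous e) (hg : NzdMod J g) :
    HasDegrees (J ⊔ Ideal.span {g}) (e ::ₘ E) := by
  rw [HasDegrees, hilbertSeries_sup hJ hge hg, Multiset.map_cons, Multiset.prod_cons, ← h]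
  ring

/-- The Hilbert series of the polynomial ring, which is found by dividing out the variables. -/
theorem hasDegrees_bot : HasDegrees (⊥ : Ideal (MvPolynomial (Fin (n + 1)) K)) 0 := by
  have key : ∀ i : ℕ, i ≤ n + 1 →
      hilbertSeries (Ideal.span ((X : Fin (n + 1) → MvPolynomial (Fin (n + 1)) K) ''
        {j | j.1 < i})) = (1 - PowerSeries.X) ^ i *
          hilbertSeries (⊥ : Ideal (MvPolynomial (Fin (n + 1)) K)) := by
    intro i
    induction i with
    | zero => simp
    | succ i ih =>
      intro hi
      rw [← span_image_lt_succ X ⟨i, hi⟩, hilbertSeries_sup (isHomogeneous_span_X_image _)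
        (isHomogeneous_X K _) (nzdMod_X_span fun h => lt_irrefl i h), ih (by omega)]
      ring
  have h1 := key (n + 1) le_rfl
  have h2 : {j : Fin (n + 1) | j.1 < n + 1} = Set.univ := Set.eq_univ_of_forall fun j => j.2
  rw [h2, Set.image_univ, hilbertSeries_span_range_X] at h1
  rw [HasDegrees, ← h1, Multiset.map_zero, Multiset.prod_zero]

/-- An artinian complete intersection vanishes in degrees greater than `∑ (e - 1)`. -/
theorem HasDegrees.mem_of_isHomogeneous {J : Ideal (MvPolynomial (Fin (n + 1)) K)}
    {E : Multiset ℕ} (h : HasDegrees J E) (hE : E.card = n + 1) {M : ℕ}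
    (hM : E.sum < M + (n + 1)) {w : MvPolynomial (Fin (n + 1)) K} (hw : w.IsHomogeneous M) :
    w ∈ J := by
  have h1 : hilbertSeries J =
      (((E.map fun e => ∑ i ∈ Finset.range e, (Polynomial.X : Polynomial ℤ) ^ i).prod :
        Polynomial ℤ) : PowerSeries ℤ) := by
    have h2 : ∀ e : ℕ, (1 - (PowerSeries.X : PowerSeries ℤ) ^ e) = (1 - PowerSeries.X) *
        ((∑ i ∈ Finset.range e, (Polynomial.X : Polynomial ℤ) ^ i : Polynomial ℤ) :
          PowerSeries ℤ) := by
      intro e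
      rw [← mul_neg_geom_sum (PowerSeries.X : PowerSeries ℤ) e]
      congr 1
      rw [← Polynomial.coeToPowerSeries.ringHom_apply, map_sum]
      simp
    have h3 : (1 - PowerSeries.X : PowerSeries ℤ) ^ (n + 1) ≠ 0 := by
      refine pow_ne_zero _ fun h0 => ?_
      have := congrArg (PowerSeries.coeff (R := ℤ) 0) h0
      simp at this
    refine mul_left_cancel₀ h3 (h.trans ?_)
    rw [Multiset.map_congr rfl fun e _ => h2 e, Multiset.prod_map_mul, Multiset.map_const',
      Multiset.prod_replicate, hE, ← Polynomial.coeToPowerSeries.ringHom_apply,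
      map_multiset_prod, Multiset.map_map]
    rfl
  have h2 : ∀ E : Multiset ℕ,
      (E.map fun e => ∑ i ∈ Finset.range e, (Polynomial.X : Polynomial ℤ) ^ i).prod = 0 ∨
      (E.map fun e => ∑ i ∈ Finset.range e, (Polynomial.X : Polynomial ℤ) ^ i).prod.natDegree +
        E.card ≤ E.sum := by
    intro E
    induction E using Multiset.induction_on with
    | empty => simp
    | cons e E ih =>
      rw [Multiset.map_cons, Multiset.prod_cons, Multiset.card_cons, Multiset.sum_cons]
      rcases ih with ih | ih
      · left
        rw [ih, mul_zero]
      · cases e with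
        | zero => left; simp
        | succ e =>
          right
          have h4 : (∑ i ∈ Finset.range (e + 1), (Polynomial.X : Polynomial ℤ) ^ i).natDegree
              ≤ e := Polynomial.natDegree_sum_le_of_forall_le _ _ fun i hi => by
            rw [Polynomial.natDegree_X_pow]
            exact Nat.lt_succ_iff.mp (Finset.mem_range.mp hi)
          have := Polynomial.natDegree_mul_le_of_le h4 le_rfl (q := (E.map fun e =>
            ∑ i ∈ Finset.range e, (Polynomial.X : Polynomial ℤ) ^ i).prod)
          omega
  have h3 : PowerSeries.coeff M (hilbertSeries J) = 0 := by
    rw [h1, Polynomial.coeff_coe]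
    rcases h2 E with h0 | h0
    · rw [h0, Polynomial.coeff_zero]
    · exact Polynomial.coeff_eq_zero_of_natDegree_lt (by omega)
  have := quotientGrading_finite J M
  rw [hilbertSeries, PowerSeries.coeff_mk, Nat.cast_eq_zero, Submodule.finrank_eq_zero] at h3
  have h4 : Ideal.Quotient.mk J w ∈
      quotientGrading (homogeneousSubmodule (Fin (n + 1)) K) J M := ⟨w, hw, rfl⟩
  rw [h3] at h4
  exact Ideal.Quotient.eq_zero_iff_mem.mp h4

end Hilbert

/-! ### Forms of large degree lie in the Jacobian ideal -/

section Generic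

open MvPolynomial

attribute [local instance] MvPolynomial.gradedAlgebra

variable {K : Type u} [Field K] {n c : ℕ}

/-- If `H^0` of the quotient by `J` vanishes, then no nonzero element is killed by powers of
all variables. -/
theorem Vanishes.mem_of_pow_mul_mem {J : Ideal (MvPolynomial (Fin (n + 1)) K)}
    (h : Vanishes X J 0) {L : ℕ} {a : MvPolynomial (Fin (n + 1)) K}
    (ha : ∀ i, X i ^ L * a ∈ J) : a ∈ J := by
  have h1 := h (fun T => algebraMap _ _ a) (fun T => by
    rw [cechD_apply]
    refine sum_mem fun i _ => ?_
    rw [Algebra.smul_def]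
    refine Ideal.mul_mem_left _ _ ?_
    rw [AlgHom.commutes, Loc.algebraMap_mem_map_iff]
    obtain ⟨j, hj⟩ := Finset.card_eq_one.mp T.2
    refine ⟨L, ?_⟩
    rw [hj, Finset.prod_singleton]
    exact ha j)
  obtain ⟨ρ, hρ, σ, hσ, hs⟩ := Submodule.mem_sup.mp h1
  obtain rfl : ρ = 0 := hρ
  rw [zero_add] at hs
  have h2 := hσ ⟨∅, rfl⟩
  rw [hs, Loc.algebraMap_mem_map_iff] at h2
  obtain ⟨e, he⟩ := h2
  rwa [Finset.prod_empty, one_pow, one_mul] at he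

/-- Over an infinite field, a space of forms that generates an ideal containing powers of the
variables modulo `J` contains a nonzerodivisor modulo `J`, unless `H^0` does not vanish: it is not
a union of its intersections with the finitely many associated primes. -/
theorem exists_nzdMod [Infinite K] {J : Ideal (MvPolynomial (Fin (n + 1)) K)}
    (h : Vanishes X J 0) (V : Submodule K (MvPolynomial (Fin (n + 1)) K)) {L : ℕ}
    (hV : ∀ i, X i ^ L ∈ J ⊔ Ideal.span (V : Set (MvPolynomial (Fin (n + 1)) K))) :
    ∃ g ∈ V, NzdMod J g := by
  set S := MvPolynomial (Fin (n + 1)) K with hS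
  by_contra! hno
  have hfin := associatedPrimes.finite S (S ⧸ J)
  have := hfin.to_subtype
  have hcover : ⋃ P : associatedPrimes S (S ⧸ J),
      (((P.1.restrictScalars K).comap V.subtype : Submodule K V) : Set V) = Set.univ := by
    refine Set.eq_univ_of_forall fun g => ?_
    have h1 := hno g.1 g.2
    rw [NzdMod] at h1
    push Not at h1
    obtain ⟨a, ha, haJ⟩ := h1
    have h2 : g.1 ∈ ⋃ P ∈ associatedPrimes S (S ⧸ J), (P : Set S) := by
      rw [biUnion_associatedPrimes_eq_zero_divisors]
      refine ⟨Ideal.Quotient.mk J a, fun h0 => haJ (Ideal.Quotient.eq_zero_iff_mem.mp h0), ?_⟩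
      exact Ideal.Quotient.eq_zero_iff_mem.mpr ha
    rw [Set.mem_iUnion₂] at h2
    obtain ⟨P, hP, hgP⟩ := h2
    exact Set.mem_iUnion.mpr ⟨⟨P, hP⟩, hgP⟩
  obtain ⟨⟨P, hP⟩, hPV⟩ := Subspace.exists_eq_top_of_iUnion_eq_univ hcover
  have hVP : ∀ g ∈ V, g ∈ P := by
    intro g hg
    have : (⟨g, hg⟩ : V) ∈ (P.restrictScalars K).comap V.subtype := by
      rw [hPV]
      trivial
    exact this
  rw [AssociatedPrimes.mem_iff, isAssociatedPrime_iff] at hP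
  obtain ⟨hprime, y, rfl⟩ := hP
  obtain ⟨a, rfl⟩ := Ideal.Quotient.mk_surjective y
  have hmem : ∀ g : S, g ∈ (⊥ : Submodule S (S ⧸ J)).colon {Ideal.Quotient.mk J a} ↔ g * a ∈ J := by
    intro g
    rw [Submodule.mem_colon_singleton, Submodule.mem_bot]
    exact Ideal.Quotient.eq_zero_iff_mem
  refine hprime.ne_top ((Ideal.eq_top_iff_one _).mpr ((hmem 1).mpr ?_))
  rw [one_mul]
  refine h.mem_of_pow_mul_mem (L := L) fun i => (hmem _).mp ?_
  have hle : J ⊔ Ideal.span (V : Set S) ≤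
      (⊥ : Submodule S (S ⧸ J)).colon {Ideal.Quotient.mk J a} := by
    refine sup_le (fun g hg => (hmem g).mpr (J.mul_mem_right _ hg)) (Ideal.span_le.mpr hVP)
  exact hle (hV i)

/-- Let `J` be a complete intersection of dimension `r` with degrees `E`, and let `V` be a space of
forms of degree `e` that cuts out the empty set on it. Then `V` contains a regular sequence of
length `r`, so that `J + (V)` contains all forms of degree greater than
`∑ (E_i - 1) + r (e - 1)`. -/
theorem mem_sup_span_of_infinite [Infinite K] (r : ℕ) {J : Ideal (MvPolynomial (Fin (n + 1)) K)}
    (hJ : J.IsHomogeneous (homogeneousSubmodule (Fin (n + 1)) K))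
    (hv : ∀ k < r, Vanishes X J k) {E : Multiset ℕ} (hE : HasDegrees J E)
    (hcard : E.card + r = n + 1) (V : Submodule K (MvPolynomial (Fin (n + 1)) K)) {e : ℕ}
    (hVe : V ≤ homogeneousSubmodule (Fin (n + 1)) K e) {L : ℕ}
    (hV : ∀ i, X i ^ L ∈ J ⊔ Ideal.span (V : Set (MvPolynomial (Fin (n + 1)) K)))
    {M : ℕ} (hM : E.sum + r * e < M + (n + 1)) {w : MvPolynomial (Fin (n + 1)) K}
    (hw : w.IsHomogeneous M) : w ∈ J ⊔ Ideal.span (V : Set (MvPolynomial (Fin (n + 1)) K)) := by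
  induction r generalizing J E with
  | zero => exact Ideal.mem_sup_left (hE.mem_of_isHomogeneous hcard (by omega) hw)
  | succ r ih =>
    obtain ⟨g, hgV, hg⟩ := exists_nzdMod (hv 0 (Nat.succ_pos r)) V hV
    have hge : g.IsHomogeneous e := hVe hgV
    have hsup : J ⊔ Ideal.span {g} ⊔ Ideal.span (V : Set (MvPolynomial (Fin (n + 1)) K)) =
        J ⊔ Ideal.span (V : Set (MvPolynomial (Fin (n + 1)) K)) := by
      rw [sup_assoc]
      congr 1
      exact sup_eq_right.mpr (Ideal.span_mono (Set.singleton_subset_iff.mpr hgV))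
    rw [← hsup] at hV ⊢
    refine ih (hJ.sup (Ideal.homogeneous_span _ _ ?_))
      (fun k hk => (hv k (by omega)).sup hg (hv (k + 1) (by omega))) (hE.sup hJ hge hg) ?_ hV ?_
    · rintro _ rfl
      exact ⟨e, hge⟩
    · rw [Multiset.card_cons]
      omega
    · rw [Multiset.sum_cons]
      have : (r + 1) * e = r * e + e := by ring
      omega

theorem hasDegrees_span {f : Fin c → MvPolynomial (Fin (n + 1)) K} {d : Fin c → ℕ}
    (hf : ∀ i, (f i).IsHomogeneous (d i)) (hreg : RegSeq ⊥ (List.ofFn f)) (i : ℕ) (hi : i ≤ c) :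
    ∃ E : Multiset ℕ, E.card = i ∧ E.sum = ∑ l with l.1 < i, d l ∧
      HasDegrees (Ideal.span (f '' {j | j.1 < i})) E := by
  induction i with
  | zero =>
    refine ⟨0, rfl, ?_, ?_⟩
    · simp
    · simpa using hasDegrees_bot
  | succ i ih =>
    obtain ⟨E, hcard, hsum, hE⟩ := ih (by omega)
    refine ⟨d ⟨i, hi⟩ ::ₘ E, by rw [Multiset.card_cons, hcard], ?_, ?_⟩
    · have hins : (Finset.univ.filter fun l : Fin c => l.1 < i + 1) =
          insert ⟨i, hi⟩ (Finset.univ.filter fun l : Fin c => l.1 < i) := by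
        ext l
        simp only [Finset.mem_filter, Finset.mem_univ, true_and, Finset.mem_insert, Fin.ext_iff]
        omega
      rw [Multiset.sum_cons, hsum, hins, Finset.sum_insert (by simp)]
    · rw [← span_image_lt_succ f ⟨i, hi⟩]
      exact hE.sup (span_image_isHomogeneous hf _) (hf _) (hreg.nzdMod ⟨i, hi⟩)

/-- A regular sequence of forms of positive degree has at most `n + 1` elements, since `n + 1` of
them already generate an ideal containing all forms of large degree. -/
theorem RegSeq.le_succ {f : Fin c → MvPolynomial (Fin (n + 1)) K} {d : Fin c → ℕ}
    (hf : ∀ i, (f i).IsHomogeneous (d i)) (hd : ∀ i, 0 < d i) (hreg : RegSeq ⊥ (List.ofFn f))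
    (htop : genIdeal f ≠ ⊤) : c ≤ n + 1 := by
  by_contra! hc
  obtain ⟨E, hcard, -, hE⟩ := hasDegrees_span hf hreg (n + 1) hc.le
  have h1 : f ⟨n + 1, hc⟩ ^ (E.sum + 1) ∈ Ideal.span (f '' {j | j.1 < n + 1}) := by
    refine hE.mem_of_isHomogeneous hcard ?_ ((hf ⟨n + 1, hc⟩).pow _)
    have := Nat.le_mul_of_pos_left (E.sum + 1) (hd ⟨n + 1, hc⟩)
    omega
  have h2 := (hreg.nzdMod ⟨n + 1, hc⟩).pow (E.sum + 1) 1 (by rwa [mul_one])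
  refine htop ((Ideal.eq_top_iff_one _).mpr (Ideal.span_mono ?_ h2))
  exact Set.image_subset_range _ _

end Generic

/-! ### Extension of the base field -/

section BaseChange

open MvPolynomial

attribute [local instance] MvPolynomial.gradedAlgebra MvPolynomial.algebraMvPolynomial

theorem faithfullyFlat_mvPolynomial (F K : Type u) [Field F] [Field K] [Algebra F K] (σ : Type*) :
    Module.FaithfullyFlat (MvPolynomial σ F) (MvPolynomial σ K) :=
  .of_linearEquiv _ _
    (Algebra.IsPushout.equiv F (MvPolynomial σ F) K (MvPolynomial σ K)).symm.toLinearEquiv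

variable {F : Type u} [Field F] {n c : ℕ}

/-- If forms `δ` of degree `e` cut out the empty set on the complete intersection
`f_1 = ⋯ = f_c = 0`, then the ideal generated by the `δ` and by powers of the `f_i` contains all
forms of large degree. -/
theorem mem_span_pow_sup {f : Fin c → MvPolynomial (Fin (n + 1)) F} {d : Fin c → ℕ}
    (hf : ∀ i, (f i).IsHomogeneous (d i))
    (hreg : RingTheory.Sequence.IsWeaklyRegular (MvPolynomial (Fin (n + 1)) F) (List.ofFn f))
    (hc : c ≤ n + 1) {ι : Type*} (δ : ι → MvPolynomial (Fin (n + 1)) F) {e : ℕ}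
    (hδ : ∀ s, (δ s).IsHomogeneous e) {L : ℕ}
    (hL : ∀ i, X i ^ L ∈ genIdeal f ⊔ Ideal.span (Set.range δ)) (a : Fin c → ℕ) {M : ℕ}
    (hM : ∑ i, a i * d i + (n + 1 - c) * e < M + (n + 1)) {w : MvPolynomial (Fin (n + 1)) F}
    (hw : w.IsHomogeneous M) :
    w ∈ Ideal.span (Set.range fun i => f i ^ a i) ⊔ Ideal.span (Set.range δ) := by
  -- general linear combinations are taken over an infinite extension of the base field
  set K := AlgebraicClosure F with hK
  have : Infinite K := IsAlgClosed.instInfinite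
  have := faithfullyFlat_mvPolynomial F K (Fin (n + 1))
  set φ : MvPolynomial (Fin (n + 1)) F →+* MvPolynomial (Fin (n + 1)) K := algebraMap _ _ with hφ
  set I := Ideal.span (Set.range fun i => f i ^ a i) ⊔ Ideal.span (Set.range δ) with hI
  have hφhom : ∀ {g : MvPolynomial (Fin (n + 1)) F} {m : ℕ}, g.IsHomogeneous m →
      (φ g).IsHomogeneous m := fun hg => hg.map _
  -- passing from `f` to `f ^ a` changes the ideal only up to radical
  obtain ⟨L', hL'⟩ : ∃ L', ∀ i, X i ^ L' ∈ I := by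
    have hrad : genIdeal f ⊔ Ideal.span (Set.range δ) ≤ I.radical := by
      refine sup_le (Ideal.span_le.mpr ?_) (le_sup_right.trans Ideal.le_radical)
      rintro _ ⟨i, rfl⟩
      exact ⟨a i, Ideal.mem_sup_left (Ideal.subset_span ⟨i, rfl⟩)⟩
    choose N hN using fun i => hrad (hL i)
    refine ⟨L * Finset.univ.sup N, fun i => ?_⟩
    rw [pow_mul]
    exact Ideal.pow_mem_of_pow_mem I (hN i) (Finset.le_sup (Finset.mem_univ i))
  have hregK : RegSeq ⊥ (List.ofFn fun i => φ (f i)) := by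
    have := hreg.of_flat (S := MvPolynomial (Fin (n + 1)) K)
    rw [List.map_ofFn] at this
    exact regSeq_of_isWeaklyRegular this
  have hregKa := hregK.pow a
  have hdeg : ∀ i, (φ (f i) ^ a i).IsHomogeneous (d i * a i) := fun i => (hφhom (hf i)).pow _
  obtain ⟨E, hcard, hsum, hE⟩ := hasDegrees_span hdeg hregKa c le_rfl
  set V := Submodule.span K (Set.range fun s => φ (δ s)) with hV
  have hspanV : Ideal.span (V : Set (MvPolynomial (Fin (n + 1)) K)) =
      (Ideal.span (Set.range δ)).map φ := by
    rw [hV, Ideal.span, Submodule.span_span_of_tower, Ideal.map_span, ← Set.range_comp]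
    rfl
  have hmap : I.map φ = Ideal.span ((fun i => φ (f i) ^ a i) '' {j | j.1 < c}) ⊔
      Ideal.span (V : Set (MvPolynomial (Fin (n + 1)) K)) := by
    rw [hI, Ideal.map_sup, hspanV, span_image_lt_eq, genIdeal, Ideal.map_span, ← Set.range_comp]
    congr 3
    funext i
    exact map_pow φ _ _
  rw [← Ideal.comap_map_eq_self_of_faithfullyFlat (B := MvPolynomial (Fin (n + 1)) K) I,
    Ideal.mem_comap]
  change φ w ∈ I.map φ
  rw [hmap]
  refine mem_sup_span_of_infinite (n + 1 - c) (span_image_isHomogeneous hdeg _)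
    (fun k hk => vanishes_span hregKa c le_rfl (by omega)) hE (by omega) V (e := e) ?_
    (L := L') ?_ ?_ (hφhom hw)
  · rw [hV, Submodule.span_le]
    rintro _ ⟨s, rfl⟩
    exact hφhom (hδ s)
  · intro i
    have := Ideal.mem_map_of_mem φ (hL' i)
    rw [hmap, map_pow] at this
    convert this
    exact (map_X _ i).symm
  · rw [hsum, Finset.filter_true_of_mem fun l _ => l.2]
    simpa only [mul_comm] using hM

end BaseChange

/-! ### The Jacobian criterion -/

section Jacobian

open MvPolynomial

/-- A weak form of the Cauchy–Binet formula. -/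
theorem det_mul_mem_span {A : Type*} [CommRing A] {ι κ : Type*} [Fintype ι] [DecidableEq ι]
    [Fintype κ] (J : Matrix ι κ A) (β : Matrix κ ι A) :
    (J * β).det ∈ Ideal.span (Set.range fun s : ι → κ => (Matrix.of fun l j => J j (s l)).det) := by
  classical
  have h1 : (J * β).det = Matrix.detRowAlternating fun m => ∑ j, β j m • fun l => J l j := by
    rw [← Matrix.det_transpose]
    change _ = Matrix.det _
    congr 1
    ext m l
    simp [Matrix.mul_apply, mul_comm]
  rw [h1]
  have h2 := (Matrix.detRowAlternating (R := A) (n := ι)).toMultilinearMap.map_sum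
    (fun m j => β j m • fun l => J l j)
  change Matrix.detRowAlternating _ = _ at h2
  rw [h2]
  refine sum_mem fun s _ => ?_
  rw [MultilinearMap.map_smul_univ, smul_eq_mul]
  exact Ideal.mul_mem_left _ _ (Ideal.subset_span ⟨s, rfl⟩)

theorem eval₂_mul_of_isHomogeneous {F B : Type*} [CommRing F] [CommRing B] (φ : F →+* B)
    {σ : Type*} [Fintype σ] {f : MvPolynomial σ F} {d : ℕ} (hf : f.IsHomogeneous d) (y : σ → B)
    (z : B) : eval₂ φ (fun j => y j * z) f = eval₂ φ y f * z ^ d := by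
  rw [eval₂_eq', eval₂_eq', Finset.sum_mul]
  refine Finset.sum_congr rfl fun m hm => ?_
  have hmd : ∑ i, m i = d := by
    rw [← hf (mem_support_iff.mp hm), Finsupp.weight_apply, Finsupp.sum_fintype _ _ (by simp)]
    simp
  simp only [mul_pow]
  rw [Finset.prod_mul_distrib, Finset.prod_pow_eq_pow_sum, hmd, mul_assoc]

/-- Taylor expansion to first order: two homomorphisms from the polynomial ring that agree up to
elements of square zero. -/
theorem sub_eq_sum_pderiv {F C : Type*} [CommRing F] [CommRing C] [Algebra F C] {σ : Type*}
    [Fintype σ] (π τ : MvPolynomial σ F →ₐ[F] C) (N : Ideal C) (hN : ∀ u ∈ N, ∀ v ∈ N, u * v = 0)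
    (h : ∀ j, π (X j) - τ (X j) ∈ N) (y : MvPolynomial σ F) :
    π y - τ y = ∑ j, π (pderiv j y) * (π (X j) - τ (X j)) := by
  classical
  induction y using MvPolynomial.induction_on with
  | C a => simp [← algebraMap_eq]
  | add y z hy hz =>
    simp only [map_add, add_mul, Finset.sum_add_distrib]
    rw [← hy, ← hz]
    ring
  | mul_X y k hy =>
    have hmem : π y - τ y ∈ N := by
      rw [hy]
      exact sum_mem fun j _ => N.mul_mem_left _ (h j)
    have h0 := hN _ hmem _ (h k)
    have h1 : ∀ j, π (pderiv j (y * X k)) * (π (X j) - τ (X j)) =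
        π (X k) * (π (pderiv j y) * (π (X j) - τ (X j))) +
          if j = k then π y * (π (X k) - τ (X k)) else 0 := by
      intro j
      rw [Derivation.leibniz, pderiv_X, Pi.single_apply]
      split_ifs with hjk hkj hkj
      · subst hkj
        simp only [smul_eq_mul, map_add, map_mul, map_one]
        ring
      · exact absurd hjk.symm hkj
      · exact absurd hkj.symm hjk
      · simp only [smul_eq_mul, map_add, map_mul, map_zero]
        ring
    rw [Finset.sum_congr rfl fun j _ => h1 j, Finset.sum_add_distrib, ← Finset.mul_sum, ← hy,
      Finset.sum_ite_eq' Finset.univ k, if_pos (Finset.mem_univ k), map_mul, map_mul]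
    linear_combination -h0

variable {F : Type u} [Field F] {n c : ℕ}

/-- The Jacobian criterion on the chart where `x_i` is invertible, for a flat algebra `T` over the
polynomial ring. A formally smooth algebra `B` over the chart provides, by infinitesimal lifting, a
solution of `f_1 = ⋯ = f_c = 0` modulo the square of the ideal that they generate; comparing it with
the tautological solution yields a right inverse of the Jacobian matrix. -/
theorem map_sup_minorIdeal_eq_top {f : Fin c → MvPolynomial (Fin (n + 1)) F} {d : Fin c → ℕ}
    (hf : ∀ i, (f i).IsHomogeneous (d i))
    (hreg : RingTheory.Sequence.IsWeaklyRegular (MvPolynomial (Fin (n + 1)) F) (List.ofFn f))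
    (i : Fin (n + 1)) (T : Type u) [CommRing T] [Algebra (MvPolynomial (Fin (n + 1)) F) T]
    [Algebra F T] [IsScalarTower F (MvPolynomial (Fin (n + 1)) F) T]
    [Module.Flat (MvPolynomial (Fin (n + 1)) F) T] (I : Ideal T)
    (hI : I = (genIdeal f).map (algebraMap (MvPolynomial (Fin (n + 1)) F) T))
    (B : Type u) [CommRing B] [Algebra F B] [Algebra.FormallySmooth F B]
    (q : B →ₐ[F] T ⧸ I) (b : Fin (n + 1) → B)
    (hb : ∀ j, q (b j) * Ideal.Quotient.mk I (algebraMap (MvPolynomial (Fin (n + 1)) F) T (X i)) =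
      Ideal.Quotient.mk I (algebraMap (MvPolynomial (Fin (n + 1)) F) T (X j)))
    (hbf : ∀ l, aeval b (f l) = 0) :
    (genIdeal f ⊔ minorIdeal f).map (algebraMap (MvPolynomial (Fin (n + 1)) F) T) = ⊤ := by
  let S := MvPolynomial (Fin (n + 1)) F
  set g : T ⧸ I ^ 2 →ₐ[F] T ⧸ I := Ideal.Quotient.factorₐ F (Ideal.pow_le_self two_ne_zero)
    with hg
  have hgmk : ∀ z : T, g (Ideal.Quotient.mk _ z) = Ideal.Quotient.mk _ z := fun z => rfl
  have hgsurj : Function.Surjective g := fun z => by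
    obtain ⟨z, rfl⟩ := Ideal.Quotient.mk_surjective z
    exact ⟨Ideal.Quotient.mk _ z, rfl⟩
  have hker : ∀ u ∈ RingHom.ker g, ∃ z ∈ I, Ideal.Quotient.mk (I ^ 2) z = u := by
    intro u hu
    obtain ⟨z, rfl⟩ := Ideal.Quotient.mk_surjective u
    exact ⟨z, Ideal.Quotient.eq_zero_iff_mem.mp hu, rfl⟩
  have hsq : ∀ u ∈ RingHom.ker g, ∀ v ∈ RingHom.ker g, u * v = 0 := by
    intro u hu v hv
    obtain ⟨y, hy, rfl⟩ := hker u hu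
    obtain ⟨z, hz, rfl⟩ := hker v hv
    rw [← map_mul, Ideal.Quotient.eq_zero_iff_mem, pow_two]
    exact Ideal.mul_mem_mul hy hz
  have hnil : IsNilpotent (RingHom.ker (g : T ⧸ I ^ 2 →+* T ⧸ I)) := by
    refine ⟨2, (pow_two _).trans (eq_bot_iff.mpr ?_)⟩
    rw [Ideal.mul_le]
    exact hsq
  set s₀ : B →ₐ[F] T ⧸ I ^ 2 := Algebra.FormallySmooth.liftOfSurjective q g hgsurj hnil with hs₀
  have hs₀g : ∀ z, g (s₀ z) = q z :=
    fun z => Algebra.FormallySmooth.liftOfSurjective_apply q g hgsurj hnil z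
  set π : S →ₐ[F] T ⧸ I ^ 2 :=
    (Ideal.Quotient.mkₐ F (I ^ 2)).comp (IsScalarTower.toAlgHom F S T) with hπ
  have hπmk : ∀ y, π y = Ideal.Quotient.mk (I ^ 2) (algebraMap S T y) := fun y => rfl
  -- `τ` is the solution lifted from `B`, rescaled by `x_i`; `π` is the tautological point
  set τ : S →ₐ[F] T ⧸ I ^ 2 := aeval fun j => s₀ (b j) * π (X i) with hτ
  have hτf : ∀ l, τ (f l) = 0 := by
    intro l
    rw [hτ, aeval_def, eval₂_mul_of_isHomogeneous _ (hf l), ← aeval_def]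
    have : aeval (fun j => s₀ (b j)) (f l) = s₀ (aeval b (f l)) := by
      rw [← comp_aeval_apply]
    rw [this, hbf, map_zero, zero_mul]
  have hθ : ∀ j, π (X j) - τ (X j) ∈ RingHom.ker g := by
    intro j
    rw [RingHom.mem_ker, map_sub, hτ, aeval_X, map_mul, hs₀g, hπmk, hπmk, hgmk, hgmk, hb,
      sub_self]
  have htaylor : ∀ l, π (f l) = ∑ j, π (pderiv j (f l)) * (π (X j) - τ (X j)) := by
    intro l
    rw [← sub_eq_sum_pderiv π τ _ hsq hθ, hτf, sub_zero]
  have hgen : ∀ z ∈ I, ∃ β : Fin c → T, ∑ m, β m * algebraMap S T (f m) = z := by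
    intro z hz
    rw [hI, genIdeal, Ideal.map_span, ← Set.range_comp] at hz
    exact Ideal.mem_span_range_iff_exists_fun.mp hz
  choose θ hθI hθ' using fun j => hker _ (hθ j)
  choose β hβ using fun j => hgen _ (hθI j)
  set D : Matrix (Fin c) (Fin c) T :=
    Matrix.of (fun l j => algebraMap S T (pderiv j (f l))) * Matrix.of β with hD
  -- `f_l - ∑_m D_{lm} f_m` lies in `I ^ 2`, so it equals `∑_m γ_m f_m` with `γ_m ∈ I`; by
  -- regularity, the coefficients `δ_{lm} - D_{lm} - γ_m` of the resulting relation lie in `I`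
  have hone : ∀ l m, (1 : Matrix (Fin c) (Fin c) T) l m - D l m ∈ I := by
    intro l
    have h1 : algebraMap S T (f l) - ∑ j, algebraMap S T (pderiv j (f l)) * θ j ∈ I ^ 2 := by
      rw [← Ideal.Quotient.eq_zero_iff_mem, map_sub, map_sum, ← hπmk, htaylor, sub_eq_zero]
      refine Finset.sum_congr rfl fun j _ => ?_
      rw [map_mul, hθ', hπmk]
    have h2 : ∃ γ : Fin c → T, (∀ m, γ m ∈ I) ∧ ∑ m, γ m * algebraMap S T (f m) =
        algebraMap S T (f l) - ∑ j, algebraMap S T (pderiv j (f l)) * θ j := by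
      refine Submodule.smul_induction_on (p := fun z => ∃ γ : Fin c → T, (∀ m, γ m ∈ I) ∧
        ∑ m, γ m * algebraMap S T (f m) = z) (by rwa [pow_two] at h1) ?_ ?_
      · intro y hy z hz
        obtain ⟨γ, hγ⟩ := hgen z hz
        refine ⟨fun m => y * γ m, fun m => I.mul_mem_right _ hy, ?_⟩
        rw [smul_eq_mul, ← hγ, Finset.mul_sum]
        exact Finset.sum_congr rfl fun m _ => mul_assoc _ _ _
      · rintro y z ⟨γ, hγ, rfl⟩ ⟨γ', hγ', rfl⟩
        refine ⟨fun m => γ m + γ' m, fun m => add_mem (hγ m) (hγ' m), ?_⟩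
        rw [← Finset.sum_add_distrib]
        exact Finset.sum_congr rfl fun m _ => add_mul _ _ _
    obtain ⟨γ, hγI, hγ⟩ := h2
    have hregT : RegSeq ⊥ (List.ofFn fun m => algebraMap S T (f m)) := by
      have := hreg.of_flat (S := T)
      rw [List.map_ofFn] at this
      exact regSeq_of_isWeaklyRegular this
    intro m
    have h3 := hregT.mem_of_sum_mem
      (fun m => (1 : Matrix (Fin c) (Fin c) T) l m - D l m - γ m) (by
        rw [Ideal.mem_bot]
        have e1 : ∑ m, algebraMap S T (f m) * (1 : Matrix (Fin c) (Fin c) T) l m =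
            algebraMap S T (f l) := by
          simp [Matrix.one_apply]
        have e2 : ∑ m, algebraMap S T (f m) * D l m =
            ∑ j, algebraMap S T (pderiv j (f l)) * θ j := by
          simp only [hD, Matrix.mul_apply, Matrix.of_apply, ← hβ, Finset.mul_sum]
          rw [Finset.sum_comm]
          exact Finset.sum_congr rfl fun j _ => Finset.sum_congr rfl fun m _ => by ring
        have e3 : ∑ m, algebraMap S T (f m) * γ m = ∑ m, γ m * algebraMap S T (f m) :=
          Finset.sum_congr rfl fun m _ => mul_comm _ _
        simp only [mul_sub, Finset.sum_sub_distrib]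
        rw [e1, e2, e3, hγ, sub_self]) m
    have h4 : Ideal.span (Set.range fun m => algebraMap S T (f m)) = I := by
      rw [hI, genIdeal, Ideal.map_span, ← Set.range_comp]
      rfl
    rw [bot_sup_eq, h4] at h3
    have := add_mem h3 (hγI m)
    rwa [sub_add_cancel] at this
  have hdet : 1 - D.det ∈ I := by
    rw [← Ideal.Quotient.eq_zero_iff_mem, map_sub, RingHom.map_det, ← Matrix.det_one (n := Fin c),
      RingHom.map_det, sub_eq_zero]
    congr 1
    ext l m
    exact Ideal.Quotient.eq.mpr (hone l m)
  have hminor : D.det ∈ (minorIdeal f).map (algebraMap S T) := by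
    refine Ideal.span_le.mpr ?_ (det_mul_mem_span _ _)
    rintro _ ⟨s, rfl⟩
    have := Ideal.mem_map_of_mem (algebraMap S T) (Ideal.subset_span ⟨s, rfl⟩ : _ ∈ minorIdeal f)
    rw [RingHom.map_det] at this
    exact this
  rw [Ideal.eq_top_iff_one, Ideal.map_sup, ← sub_add_cancel 1 D.det, ← hI]
  exact Submodule.add_mem_sup hdet hminor

end Jacobian

/-! ### Smoothness of `Proj` on the standard charts -/

section Chart

open MvPolynomial AlgebraicGeometry CategoryTheory HomogeneousLocalization

/-- If `Proj 𝒜` is smooth over `F`, so is the coordinate ring of the chart where `x` is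
invertible. -/
theorem smooth_away_of_smooth_proj {F A : Type u} [CommRing F] [CommRing A] [Algebra F A]
    (𝒜 : ℕ → Submodule F A) [GradedAlgebra 𝒜]
    (h : AlgebraicGeometry.Smooth (Proj.toSpecZero 𝒜 ≫
      Spec.map (CommRingCat.ofHom (algebraMap F (𝒜 0))))) {x : A} (hx : x ∈ 𝒜 1) :
    ((fromZeroRingHom 𝒜 (Submonoid.powers x)).comp (algebraMap F (𝒜 0))).Smooth := by
  have h1 : AlgebraicGeometry.Smooth (Proj.awayι 𝒜 x hx Nat.one_pos ≫ Proj.toSpecZero 𝒜 ≫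
      Spec.map (CommRingCat.ofHom (algebraMap F (𝒜 0)))) := inferInstance
  rw [Proj.awayι_toSpecZero_assoc, ← Spec.map_comp,
    HasRingHomProperty.Spec_iff (P := @AlgebraicGeometry.Smooth)] at h1
  exact h1

variable {F : Type u} [Field F] {n c : ℕ}

attribute [local instance] MvPolynomial.gradedAlgebra

/-- The Jacobian criterion, projective form: the ideal generated by the forms `f_i` and the
maximal minors of the Jacobian matrix contains a power of each variable. -/
theorem exists_X_pow_mem_of_definesSmoothProj {f : Fin c → MvPolynomial (Fin (n + 1)) F}
    {d : Fin c → ℕ} (hf : ∀ i, (f i).IsHomogeneous (d i))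
    (hreg : RingTheory.Sequence.IsWeaklyRegular (MvPolynomial (Fin (n + 1)) F) (List.ofFn f))
    (hsmooth : DefinesSmoothProj hf) (i : Fin (n + 1)) :
    ∃ L : ℕ, (X i : MvPolynomial (Fin (n + 1)) F) ^ L ∈ genIdeal f ⊔ minorIdeal f := by
  let : GradedAlgebra (stdGrading f) := quotientGradedAlgebra _ _ (genIdeal_isHomogeneous hf)
  have h0 := smooth_away_of_smooth_proj (stdGrading f) hsmooth (varClass_mem f i)
  let T := Localization.Away (X i : MvPolynomial (Fin (n + 1)) F)
  let B := HomogeneousLocalization.Away (stdGrading f) (varClass f i)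
  let φ : F →+* B := (fromZeroRingHom (stdGrading f) (Submonoid.powers (varClass f i))).comp
    (algebraMap F (stdGrading f 0))
  let : Algebra F B := φ.toAlgebra
  have hB : Algebra.Smooth F B := h0
  let I : Ideal T := (genIdeal f).map (algebraMap (MvPolynomial (Fin (n + 1)) F) T)
  let A := MvPolynomial (Fin (n + 1)) F ⧸ genIdeal f
  let A' := Localization.Away (varClass f i)
  -- The homomorphism `S/I → S_{x_i}/I S_{x_i}` and its extension to the localization at `x_i`.
  let ψ : MvPolynomial (Fin (n + 1)) F ⧸ genIdeal f →+* T ⧸ I :=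
    Ideal.quotientMap I (algebraMap (MvPolynomial (Fin (n + 1)) F) T) Ideal.le_comap_map
  have hψ : ∀ y, ψ (Ideal.Quotient.mk _ y) =
      Ideal.Quotient.mk I (algebraMap (MvPolynomial (Fin (n + 1)) F) T y) :=
    fun _ => rfl
  have hunit : IsUnit (ψ (varClass f i)) := by
    rw [varClass, hψ]
    exact (IsLocalization.Away.algebraMap_isUnit (S := T) (X i)).map _
  let ψ' : A' →+* T ⧸ I := Localization.awayLift ψ _ hunit
  have hψ' : ∀ y, ψ' (algebraMap A A' y) = ψ y := fun y => IsLocalization.Away.lift_eq _ hunit y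
  let v : B →+* A' := algebraMap B A'
  have hv : Function.Injective v := val_injective _
  have hvφ : ∀ a, v (φ a) = algebraMap A A' (Ideal.Quotient.mk (genIdeal f) (C a)) := by
    intro a
    rfl
  let q : B →ₐ[F] T ⧸ I :=
    { ψ'.comp v with
      commutes' := fun a => by
        change ψ' (v (φ a)) = _
        rw [hvφ, hψ', hψ]
        rfl }
  let b : Fin (n + 1) → B := fun j =>
    Away.mk (stdGrading f) (varClass_mem f i) 1 (varClass f j) (varClass_mem f j)
  have hbv : ∀ j, v (b j) * algebraMap A A' (varClass f i) = algebraMap A A' (varClass f j) := by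
    intro j
    change Localization.mk (varClass f j) _ * _ = _
    rw [← Localization.mk_one_eq_algebraMap, ← Localization.mk_one_eq_algebraMap,
      Localization.mk_mul, Localization.mk_eq_mk_iff, Localization.r_iff_exists]
    exact ⟨1, by simp [mul_comm]⟩
  have hb : ∀ j, q (b j) * Ideal.Quotient.mk I (algebraMap (MvPolynomial (Fin (n + 1)) F) T (X i)) =
      Ideal.Quotient.mk I (algebraMap (MvPolynomial (Fin (n + 1)) F) T (X j)) := by
    intro j
    have := congrArg ψ' (hbv j)
    rw [map_mul, hψ', hψ'] at this
    exact this
  have hbf : ∀ l, aeval b (f l) = 0 := by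
    intro l
    refine hv ?_
    have hu : IsUnit (algebraMap A A' (varClass f i) ^ d l) :=
      (IsLocalization.Away.algebraMap_isUnit (varClass f i)).pow _
    refine hu.mul_right_cancel ?_
    rw [map_zero, zero_mul, aeval_def, hom_eval₂,
      ← eval₂_mul_of_isHomogeneous _ (hf l)]
    have : eval₂ (v.comp (algebraMap F B))
        (fun j => (v ∘ b) j * algebraMap A A' (varClass f i)) (f l) =
          algebraMap A A' (Ideal.Quotient.mk (genIdeal f) (f l)) := by
      rw [← RingHom.comp_apply, ← coe_eval₂Hom]
      refine DFunLike.congr_fun (ringHom_ext (fun a => ?_) fun j => ?_) (f l)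
      · rw [coe_eval₂Hom, eval₂_C]
        exact hvφ a
      · rw [coe_eval₂Hom, eval₂_X]
        exact hbv j
    refine Eq.trans this ?_
    rw [Ideal.Quotient.eq_zero_iff_mem.mpr (Ideal.subset_span (Set.mem_range_self l)), map_zero]
  have htop := map_sup_minorIdeal_eq_top hf hreg i T I rfl B q b hb hbf
  rw [Ideal.eq_top_iff_one, ← map_one (algebraMap (MvPolynomial (Fin (n + 1)) F) T),
    IsLocalization.algebraMap_mem_map_algebraMap_iff
      (Submonoid.powers (X i : MvPolynomial (Fin (n + 1)) F))] at htop
  obtain ⟨_, ⟨L, rfl⟩, hL⟩ := htop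
  exact ⟨L, by simpa using hL⟩

end Chart

/-! ### Degrees of the forms and of the minors -/

section Degrees

open MvPolynomial

variable {F : Type u} [Field F] {n c : ℕ}

/-- The forms of a regular sequence have positive degree. -/
theorem RegSeq.degree_pos {f : Fin c → MvPolynomial (Fin (n + 1)) F} {d : Fin c → ℕ}
    (hf : ∀ i, (f i).IsHomogeneous (d i)) (hreg : RegSeq ⊥ (List.ofFn f))
    (htop : genIdeal f ≠ ⊤) (i : Fin c) : 0 < d i := by
  refine Nat.pos_of_ne_zero fun hi => ?_
  have h0 : f i = C (coeff 0 (f i)) :=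
    totalDegree_eq_zero_iff_eq_C.mp (Nat.le_zero.mp (hi ▸ (hf i).totalDegree_le))
  have hfi : f i ∈ genIdeal f := Ideal.subset_span ⟨i, rfl⟩
  by_cases ha : coeff 0 (f i) = 0
  · rw [ha, map_zero] at h0
    have h1 := (regSeq_ofFn_iff f ⊥).mp hreg i 1 (by rw [h0, zero_mul]; exact zero_mem _)
    rw [bot_sup_eq] at h1
    exact htop ((Ideal.eq_top_iff_one _).mpr (Ideal.span_mono (Set.image_subset_range _ _) h1))
  · exact htop (Ideal.eq_top_of_isUnit_mem _ hfi (h0 ▸ (isUnit_iff_ne_zero.mpr ha).map C))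

theorem isHomogeneous_det_pderiv {f : Fin c → MvPolynomial (Fin (n + 1)) F} {d : Fin c → ℕ}
    (hf : ∀ i, (f i).IsHomogeneous (d i)) (s : Fin c → Fin (n + 1)) :
    (Matrix.of fun l j => pderiv (s l) (f j)).det.IsHomogeneous (∑ j, (d j - 1)) := by
  rw [Matrix.det_apply]
  refine IsHomogeneous.sum _ _ _ fun τ _ => ?_
  have : (∏ j, pderiv (s (τ j)) (f j)).IsHomogeneous (∑ j, (d j - 1)) :=
    IsHomogeneous.prod _ _ _ fun j _ => (hf j).pderiv
  rw [Units.smul_def]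
  exact (homogeneousSubmodule (Fin (n + 1)) F _).toAddSubgroup.zsmul_mem this _

theorem lt_mul_of_cast_le {d : Fin c → ℕ} (hd : ∀ i, 0 < d i) (hc : c ≤ n + 1) {m : ℕ}
    (h : ((n : ℤ) + 1 - c) * ((∑ j, (d j : ℤ)) - c) + 1 ≤ m) :
    (n + 1 - c) * ∑ j, (d j - 1) < m := by
  have h1 : ((∑ j, (d j - 1) : ℕ) : ℤ) = (∑ j, (d j : ℤ)) - c := by
    rw [Nat.cast_sum, Finset.sum_congr rfl fun j _ => Nat.cast_sub (R := ℤ) (hd j)]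
    simp
  rw [← h1] at h
  zify
  rw [Nat.cast_sub hc]
  push_cast at h ⊢
  exact Int.lt_iff_add_one_le.mpr h

theorem genIdeal_ne_top {A : Type*} [CommRing A] {f : Fin c → A}
    (hreg : RingTheory.Sequence.IsRegular A (List.ofFn f)) : genIdeal f ≠ ⊤ := by
  intro h
  refine hreg.top_ne_smul ?_
  have : Ideal.ofList (List.ofFn f) = genIdeal f := by
    rw [Ideal.ofList, genIdeal]
    congr 1
    ext
    simp [List.mem_ofFn]
  rw [this, h, Submodule.top_smul]

end Degrees

section Injectivity

open MvPolynomial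

variable {F : Type u} [Field F] {n c : ℕ}

/-- Injectivity on the top local cohomology of the polynomial ring, for forms that define a smooth
projective scheme and satisfy the degree bound. -/
theorem mem_powIdeal_of_definesSmoothProj {p t : ℕ} [Fact p.Prime] [CharP F p] (htp : t ≤ p)
    {f : Fin c → MvPolynomial (Fin (n + 1)) F} {d : Fin c → ℕ}
    (hf : ∀ i, (f i).IsHomogeneous (d i))
    (hreg : RingTheory.Sequence.IsWeaklyRegular (MvPolynomial (Fin (n + 1)) F) (List.ofFn f))
    (hc : c ≤ n + 1) (hsmooth : DefinesSmoothProj hf)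
    (hb : ∀ i, (n + 1 - c) * ∑ j, (d j - 1) < t * d i) (N m : ℕ)
    (s : MvPolynomial (Fin (n + 1)) F) (hs : s.IsHomogeneous m)
    (hmd : m + ∑ i, d i = N * (n + 1)) (hfs : ∀ l, f l * s ∈ powIdeal F n N)
    (h : (∏ l, f l) ^ (p - t) * s ^ p ∈ powIdeal F n (p * N)) : s ∈ powIdeal F n N := by
  choose L hL using exists_X_pow_mem_of_definesSmoothProj hf hreg hsmooth
  have hL' : ∀ i, (X i : MvPolynomial (Fin (n + 1)) F) ^ Finset.univ.sup L ∈
      genIdeal f ⊔ minorIdeal f := fun i =>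
    Ideal.mem_of_dvd _ (pow_dvd_pow _ (Finset.le_sup (Finset.mem_univ i))) (hL i)
  exact mem_powIdeal_of_prod_mul_pow_mem htp hf hb
    (fun a M hM w hw => mem_span_pow_sup hf hreg hc _
      (isHomogeneous_det_pderiv hf) hL' a hM hw) hs hmd hfs h

end Injectivity

end FrobCI

/-- The hypotheses put `f_1, …, f_c` in `F[x_0, …, x_n]` with `deg f_i = d i`; the inequality in
`hbound` reads `t d_i ≥ (n + 1 - c) (∑ d_i - c) + 1`. -/
theorem theorem4p1 {F : Type u} [Field F] (p : ℕ) [Fact p.Prime] [CharP F p] (n c : ℕ)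
    (f : Fin c → MvPolynomial (Fin (n + 1)) F) (d : Fin c → ℕ)
    (hf : ∀ i, (f i).IsHomogeneous (d i))
    (hreg : RingTheory.Sequence.IsRegular (MvPolynomial (Fin (n + 1)) F) (List.ofFn f))
    (hsmooth : FrobCI.DefinesSmoothProj hf)
    (t : ℕ) (htp : t ≤ p)
    (hbound : ∀ i, ((n : ℤ) + 1 - c) * ((∑ j, (d j : ℤ)) - c) + 1 ≤ t * d i) :
    Function.Injective (FrobCI.frobeniusLocalCohomologyZero p f t htp (n + 1 - c)) := by
  have hseq := FrobCI.regSeq_of_isWeaklyRegular hreg.toIsWeaklyRegular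
  have htop := FrobCI.genIdeal_ne_top hreg
  have hd := hseq.degree_pos hf htop
  have hc := hseq.le_succ hf hd htop
  exact FrobCI.injective_of_top htp hf hseq hc (FrobCI.top_of_polynomial
    (FrobCI.mem_powIdeal_of_definesSmoothProj htp hf hreg.toIsWeaklyRegular hc hsmooth
      fun i => FrobCI.lt_mul_of_cast_le hd hc (by exact_mod_cast hbound i)))
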